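/- A graph is outerplanar if it has a crossing-free drawing in a closed disc of the plane (edges being arbitrary arcs) with all its vertices on the boundary circle of the disc. Two perfect matchings $M, M'$ of a simple graph $G$ differ by a flip if their symmetric difference $M \mathbin{\triangle} M'$ is the edge set of a cycle of length four. A reconfiguration sequence of length $q$ between perfect matchings $M$ and $N$ of $G$ is a sequence $M = M_0, M_1, \dots, M_q = N$ of perfect matchings of $G$ such that $M_{i-1}$ and $M_i$ differ by a flip for $1 \le i \le q$. The problem Perfect Matching Reconfiguration asks, given $G$ and two perfect matchings $M_{\mathrm{ini}}, M_{\mathrm{tar}}$ of $G$, whether there is a reconfiguration sequence between $M_{\mathrm{ini}}$ and $M_{\mathrm{tar}}$ (a YES-instance) or not (a NO-instance). Theorem. There are a random access machine program and a constant $C$ such that for every finite simple outerplanar graph $G=(V,E)$ with $V = \{0,\dots,|V|-1\}$, given as a list of its edges in any order, and all perfect matchings $M_{\mathrm{ini}}, M_{\mathrm{tar}}$ of $G$, given by the partner of each vertex, the program halts after at most $C(|V|+|E|+1)$ steps and correctly answers whether $(G, M_{\mathrm{ini}}, M_{\mathrm{tar}})$ is a YES-instance. Moreover, for every YES-instance it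 outputs, within the same number of steps, a reconfiguration sequence between $M_{\mathrm{ini}}$ and $M_{\mathrm{tar}}$ of length at most $C|V|$, written as the list of the successive 4-cycles along which the flips take place. Here the machine has finitely many registers and arrays holding natural numbers; its unit-cost operations are assigning a constant, copying, adding or subtracting one, reading and writing an array cell whose index is in a register, and comparing two registers. -/

import Mathlib

/-! ### Outerplanar graphs -/

/-- `A` is an arc in the plane (an injective continuous image of the unit interval)
with endpoints `a` and `b`. -/
def IsArcBetween (A : Set ℂ) (a b : ℂ) : Prop :=
  ∃ p : Path a b, Function.Injective p ∧ Set.range p = A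

/-- A graph is outerplanar if it has a crossing-free drawing in a closed disc of the plane with all
its vertices on the boundary circle: vertices are distinct points of the circle, every edge is an
arc in the disc joining its two ends, an edge passes through no vertex other than its ends, and two
different edges meet at most in the point of a common end.
(Edges are arbitrary arcs, not necessarily straight.) -/
def IsOuterplanar {V : Type*} (G : SimpleGraph V) : Prop :=
  ∃ (pos : V → ℂ) (arc : Sym2 V → Set ℂ),
    Function.Injective pos ∧
    (∀ v, pos v ∈ Metric.sphere (0 : ℂ) 1) ∧
    (∀ u v, G.Adj u v → IsArcBetween (arc s(u, v)) (pos u) (pos v)) ∧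
    (∀ e ∈ G.edgeSet, arc e ⊆ Metric.closedBall (0 : ℂ) 1) ∧
    (∀ e ∈ G.edgeSet, ∀ w, pos w ∈ arc e → w ∈ e) ∧
    (∀ e ∈ G.edgeSet, ∀ f ∈ G.edgeSet, e ≠ f →
      ∀ x ∈ arc e ∩ arc f, ∃ w, w ∈ e ∧ w ∈ f ∧ pos w = x)

/-! ### Flips and reconfiguration sequences of perfect matchings -/

/-- The perfect matchings `M` and `M'` of `G` differ by the flip along the 4-cycle `a b c d`:
their symmetric difference consists of the four edges of this cycle. -/
def FlipAlong {V : Type*} {G : SimpleGraph V} (a b c d : V) (M M' : G.Subgraph) : Prop :=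
  M.IsPerfectMatching ∧ M'.IsPerfectMatching ∧ [a, b, c, d].Nodup ∧
    symmDiff M.edgeSet M'.edgeSet = {s(a, b), s(b, c), s(c, d), s(d, a)}

/-- Two perfect matchings are adjacent if they differ by a flip. -/
def FlipAdj {V : Type*} {G : SimpleGraph V} (M M' : G.Subgraph) : Prop :=
  ∃ a b c d : V, FlipAlong a b c d M M'

/-- `S 0, S 1, …, S q` is a reconfiguration sequence (of length `q`) between `M` and `N`. -/
def IsReconfSeq {V : Type*} {G : SimpleGraph V} (M N : G.Subgraph) (q : ℕ)
    (S : ℕ → G.Subgraph) : Prop :=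
  S 0 = M ∧ S q = N ∧ ∀ i < q, FlipAdj (S i) (S (i + 1))

/-- The instance `(G, M, N)` of Perfect Matching Reconfiguration is a YES-instance. -/
def Reconfigurable {V : Type*} {G : SimpleGraph V} (M N : G.Subgraph) : Prop :=
  ∃ (q : ℕ) (S : ℕ → G.Subgraph), IsReconfSeq M N q S

/-! ### Random access machines

A program uses a fixed finite set of registers and a fixed finite set of arrays (those it mentions),
each array cell and each register holding a natural number. Elementary operations cost one step.
The only arithmetic is adding or subtracting one, so that in `t` steps no number can grow
beyond the largest constant or input number plus `t`: a computation with a linear number of steps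
only handles numbers of logarithmically many bits, and the unit cost measure is the usual one. -/

namespace RAM

/-- Contents of the registers, and of the arrays: `mem a i` is cell `i` of array `a`. -/
structure State where
  reg : ℕ → ℕ
  mem : ℕ → ℕ → ℕ

/-- Tests comparing two registers. -/
inductive Test where
  | eq (x y : ℕ)
  | lt (x y : ℕ)

/-- Structured programs; `x`, `y` are registers, `a` is an array, `c` is a constant. -/
inductive Program where
  /-- `x := c` -/
  | const (x c : ℕ)
  /-- `x := y` -/
  | copy (x y : ℕ)
  /-- `x := y + 1` -/
  | succ (x y : ℕ)
  /-- `x := y - 1` (and `x := 0` if `y` holds `0`) -/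
  | pred (x y : ℕ)
  /-- `x := a[y]` -/
  | load (x a y : ℕ)
  /-- `a[x] := y` -/
  | store (a x y : ℕ)
  /-- first `p`, then `q` -/
  | seq (p q : Program)
  /-- if `b` then `p` else `q` -/
  | ite (b : Test) (p q : Program)
  /-- while `b` do `p` -/
  | loop (b : Test) (p : Program)

def Test.Holds (s : State) : Test → Prop
  | .eq x y => s.reg x = s.reg y
  | .lt x y => s.reg x < s.reg y

/-- Write `v` into register `x`. -/
def State.setReg (s : State) (x v : ℕ) : State :=
  { s with reg := Function.update s.reg x v }

/-- Write `v` into cell `i` of array `a`. -/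
def State.setMem (s : State) (a i v : ℕ) : State :=
  { s with mem := Function.update s.mem a (Function.update (s.mem a) i v) }

/-- `Exec p s t s'`: program `p`, started in state `s`, halts after exactly `t` steps in state
`s'`. Every elementary operation and every evaluation of a test is one step. -/
inductive Exec : Program → State → ℕ → State → Prop where
  | const (s : State) (x c : ℕ) : Exec (.const x c) s 1 (s.setReg x c)
  | copy (s : State) (x y : ℕ) : Exec (.copy x y) s 1 (s.setReg x (s.reg y))
  | succ (s : State) (x y : ℕ) : Exec (.succ x y) s 1 (s.setReg x (s.reg y + 1))
  | pred (s : State) (x y : ℕ) : Exec (.pred x y) s 1 (s.setReg x (s.reg y - 1))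
  | load (s : State) (x a y : ℕ) : Exec (.load x a y) s 1 (s.setReg x (s.mem a (s.reg y)))
  | store (s : State) (a x y : ℕ) : Exec (.store a x y) s 1 (s.setMem a (s.reg x) (s.reg y))
  | seq {p q : Program} {s s' s'' : State} {t u : ℕ} :
      Exec p s t s' → Exec q s' u s'' → Exec (.seq p q) s (t + u) s''
  | ite_true {b : Test} {p q : Program} {s s' : State} {t : ℕ} :
      b.Holds s → Exec p s t s' → Exec (.ite b p q) s (1 + t) s'
  | ite_false {b : Test} {p q : Program} {s s' : State} {t : ℕ} :
      ¬ b.Holds s → Exec q s t s' → Exec (.ite b p q) s (1 + t) s'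
  | loop_false {b : Test} {p : Program} {s : State} :
      ¬ b.Holds s → Exec (.loop b p) s 1 s
  | loop_true {b : Test} {p : Program} {s s' s'' : State} {t u : ℕ} :
      b.Holds s → Exec p s t s' → Exec (.loop b p) s' u s'' → Exec (.loop b p) s (1 + t + u) s''

end RAM

/-! ### Input and output -/

/-- `L` lists every edge of `G` exactly once, in any order and with its ends in any order. -/
def IsEdgeList {n : ℕ} (G : SimpleGraph (Fin n)) (L : List (Fin n × Fin n)) : Prop :=
  (L.map fun e => s(e.1, e.2)).Nodup ∧ ∀ u v, G.Adj u v ↔ (u, v) ∈ L ∨ (v, u) ∈ L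

/-- `mate v` is the vertex matched with `v` in `M`. -/
def IsMateFun {n : ℕ} {G : SimpleGraph (Fin n)} (M : G.Subgraph) (mate : Fin n → Fin n) : Prop :=
  ∀ v, M.Adj v (mate v)

/-- The initial memory. Register 0 holds the number of vertices, register 1 the number of edges;
arrays 0 and 1 hold the first and second ends of the listed edges, arrays 2 and 3 the two given
perfect matchings, as the partner of each vertex. Everything else is 0. -/
def inputState {n : ℕ} (L : List (Fin n × Fin n)) (mateIni mateTar : Fin n → Fin n) :
    RAM.State where
  reg := fun
    | 0 => n
    | 1 => L.length
    | _ => 0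
  mem := fun
    | 0, i => if h : i < L.length then (L[i].1 : ℕ) else 0
    | 1, i => if h : i < L.length then (L[i].2 : ℕ) else 0
    | 2, i => if h : i < n then (mateIni ⟨i, h⟩ : ℕ) else 0
    | 3, i => if h : i < n then (mateTar ⟨i, h⟩ : ℕ) else 0
    | _, _ => 0

/-- The final memory `s` contains a reconfiguration sequence between `M` and `N`, given by its
successive flips: register 1 holds its length `q`, and for `i < q` cell `i` of the arrays 0, 1, 2, 3
holds the four vertices, in cyclic order, of the 4-cycle flipped in step `i`. -/
def OutputsReconfSeq {n : ℕ} {G : SimpleGraph (Fin n)} (M N : G.Subgraph) (s : RAM.State) : Prop :=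
  ∃ S : ℕ → G.Subgraph, IsReconfSeq M N (s.reg 1) S ∧
    ∀ i < s.reg 1, ∃ a b c d : Fin n,
      s.mem 0 i = a ∧ s.mem 1 i = b ∧ s.mem 2 i = c ∧ s.mem 3 i = d ∧
        FlipAlong a b c d (S i) (S (i + 1))

/-! Cutting the boundary circle at a point orders the vertices linearly so that no two edges
interleave. The topological input is `exists_eq_of_interleaved`: two paths in a disc whose ends
alternate on the circle must meet. Two combinatorial facts follow. The vertices lying under an edge
of a perfect matching are matched among themselves, so every perfect matching joins even ranks to
odd ranks (`NonCrossing.colour_mate`). And every cycle visits its vertices in circular order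
(`NonCrossing.pairwise_lt_of_cycle`).

The union of the two matchings splits into alternating cycles, a common edge counting as a cycle of
length two. Each cycle, with the edges of `G` that join its vertices of opposite colour, is a
polygon with non-crossing chords. If it has more than two vertices, it contains an ear: successive
vertices `a b c d` such that no chord ends in `b` or `c`. Cutting off ears shows that a polygon of
length `k` has degree sum at most `3k - 4`, and that in the case of equality each ear is closed by
an edge `ad`; the polygon is then quadrangulated. The criterion is that the instance is a
YES-instance if and only if every alternating cycle attains this bound.

Necessity (`IsBlock.degSum_eq_of_reconfigurable`): for an ear of what is left of a cycle, the
initial and final partners of `b` lie on different sides of `b` in the order. So some flip moves the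
partner of `b` across, along a 4-cycle `b y z y'`; planarity and colours force `y = a`, `y' = c`, `z
= d`, hence `ad` is an edge. Induction continues with the ear removed.

Sufficiency (`ScanInv.reduce`): in the 4-cycle `a b c d` one matching contains `ab` and `cd`, the
other contains `bc`. Flipping the former makes both contain `bc` and leaves a shorter alternating
polygon through `ad`. In the end the two modified matchings agree. The flips of the first matching,
followed by those of the second in reverse order, form the sequence; a cycle of length `k` costs
`k/2 - 1` flips.

The program lists the alternating cycles, counts the degrees inside them, compares the total with
the sum of the bounds, and finds ears with a stack: a quadrangle is on top exactly when the two
middle ones of the top four vertices have degree two. Each cut shortens the stack, so the scan takes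
linear time. -/

open scoped List

/-! ### Crossing paths in a disc -/

/-- A continuous angle that stays in the half-plane centred at the direction `c` changes by the
difference of any two representatives of its end values in that half-plane. -/
lemma angle_change_of_cos_nonneg {h : ℝ → ℝ} (hc : Continuous h) {c x y : ℝ}
    (hcos : ∀ s ∈ Set.Icc (0 : ℝ) 1, 0 ≤ Real.cos (h s - c))
    (hx : ∃ k : ℤ, h 0 = x + k * (2 * Real.pi)) (hy : ∃ k : ℤ, h 1 = y + k * (2 * Real.pi))
    (hx1 : c - Real.pi / 2 ≤ x) (hx2 : x ≤ c + Real.pi / 2)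
    (hy1 : c - Real.pi / 2 ≤ y) (hy2 : y ≤ c + Real.pi / 2) :
    h 1 - h 0 = y - x := by
  have hpi := Real.pi_pos
  obtain ⟨k, hk⟩ := hx
  obtain ⟨m, hm⟩ := hy
  have key : ∀ v, v ∈ Set.uIcc (h 0) (h 1) → 0 ≤ Real.cos (v - c) := by
    intro v hv
    have := intermediate_value_uIcc (a := (0 : ℝ)) (b := 1) (f := h) hc.continuousOn hv
    obtain ⟨s, hs, rfl⟩ := this
    rw [Set.uIcc_of_le zero_le_one] at hs
    exact hcos s hs
  -- The cosine is negative on the two gaps of width `π` beside the interval around `c + 2πk` that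
  -- contains `h 0`. By the intermediate value theorem `h` cannot pass through a gap, so `h 1` lies
  -- in the same interval.
  have neg : ∀ v, c + k * (2 * Real.pi) + Real.pi / 2 < v →
      v < c + k * (2 * Real.pi) + 3 * Real.pi / 2 → Real.cos (v - c) < 0 := by
    intro v h1 h2
    have := Real.cos_neg_of_pi_div_two_lt_of_lt (x := v - c - k * (2 * Real.pi))
      (by linarith) (by linarith)
    rwa [Real.cos_sub_int_mul_two_pi] at this
  have neg' : ∀ v, c + k * (2 * Real.pi) - 3 * Real.pi / 2 < v →
      v < c + k * (2 * Real.pi) - Real.pi / 2 → Real.cos (v - c) < 0 := by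
    intro v h1 h2
    have := Real.cos_neg_of_pi_div_two_lt_of_lt (x := v - c - k * (2 * Real.pi) + 2 * Real.pi)
      (by linarith) (by linarith)
    rwa [Real.cos_add_two_pi, Real.cos_sub_int_mul_two_pi] at this
  have up : h 1 ≤ c + k * (2 * Real.pi) + Real.pi / 2 := by
    by_contra! hlt
    obtain ⟨v, hv1, hv2⟩ := exists_between (lt_min hlt
      (show c + k * (2 * Real.pi) + Real.pi / 2 < c + k * (2 * Real.pi) + 3 * Real.pi / 2 by
        linarith))
    have hv3 := lt_min_iff.1 hv2
    have := key v (Set.mem_uIcc.2 (Or.inl ⟨by linarith, hv3.1.le⟩))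
    linarith [neg v hv1 hv3.2]
  have down : c + k * (2 * Real.pi) - Real.pi / 2 ≤ h 1 := by
    by_contra! hlt
    obtain ⟨v, hv1, hv2⟩ := exists_between (max_lt hlt
      (show c + k * (2 * Real.pi) - 3 * Real.pi / 2 < c + k * (2 * Real.pi) - Real.pi / 2 by
        linarith))
    have hv3 := max_lt_iff.1 hv1
    have := key v (Set.mem_uIcc.2 (Or.inr ⟨hv3.1.le, by linarith⟩))
    linarith [neg' v hv3.2 hv2]
  -- `h 1` and `y + 2πk` lie in a common interval of length `π`, too short for two values that
  -- differ by a nonzero multiple of `2π`.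
  have hmk : m = k := by
    have h1 : ((m : ℝ) - k) * (2 * Real.pi) ≤ Real.pi := by linarith
    have h2 : -Real.pi ≤ ((m : ℝ) - k) * (2 * Real.pi) := by linarith
    have h3 : (m : ℝ) - k < 1 := by nlinarith
    have h4 : -1 < (m : ℝ) - k := by nlinarith
    have h5 : m - k < 1 := by exact_mod_cast h3
    have h6 : -1 < m - k := by exact_mod_cast h4
    omega
  rw [hk, hm, hmk]; ring

/-- A chord of the unit circle is perpendicular to the bisector of the angles of its ends. The half
angles here are those of the inscribed angle theorem. -/
lemma exp_sub_exp_eq (a b : ℝ) :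
    Complex.exp (a * Complex.I) - Complex.exp (b * Complex.I) =
      ((2 * Real.sin ((a - b) / 2) : ℝ) : ℂ) *
        Complex.exp (((a + b) / 2 + Real.pi / 2 : ℝ) * Complex.I) := by
  apply Complex.ext
  · simp only [Complex.sub_re, Complex.exp_ofReal_mul_I_re, Complex.re_ofReal_mul]
    rw [Real.cos_add_pi_div_two, Real.cos_sub_cos]; ring
  · simp only [Complex.sub_im, Complex.exp_ofReal_mul_I_im, Complex.im_ofReal_mul]
    rw [Real.sin_add_pi_div_two, Real.sin_sub_sin]

lemma exists_im_of_exp_eq {z : ℂ} {r x : ℝ} (hr : 0 < r)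
    (h : Complex.exp z = (r : ℂ) * Complex.exp (x * Complex.I)) :
    ∃ k : ℤ, z.im = x + k * (2 * Real.pi) := by
  have h1 : Complex.exp z = Complex.exp ((Real.log r : ℝ) + x * Complex.I) := by
    rw [h, Complex.exp_add, ← Complex.ofReal_exp, Real.exp_log hr]
  obtain ⟨k, hk⟩ := Complex.exp_eq_exp_iff_exists_int.1 h1
  refine ⟨k, ?_⟩
  have := congrArg Complex.im hk
  simpa using this

/-- Seen from the point of angle `b` of the unit circle, the direction of a moving point of the
closed disc changes by half the angle between its two end positions on the circle. -/
lemma log_change_seen_from_circle {ζ L : ℝ → ℂ} (hL : Continuous L) {a₀ a₁ b : ℝ}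
    (hζ : ∀ s, ‖ζ s‖ ≤ 1)
    (hexp : ∀ s, Complex.exp (L s) = ζ s - Complex.exp (b * Complex.I))
    (h0 : ζ 0 = Complex.exp (a₀ * Complex.I)) (h1 : ζ 1 = Complex.exp (a₁ * Complex.I))
    (ha₀ : b < a₀) (ha₀' : a₀ < b + 2 * Real.pi) (ha₁ : b < a₁) (ha₁' : a₁ < b + 2 * Real.pi) :
    (L 1).im - (L 0).im = (a₁ - a₀) / 2 := by
  have hpi := Real.pi_pos
  have ends : ∀ (s a : ℝ), ζ s = Complex.exp (a * Complex.I) → b < a → a < b + 2 * Real.pi →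
      ∃ k : ℤ, (L s).im = ((a + b) / 2 + Real.pi / 2) + k * (2 * Real.pi) := by
    intro s a hs h1 h2
    refine exists_im_of_exp_eq (r := 2 * Real.sin ((a - b) / 2)) ?_ ?_
    · have := Real.sin_pos_of_pos_of_lt_pi (x := (a - b) / 2) (by linarith) (by linarith)
      linarith
    · rw [hexp, hs, exp_sub_exp_eq]
  -- From the point of angle `b`, the disc lies in the half-plane centred at the direction `b + π`,
  -- because `Re (ζ e^{-ib}) ≤ 1`; the assumptions on `a₀` and `a₁` put both end directions in it.
  have := angle_change_of_cos_nonneg (h := fun s => (L s).im) (Complex.continuous_im.comp hL)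
    (c := b + Real.pi) (x := (a₀ + b) / 2 + Real.pi / 2) (y := (a₁ + b) / 2 + Real.pi / 2)
    ?_ (ends 0 a₀ h0 ha₀ ha₀') (ends 1 a₁ h1 ha₁ ha₁')
    (by linarith) (by linarith) (by linarith) (by linarith)
  · rw [this]; ring
  · intro s _
    have e1 : ζ s = Complex.exp (L s) + Complex.exp (b * Complex.I) := by rw [hexp]; ring
    have e2 : (ζ s * Complex.exp (-b * Complex.I)).re =
        Real.exp (L s).re * Real.cos ((L s).im - b) + 1 := by
      rw [e1, add_mul, ← Complex.exp_add, ← Complex.exp_add]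
      simp [Complex.exp_re, sub_eq_add_neg]
    have e3 : (ζ s * Complex.exp (-b * Complex.I)).re ≤ 1 := by
      refine (Complex.re_le_norm _).trans ?_
      have : ‖Complex.exp (-b * Complex.I)‖ = 1 := by
        have := Complex.norm_exp_ofReal_mul_I (-b)
        push_cast at this; exact this
      rw [norm_mul, this, mul_one]; exact hζ s
    have e4 := Real.exp_pos (L s).re
    have e5 : Real.cos ((L s).im - b) ≤ 0 := by
      by_contra! hlt
      have := mul_pos e4 hlt
      linarith
    have e6 : (L s).im - (b + Real.pi) = ((L s).im - b) - Real.pi := by ring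
    rw [e6, Real.cos_sub_pi]; linarith

/-- Two paths in the closed unit disc whose ends interleave on the unit circle meet. -/
theorem exists_eq_of_interleaved {γ δ : ℝ → ℂ} (hγ : Continuous γ) (hδ : Continuous δ)
    (hγ1 : ∀ s, ‖γ s‖ ≤ 1) (hδ1 : ∀ s, ‖δ s‖ ≤ 1) {a₀ b₀ a₁ b₁ : ℝ}
    (ha₀ : γ 0 = Complex.exp (a₀ * Complex.I)) (ha₁ : γ 1 = Complex.exp (a₁ * Complex.I))
    (hb₀ : δ 0 = Complex.exp (b₀ * Complex.I)) (hb₁ : δ 1 = Complex.exp (b₁ * Complex.I))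
    (h1 : a₀ < b₀) (h2 : b₀ < a₁) (h3 : a₁ < b₁) (h4 : b₁ < a₀ + 2 * Real.pi) :
    ∃ s t, γ s = δ t := by
  by_contra! hne
  have hsc : IsSimplyConnected (Set.univ : Set (ℝ × ℝ)) := by
    have : ContractibleSpace (Set.univ : Set (ℝ × ℝ)) :=
      convex_univ.contractibleSpace Set.univ_nonempty
    rw [IsSimplyConnected]; infer_instance
  -- If the paths never meet, `γ s - δ t` has no zero on the simply connected plane of pairs `(s,
  -- t)`, hence a continuous logarithm.
  obtain ⟨L, hLc, hL⟩ := Complex.exists_continuousOn_eqOn_exp_comp (X := ℝ × ℝ) hsc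
    isOpen_univ (g := fun p => γ p.1 - δ p.2)
    (Continuous.continuousOn (by fun_prop))
    (by rintro ⟨p, -, hp⟩; exact hne p.1 p.2 (sub_eq_zero.1 hp))
  rw [continuousOn_univ] at hLc
  have hexp : ∀ s t, Complex.exp (L (s, t)) = γ s - δ t := fun s t => hL (Set.mem_univ (s, t))
  have hneg : ∀ s t, Complex.exp (L (s, t) + Real.pi * Complex.I) = δ t - γ s := by
    intro s t
    rw [Complex.exp_add, hexp, Complex.exp_pi_mul_I]; ring
  have hper : ∀ a : ℝ, Complex.exp (((a + 2 * Real.pi : ℝ) : ℂ) * Complex.I) =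
      Complex.exp (a * Complex.I) := by
    intro a
    push_cast
    rw [add_mul, Complex.exp_add, Complex.exp_two_pi_mul_I, mul_one]
  -- On each side of the unit square one of the two points rests on the circle. The angle changes by
  -- `(a₁ - a₀)/2 - π` and `(a₁ - a₀)/2` on bottom and top, by `(b₁ - b₀)/2` and `(b₁ - b₀)/2 - π`
  -- on left and right. The two ways from corner to opposite corner therefore differ by `2π`, which
  -- is absurd. The shifts by `2π` bring each angle into the turn that begins at the resting point.
  have bottom := log_change_seen_from_circle (ζ := γ) (L := fun s => L (s, 0)) (by fun_prop)
    (a₀ := a₀ + 2 * Real.pi) (a₁ := a₁) (b := b₀) hγ1 (fun s => by rw [hexp, hb₀])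
    (by rw [ha₀, hper]) ha₁ (by linarith) (by linarith) (by linarith) (by linarith)
  have top := log_change_seen_from_circle (ζ := γ) (L := fun s => L (s, 1)) (by fun_prop)
    (a₀ := a₀ + 2 * Real.pi) (a₁ := a₁ + 2 * Real.pi) (b := b₁) hγ1 (fun s => by rw [hexp, hb₁])
    (by rw [ha₀, hper]) (by rw [ha₁, hper]) (by linarith) (by linarith) (by linarith) (by linarith)
  have left := log_change_seen_from_circle (ζ := δ)
    (L := fun t => L (0, t) + Real.pi * Complex.I) (by fun_prop)
    (a₀ := b₀) (a₁ := b₁) (b := a₀) hδ1 (fun s => by rw [hneg, ha₀])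
    hb₀ hb₁ (by linarith) (by linarith) (by linarith) (by linarith)
  have right := log_change_seen_from_circle (ζ := δ)
    (L := fun t => L (1, t) + Real.pi * Complex.I) (by fun_prop)
    (a₀ := b₀ + 2 * Real.pi) (a₁ := b₁) (b := a₁) hδ1 (fun s => by rw [hneg, ha₁])
    (by rw [hb₀, hper]) hb₁ (by linarith) (by linarith) (by linarith) (by linarith)
  simp only [Complex.add_im] at bottom top left right
  linarith [Real.pi_pos]

/-! ### Outerplanar graphs have a non-crossing vertex order -/

/-- In the order of the vertices given by `θ`, no two edges of `G` interleave. -/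
def NonCrossing {V : Type*} (G : SimpleGraph V) (θ : V → ℝ) : Prop :=
  ∀ a b c d, θ a < θ b → θ b < θ c → θ c < θ d → G.Adj a c → G.Adj b d → False

/-- The vertices of an outerplanar graph can be ordered along the circle, starting anywhere,
without interleaving edges. -/
theorem IsOuterplanar.exists_nonCrossing {V : Type*} {G : SimpleGraph V} (hG : IsOuterplanar G)
    (v₀ : V) : ∃ θ : V → ℝ, Function.Injective θ ∧ NonCrossing G θ ∧ ∀ v, θ v ≤ θ v₀ := by
  obtain ⟨pos, arc, hinj, hsph, harc, hball, -, hcross⟩ := hG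
  have hnorm : ∀ v, ‖pos v‖ = 1 := fun v => by simpa using hsph v
  have hne : ∀ v, pos v ≠ 0 := fun v h => by simpa [h] using hnorm v
  -- This rotation sends `v₀` to `-1`, whose argument `π` is the largest possible, so `v₀` comes
  -- last.
  set r : ℂ := -(pos v₀)⁻¹ with hr
  have hrn : ‖r‖ = 1 := by simp [hr, hnorm]
  have hr0 : r ≠ 0 := by intro h; simp [h] at hrn
  have hval : ∀ v, r * pos v = Complex.exp ((r * pos v).arg * Complex.I) := by
    intro v
    have := Complex.norm_mul_exp_arg_mul_I (r * pos v)
    rw [norm_mul, hrn, hnorm] at this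
    simpa using this.symm
  refine ⟨fun v => (r * pos v).arg, ?_, ?_, ?_⟩
  · intro u v huv
    simp only at huv
    have := hval u
    rw [huv, ← hval v] at this
    exact hinj (mul_left_cancel₀ hr0 this)
  · intro a b c d hab hbc hcd hac hbd
    simp only at hab hbc hcd
    obtain ⟨p, -, hp⟩ := harc a c hac
    obtain ⟨q, -, hq⟩ := harc b d hbd
    have hpn : ∀ s, ‖p s‖ ≤ 1 := fun s => by
      simpa using hball s(a, c) hac (hp ▸ Set.mem_range_self s)
    have hqn : ∀ s, ‖q s‖ ≤ 1 := fun s => by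
      simpa using hball s(b, d) hbd (hq ▸ Set.mem_range_self s)
    have hpe : ∀ s, ∃ s', p.extend s = p s' := fun s => by
      have : p.extend s ∈ Set.range p := by
        rw [← Path.extend_range]; exact Set.mem_range_self s
      obtain ⟨s', hs'⟩ := this
      exact ⟨s', hs'.symm⟩
    have hqe : ∀ s, ∃ s', q.extend s = q s' := fun s => by
      have : q.extend s ∈ Set.range q := by
        rw [← Path.extend_range]; exact Set.mem_range_self s
      obtain ⟨s', hs'⟩ := this
      exact ⟨s', hs'.symm⟩
    obtain ⟨s, t, hst⟩ := exists_eq_of_interleaved (γ := fun s => r * p.extend s)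
      (δ := fun s => r * q.extend s) (by fun_prop) (by fun_prop)
      (fun s => by obtain ⟨s', hs'⟩ := hpe s; simp [hrn, hs', hpn])
      (fun s => by obtain ⟨s', hs'⟩ := hqe s; simp [hrn, hs', hqn])
      (by simpa using hval a) (by simpa using hval c) (by simpa using hval b)
      (by simpa using hval d) hab hbc hcd
      (by linarith [Complex.arg_le_pi (r * pos d), Complex.neg_pi_lt_arg (r * pos a)])
    have hst' := mul_left_cancel₀ hr0 hst
    obtain ⟨s', hs'⟩ := hpe s
    obtain ⟨t', ht'⟩ := hqe t
    rw [hs', ht'] at hst'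
    have hef : s(a, c) ≠ s(b, d) := by
      intro h
      rcases Sym2.eq_iff.1 h with ⟨rfl, rfl⟩ | ⟨rfl, rfl⟩ <;> linarith
    obtain ⟨w, hw1, hw2, -⟩ := hcross s(a, c) hac s(b, d) hbd hef (p s')
      ⟨hp ▸ Set.mem_range_self s', hq ▸ hst' ▸ Set.mem_range_self t'⟩
    rw [Sym2.mem_iff] at hw1 hw2
    rcases hw1 with rfl | rfl <;> rcases hw2 with rfl | rfl <;> linarith
  · intro v
    have : r * pos v₀ = -1 := by rw [hr]; field_simp [hne v₀]
    simp only [this, Complex.arg_neg_one]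
    exact Complex.arg_le_pi _

/-! ### Non-crossing orders: parity and cycles -/

section NonCrossing

variable {V : Type*} {G : SimpleGraph V} {θ : V → ℝ}

/-- `f` maps every vertex to its partner in some perfect matching of `G`. -/
structure IsMate (G : SimpleGraph V) (f : V → V) : Prop where
  invol : ∀ v, f (f v) = v
  adj : ∀ v, G.Adj v (f v)

lemma IsMate.ne {f : V → V} (hf : IsMate G f) (v : V) : f v ≠ v := (hf.adj v).ne'

lemma IsMate.injective {f : V → V} (hf : IsMate G f) : Function.Injective f :=
  Function.LeftInverse.injective hf.invol

/-- `x` lies strictly between `u` and `v`. -/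
def Inside (θ : V → ℝ) (u v x : V) : Prop := θ u < θ x ∧ θ x < θ v

/-- An edge leaving the interval between `u` and `v` other than through its ends would interleave
with `uv`. -/
lemma NonCrossing.inside_of_adj (h : NonCrossing G θ) (hθ : Function.Injective θ) {u v x y : V}
    (huv : G.Adj u v) (hxy : G.Adj x y) (hx : Inside θ u v x) (hyu : y ≠ u) (hyv : y ≠ v) :
    Inside θ u v y := by
  by_contra hy
  rcases lt_or_ge (θ u) (θ y) with h1 | h1
  · rcases lt_or_ge (θ y) (θ v) with h2 | h2
    · exact hy ⟨h1, h2⟩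
    · exact h u x v y hx.1 hx.2 (lt_of_le_of_ne h2 fun h => hyv (hθ h.symm)) huv hxy
  · exact h y u x v (lt_of_le_of_ne h1 fun h => hyu (hθ h)) hx.1 hx.2 hxy.symm huv

/-- An edge separates the order into two sides, and a path that avoids its ends cannot change sides,
by `inside_of_adj` at each step. -/
lemma NonCrossing.inside_iff_of_chain (h : NonCrossing G θ) (hθ : Function.Injective θ) {u v : V}
    (huv : G.Adj u v) : ∀ (l : List V) (x : V), List.IsChain G.Adj (x :: l) → u ∉ x :: l →
      v ∉ x :: l → ∀ y ∈ x :: l, (Inside θ u v y ↔ Inside θ u v x)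
  | [], x, _, _, _, y, hy => by simp at hy; rw [hy]
  | z :: l, x, hc, hu, hv, y, hy => by
    rw [List.isChain_cons_cons] at hc
    have hxz : Inside θ u v z ↔ Inside θ u v x := by
      simp only [List.mem_cons, not_or] at hu hv
      exact ⟨fun hz => h.inside_of_adj hθ huv hc.1.symm hz (Ne.symm hu.1) (Ne.symm hv.1),
        fun hx => h.inside_of_adj hθ huv hc.1 hx (Ne.symm hu.2.1) (Ne.symm hv.2.1)⟩
    rcases List.mem_cons.1 hy with rfl | hy
    · rfl
    · rw [h.inside_iff_of_chain hθ huv l z hc.2 (fun h => hu (List.mem_cons_of_mem _ h))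
        (fun h => hv (List.mem_cons_of_mem _ h)) y hy, hxz]

lemma NonCrossing.neg (h : NonCrossing G θ) : NonCrossing G (fun v => - θ v) := by
  intro a b c d hab hbc hcd hac hbd
  simp only [neg_lt_neg_iff] at hab hbc hcd
  exact h d c b a hcd hbc hab hbd.symm hac.symm

/-- A path starting at its smallest and ending at its largest vertex is increasing. -/
lemma NonCrossing.pairwise_lt_of_chain (h : NonCrossing G θ) (hθ : Function.Injective θ) :
    ∀ (l : List V) (x w : V), List.IsChain G.Adj (x :: l) → (x :: l).Nodup →
      (∀ y ∈ l, θ x < θ y) → w ∈ (x :: l).getLast? → (∀ y ∈ x :: l, θ y ≤ θ w) →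
      (x :: l).Pairwise (fun a b => θ a < θ b)
  | [], x, w, _, _, _, _, _ => by simp
  | [y], x, w, _, _, hx, _, _ => by simpa using hx
  | y :: z :: l, x, w, hc, hn, hx, hw, hmax => by
    rw [List.isChain_cons_cons] at hc
    have hn' := List.nodup_cons.1 hn
    have hn'' := List.nodup_cons.1 hn'.2
    have hwl : w ∈ (z :: l).getLast? := by simpa [List.getLast?_cons_cons] using hw
    have hwm : w ∈ z :: l := List.mem_of_mem_getLast? hwl
    have hcl := List.isChain_cons_cons.1 hc.2
    -- The path after `y` avoids both ends of the edge `xy`, so it stays on one side of it. The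
    -- largest vertex `w` is outside, hence so is the whole path, which therefore lies beyond `y`.
    have hside := h.inside_iff_of_chain hθ hc.1 l z hcl.2
      (fun hm => hn'.1 (List.mem_cons_of_mem _ hm)) hn''.1
    have hwo : ¬ Inside θ x y w := fun hi => by
      have := hmax y (by simp)
      exact absurd hi.2 (not_lt.2 this)
    have hout : ∀ t ∈ z :: l, ¬ Inside θ x y t := fun t ht => by
      rw [hside t ht, ← hside w hwm]; exact hwo
    refine List.pairwise_cons.2 ⟨hx, ?_⟩
    refine h.pairwise_lt_of_chain hθ (z :: l) y w hc.2 hn'.2 ?_ ?_ ?_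
    · intro t ht
      by_contra! hle
      refine hout t ht ⟨hx t (List.mem_cons_of_mem _ ht), lt_of_le_of_ne hle ?_⟩
      intro he
      exact hn''.1 (hθ he ▸ ht)
    · simpa [List.getLast?_cons_cons] using hw
    · exact fun t ht => hmax t (List.mem_cons_of_mem _ ht)

/-- A cycle is increasing from its smallest vertex, in the direction of the smaller neighbour. -/
lemma NonCrossing.pairwise_lt_of_cycle (h : NonCrossing G θ) (hθ : Function.Injective θ)
    {v x w : V} {l : List V} (hc : List.IsChain G.Adj (v :: x :: l)) (hn : (v :: x :: l).Nodup)
    (hw : w ∈ (x :: l).getLast?) (hwv : G.Adj w v) (hmin : ∀ y, θ v ≤ θ y) (hxw : θ x ≤ θ w) :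
    (v :: x :: l).Pairwise (fun a b => θ a < θ b) := by
  have hn' := List.nodup_cons.1 hn
  have hlt : ∀ y ∈ x :: l, θ v < θ y := fun y hy =>
    lt_of_le_of_ne (hmin y) fun he => hn'.1 (hθ he ▸ hy)
  refine h.pairwise_lt_of_chain hθ (x :: l) v w hc hn hlt
    (by simpa [List.getLast?_cons_cons] using hw) ?_
  have hwm : w ∈ x :: l := List.mem_of_mem_getLast? hw
  -- Without `w`, the path from `x` avoids both ends of the closing edge `vw`. Since `x` lies
  -- between `v` and `w`, so does everything else, and `w` is the largest vertex.
  have key : ∀ y ∈ x :: l, θ y ≤ θ w := by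
    obtain ⟨k, hk⟩ : ∃ k, x :: l = k ++ [w] := by
      obtain ⟨h1, h2⟩ := List.mem_getLast?_eq_getLast hw
      exact ⟨_, by rw [h2]; exact (List.dropLast_append_getLast h1).symm⟩
    rw [hk]
    cases k with
    | nil => simp
    | cons z k =>
      have hz : z = x := by
        have := congrArg List.head? hk
        simpa using this.symm
      subst hz
      rw [hk] at hc hn'
      have hc' : List.IsChain G.Adj (z :: k) := by
        have := (List.isChain_cons.1 hc).2
        exact (List.isChain_append.1 this).1
      have hn2 := List.nodup_append.1 hn'.2
      have hside := h.inside_iff_of_chain hθ hwv.symm k z hc'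
        (fun hm => hn'.1 (List.mem_append_left _ hm))
        (fun hm => hn2.2.2 w hm w (by simp) rfl)
      have hzw : θ z < θ w := lt_of_le_of_ne hxw fun he =>
        hn2.2.2 z (by simp) w (by simp) (hθ he)
      intro y hy
      rcases List.mem_append.1 hy with hy | hy
      · exact ((hside y hy).2 ⟨hlt z (by simp), hzw⟩).2.le
      · simp at hy; rw [hy]
  intro y hy
  rcases List.mem_cons.1 hy with rfl | hy
  · exact hmin w
  · exact key y hy

/-- Reversing the circular order, keeping the same first vertex. -/
lemma NonCrossing.exists_reflect [Finite V] (h : NonCrossing G θ) (hθ : Function.Injective θ)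
    {v : V} (hmin : ∀ y, θ v ≤ θ y) : ∃ θ' : V → ℝ, Function.Injective θ' ∧ NonCrossing G θ' ∧
      (∀ y, θ' v ≤ θ' y) ∧ ∀ x y, x ≠ v → y ≠ v → θ y ≤ θ x → θ' x ≤ θ' y := by
  classical
  obtain ⟨K, hK⟩ : ∃ K, ∀ y, θ y < K := by
    obtain ⟨B, hB⟩ := (Set.finite_range θ).bddAbove
    exact ⟨B + 1, fun y => by linarith [hB (Set.mem_range_self y)]⟩
  have hval : ∀ y, y ≠ v → Function.update θ v K y = θ y := fun y hy =>
    Function.update_of_ne hy _ _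
  have hvv : Function.update θ v K v = K := Function.update_self _ _ _
  have hle : ∀ y, Function.update θ v K y ≤ K := fun y => by
    by_cases hy : y = v
    · rw [hy, hvv]
    · rw [hval y hy]; exact (hK y).le
  -- First `v` is moved from the bottom to the top, which only shifts the circular order; negation
  -- then reverses the order and brings `v` back to the bottom.
  refine ⟨fun y => - Function.update θ v K y, ?_, ?_, ?_, ?_⟩
  · intro x y hxy
    simp only [neg_inj] at hxy
    by_cases hx : x = v <;> by_cases hy : y = v
    · rw [hx, hy]
    · rw [hx, hvv, hval y hy] at hxy; linarith [hK y]
    · rw [hy, hvv, hval x hx] at hxy; linarith [hK x]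
    · rw [hval x hx, hval y hy] at hxy; exact hθ hxy
  · refine NonCrossing.neg ?_
    intro a b c d hab hbc hcd hac hbd
    have hne : ∀ {x y}, Function.update θ v K x < Function.update θ v K y → x ≠ v := by
      rintro x y hxy rfl
      rw [hvv] at hxy
      linarith [hle y]
    have hav := hne hab
    rw [hval a hav, hval b (hne hbc)] at hab
    rw [hval b (hne hbc), hval c (hne hcd)] at hbc
    rw [hval c (hne hcd)] at hcd
    -- If the moved vertex takes part, it is the last of the four; putting it first again is a
    -- cyclic shift, after which the same two edges still interleave.
    by_cases hd : d = v
    · subst hd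
      exact h d a b c (lt_of_le_of_ne (hmin a) fun he => hav (hθ he).symm)
        hab hbc hbd.symm hac
    · rw [hval d hd] at hcd
      exact h a b c d hab hbc hcd hac hbd
  · intro y
    simp only [neg_le_neg_iff, hvv]
    exact hle y
  · intro x y hx hy hxy
    simp only [neg_le_neg_iff]
    rwa [hval x hx, hval y hy]

/-- The vertices are coloured by the parity of their rank in the order `θ`. -/
def colour [Fintype V] (θ : V → ℝ) (v : V) : Prop := Even (Finset.univ.filter (θ · < θ v)).card

/-- Edges of perfect matchings join vertices of different colours. -/
lemma NonCrossing.colour_mate [Fintype V] (h : NonCrossing G θ) (hθ : Function.Injective θ)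
    {f : V → V} (hf : IsMate G f) (v : V) : colour θ (f v) ↔ ¬ colour θ v := by
  classical
  have key : ∀ v, θ v < θ (f v) → (colour θ (f v) ↔ ¬ colour θ v) := by
    intro v hv
    -- No matching edge crosses `v (f v)`, so `f` pairs off the vertices strictly between; the ranks
    -- of `v` and `f v` then differ by an odd number.
    have heven : Even (Finset.univ.filter (Inside θ v (f v))).card := by
      have : ∑ x ∈ Finset.univ.filter (Inside θ v (f v)), (1 : ZMod 2) = 0 := by
        refine Finset.sum_involution (fun x _ => f x) ?_ ?_ ?_ ?_
        · intros; exact CharTwo.add_self_eq_zero 1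
        · intro x _ _; exact hf.ne x
        · intro x hx
          simp only [Finset.mem_filter, Finset.mem_univ, true_and] at hx ⊢
          refine h.inside_of_adj hθ (hf.adj v) (hf.adj x) hx ?_ ?_
          · rintro he
            rw [← he, hf.invol] at hx
            exact lt_irrefl _ hx.2
          · intro he
            rw [hf.injective he] at hx
            exact lt_irrefl _ hx.1
        · intro x _; exact hf.invol x
      simp only [Finset.sum_const, nsmul_eq_mul, mul_one] at this
      rwa [ZMod.natCast_eq_zero_iff_even] at this
    have hcard : (Finset.univ.filter (θ · < θ (f v))).card =
        (Finset.univ.filter (θ · < θ v)).card +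
          ((Finset.univ.filter (Inside θ v (f v))).card + 1) := by
      have e : (Finset.univ.filter (θ · < θ (f v))) =
          (Finset.univ.filter (θ · < θ v)) ∪
            insert v (Finset.univ.filter (Inside θ v (f v))) := by
        ext x
        simp only [Finset.mem_filter, Finset.mem_univ, true_and, Finset.mem_union,
          Finset.mem_insert, Inside]
        constructor
        · intro hx
          rcases lt_trichotomy (θ x) (θ v) with h1 | h1 | h1
          · exact Or.inl h1
          · exact Or.inr (Or.inl (hθ h1))
          · exact Or.inr (Or.inr ⟨h1, hx⟩)
        · rintro (h1 | rfl | h1)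
          · exact h1.trans hv
          · exact hv
          · exact h1.2
      rw [e, Finset.card_union_of_disjoint, Finset.card_insert_of_notMem]
      · simp [Inside]
      · rw [Finset.disjoint_left]
        intro x hx
        simp only [Finset.mem_filter, Finset.mem_univ, true_and, Finset.mem_insert, Inside,
          not_or, not_and] at hx ⊢
        exact ⟨fun he => by rw [he] at hx; exact lt_irrefl _ hx,
          fun h1 => absurd h1 (not_lt.2 hx.le)⟩
    unfold colour
    rw [hcard]
    rw [Nat.even_add, Nat.even_add_one]
    tauto
  rcases lt_trichotomy (θ v) (θ (f v)) with h1 | h1 | h1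
  · exact key v h1
  · exact absurd (hθ h1).symm (hf.ne v)
  · have := key (f v) (by rwa [hf.invol])
    rw [hf.invol] at this
    tauto

end NonCrossing

/-! ### Alternating cycles of two perfect matchings -/

section Blocks

variable {V : Type*} {G : SimpleGraph V} {f g : V → V} {par : V → ℕ}

/-- One step along an alternating cycle: by `f` from the vertices of parity `0`, by `g` from those
of parity `1`. -/
def AltStep (f g : V → V) (par : V → ℕ) (x y : V) : Prop :=
  (par x = 0 ∧ par y = 1 ∧ f x = y) ∨ (par x = 1 ∧ par y = 0 ∧ g x = y)

/-- `v :: t` lists the alternating cycle of `f` and `g` through `v`. -/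
structure IsBlock (f g : V → V) (par : V → ℕ) (v : V) (t : List V) : Prop where
  nodup : (v :: t).Nodup
  chain : List.IsChain (AltStep f g par) (v :: t ++ [v])
  par_eq : par v = 0

lemma AltStep.adj (hf : IsMate G f) (hg : IsMate G g) {x y : V} (h : AltStep f g par x y) :
    G.Adj x y := by
  rcases h with ⟨-, -, rfl⟩ | ⟨-, -, rfl⟩
  · exact hf.adj x
  · exact hg.adj x

lemma IsBlock.ne_nil (hf : IsMate G f) (hg : IsMate G g) {v : V} {t : List V}
    (h : IsBlock f g par v t) : t ≠ [] := by
  rintro rfl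
  have := h.chain
  simp only [List.cons_append, List.nil_append, List.isChain_cons_cons] at this
  exact (this.1.adj hf hg).ne rfl

/-- An alternating cycle in an outerplanar graph runs along the circle. -/
lemma IsBlock.exists_nonCrossing [Finite V] (hG : IsOuterplanar G) (hf : IsMate G f)
    (hg : IsMate G g) {v : V} {t : List V} (h : IsBlock f g par v t) :
    ∃ θ : V → ℝ, Function.Injective θ ∧ NonCrossing G θ ∧
      (v :: t).Pairwise (fun a b => θ a < θ b) := by
  obtain ⟨θ₀, hi, hnc, hmax⟩ := hG.exists_nonCrossing v
  have hi' : Function.Injective (fun x => - θ₀ x) := fun x y hxy => hi (neg_injective hxy)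
  have hmin : ∀ y, - θ₀ v ≤ - θ₀ y := fun y => by simpa using hmax y
  obtain ⟨x, l, rfl⟩ := List.exists_cons_of_ne_nil (h.ne_nil hf hg)
  have hch : List.IsChain G.Adj (v :: x :: l ++ [v]) := h.chain.imp fun _ _ hs => hs.adj hf hg
  have hc := (List.isChain_append.1 hch).1
  obtain ⟨w, hw⟩ : ∃ w, w ∈ (x :: l).getLast? :=
    ⟨_, List.getLast?_eq_getLast_of_ne_nil (by simp)⟩
  have hwv : G.Adj w v := (List.isChain_append.1 hch).2.2 w
    (by simpa [List.getLast?_cons_cons] using hw) v (by simp)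
  have hn := List.nodup_cons.1 h.nodup
  have hwm : w ∈ x :: l := List.mem_of_mem_getLast? hw
  -- The direction of travel is not known in advance: if the second vertex comes after the last one,
  -- the order is reflected, keeping `v` first.
  rcases le_total (- θ₀ x) (- θ₀ w) with hxw | hxw
  · exact ⟨_, hi', hnc.neg, hnc.neg.pairwise_lt_of_cycle hi' hc h.nodup hw hwv hmin hxw⟩
  · obtain ⟨θ', hi'', hnc', hmin', hrev⟩ := hnc.neg.exists_reflect hi' hmin
    refine ⟨θ', hi'', hnc', hnc'.pairwise_lt_of_cycle hi'' hc h.nodup hw hwv hmin' ?_⟩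
    exact hrev x w (fun he => hn.1 (by simp [he])) (fun he => hn.1 (he ▸ hwm)) hxw

end Blocks

/-! ### Polygons with non-crossing chords -/

section Polygons

variable {V : Type*} {R : V → V → Prop} {par : V → ℕ}

/-- `p` lists the vertices of a polygon whose sides and chords are given by `R`; the chords do not
cross and join vertices of different parity. -/
structure ChordPolygon (R : V → V → Prop) (par : V → ℕ) (p : List V) : Prop where
  nodup : p.Nodup
  ne_nil : p ≠ []
  chain : List.IsChain R p
  closing : R (p.head ne_nil) (p.getLast ne_nil)
  symm : ∀ x y, R x y → R y x
  opp : ∀ x y, R x y → (par x = 0 ∧ par y = 1) ∨ (par x = 1 ∧ par y = 0)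
  cross : ∀ a b c d, [a, b, c, d] <+ p → R a c → R b d → False

open Classical in
/-- The number of `R`-neighbours of `x` in `p`. -/
noncomputable def ldeg (R : V → V → Prop) (p : List V) (x : V) : ℕ := p.countP fun y => R x y

/-- The sum of the degrees of the vertices of `p`. -/
noncomputable def degSum (R : V → V → Prop) (p : List V) : ℕ := (p.map (ldeg R p)).sum

/-- `R` with the edge joining `a` and `d` added. -/
def addEdge (R : V → V → Prop) (a d : V) (x y : V) : Prop :=
  R x y ∨ (x = a ∧ y = d) ∨ (x = d ∧ y = a)

lemma addEdge_of_rel (hs : ∀ x y, R x y → R y x) {a d : V} (h : R a d) : addEdge R a d = R := by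
  funext x y
  refine propext ⟨?_, Or.inl⟩
  rintro (h1 | ⟨rfl, rfl⟩ | ⟨rfl, rfl⟩)
  exacts [h1, h, hs _ _ h]

namespace ChordPolygon

variable {p : List V}

lemma cross_getElem (h : ChordPolygon R par p) {i j k m : ℕ} (hij : i < j) (hjk : j < k) (hkm : k < m)
    (hm : m < p.length) (h1 : R p[i] p[k]) (h2 : R p[j] p[m]) : False := by
  have := List.map_getElem_sublist (l := p)
    (is := [⟨i, by omega⟩, ⟨j, by omega⟩, ⟨k, by omega⟩, ⟨m, by omega⟩]) (by simp; omega)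
  simp only [List.map_cons, List.map_nil] at this
  exact h.cross _ _ _ _ this h1 h2

lemma par_getElem (h : ChordPolygon R par p) : ∀ i (hi : i < p.length),
    (par p[i] + i) % 2 = (par (p[0]'(by omega))) % 2
  | 0, _ => by simp
  | i + 1, hi => by
    have ih := h.par_getElem i (by omega)
    have hc := h.opp _ _ (List.isChain_iff_getElem.1 h.chain i hi)
    omega

/-- Parities alternate along the sides. Consequently a chord that is not a side spans at least three
sides, which is what makes ears have two inner vertices. -/
lemma odd_of_rel (h : ChordPolygon R par p) {i j : ℕ} (hi : i < p.length) (hj : j < p.length)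
    (hR : R p[i] p[j]) : (i + j) % 2 = 1 := by
  have h1 := h.par_getElem i hi
  have h2 := h.par_getElem j hj
  have h3 := h.opp _ _ hR
  omega

lemma even_length (h : ChordPolygon R par p) : p.length % 2 = 0 := by
  have hl := List.length_pos_of_ne_nil h.ne_nil
  have hc := h.closing
  rw [List.head_eq_getElem, List.getLast_eq_getElem] at hc
  have := h.odd_of_rel hl (by omega) hc
  omega

/-- Descent to a shorter chord: if a vertex strictly between `i` and `j` has a chord that is not a
side, non-crossing keeps its other end within `[i, j]`, so that chord is shorter, and by parity it
again spans at least three. When no such chord is left, the vertices `i + 1` and `i + 2` have only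
their sides. -/
lemma exists_ear_index (h : ChordPolygon R par p) : ∀ (N i j : ℕ), j - i ≤ N → i + 3 ≤ j →
    ∀ (hj : j < p.length) (hi : i < p.length), R p[i] p[j] →
    ∃ (k : ℕ) (hk : k + 3 < p.length),
      (∀ y ∈ p, R p[k + 1] y → y = p[k] ∨ y = p[k + 2]) ∧
      (∀ y ∈ p, R p[k + 2] y → y = p[k + 1] ∨ y = p[k + 3])
  | 0, i, j, hN, hij, _, _, _ => by omega
  | N + 1, i, j, hN, hij, hj, hi, hR => by
    by_cases hall : ∀ k m (hk : k < p.length) (hm : m < p.length), i < k → k < j →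
        R p[k] p[m] → m + 1 = k ∨ m = k + 1
    · refine ⟨i, by omega, ?_, ?_⟩
      · intro y hy hRy
        obtain ⟨m, hm, rfl⟩ := List.getElem_of_mem hy
        rcases hall (i + 1) m (by omega) hm (by omega) (by omega) hRy with h1 | h1
        · left; congr 1; omega
        · right; congr 1
      · intro y hy hRy
        obtain ⟨m, hm, rfl⟩ := List.getElem_of_mem hy
        rcases hall (i + 2) m (by omega) hm (by omega) (by omega) hRy with h1 | h1
        · left; congr 1; omega
        · right; congr 1
    · push Not at hall
      obtain ⟨k, m, hk, hm, hik, hkj, hkm, h1, h2⟩ := hall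
      have hodd := h.odd_of_rel hk hm hkm
      have hmi : i ≤ m := by
        by_contra! hlt
        exact h.cross_getElem hlt hik hkj hj (h.symm _ _ hkm) hR
      have hmj : m ≤ j := by
        by_contra! hlt
        exact h.cross_getElem hik hkj hlt hm hR hkm
      rcases lt_or_ge k m with hlt | hge
      · exact h.exists_ear_index N k m (by omega) (by omega) hm hk hkm
      · exact h.exists_ear_index N m k (by omega) (by omega) hk hm (h.symm _ _ hkm)

/-- A polygon with at least four vertices has two successive vertices without chords. -/
lemma exists_ear (h : ChordPolygon R par p) (hl : 4 ≤ p.length) :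
    ∃ s a b c d r, p = s ++ a :: b :: c :: d :: r ∧
      (∀ y ∈ p, R b y → y = a ∨ y = c) ∧ (∀ y ∈ p, R c y → y = b ∨ y = d) := by
  have hc := h.closing
  rw [List.head_eq_getElem, List.getLast_eq_getElem] at hc
  -- The descent starts from the closing side, so the ear found does not wrap around the end of the
  -- list.
  obtain ⟨k, hk, h1, h2⟩ := h.exists_ear_index _ 0 (p.length - 1) le_rfl (by omega) (by omega)
    (by omega) hc
  refine ⟨p.take k, p[k], p[k + 1], p[k + 2], p[k + 3], p.drop (k + 4), ?_, h1, h2⟩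
  simp

end ChordPolygon

lemma List.Nodup.pairwise_idxOf [DecidableEq V] {l : List V} (h : l.Nodup) :
    l.Pairwise fun x y => l.idxOf x < l.idxOf y := by
  rw [List.pairwise_iff_getElem]
  intro i j hi hj hij
  rwa [h.idxOf_getElem, h.idxOf_getElem]

/-- A chord crossing the new side `ad` would have an end strictly between `a` and `d`, which have
become neighbours in the list. -/
lemma not_between_of_nodup {s r : List V} {a d x y z : V} (hn : (s ++ a :: d :: r).Nodup)
    (hsub : [x, y, z] <+ s ++ a :: d :: r) (h : (x = a ∧ z = d) ∨ (x = d ∧ z = a)) : False := by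
  classical
  have hp := hn.pairwise_idxOf.sublist hsub
  have hn' := hn
  simp only [List.nodup_append, List.nodup_cons, List.mem_cons, not_or] at hn'
  have ha : (s ++ a :: d :: r).idxOf a = s.length := by
    rw [List.idxOf_append_of_notMem fun hm => hn'.2.2 a hm a (by simp) rfl]; simp
  have hd : (s ++ a :: d :: r).idxOf d = s.length + 1 := by
    rw [List.idxOf_append_of_notMem fun hm => hn'.2.2 d hm d (by simp) rfl,
      List.idxOf_cons_ne _ hn'.2.1.1.1]
    simp
  simp only [List.pairwise_cons, List.mem_cons, List.not_mem_nil, or_false, forall_eq_or_imp,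
    forall_eq] at hp
  rcases h with ⟨rfl, rfl⟩ | ⟨rfl, rfl⟩ <;> omega

/-- `b` and `c` have no chords in the polygon that lists `a`, `b`, `c`, `d` successively. -/
structure IsEar (R : V → V → Prop) (s : List V) (a b c d : V) (r : List V) : Prop where
  left : ∀ y ∈ s ++ a :: b :: c :: d :: r, R b y → y = a ∨ y = c
  right : ∀ y ∈ s ++ a :: b :: c :: d :: r, R c y → y = b ∨ y = d

namespace ChordPolygon

variable {s r : List V} {a b c d : V}

lemma sides (h : ChordPolygon R par (s ++ a :: b :: c :: d :: r)) : R a b ∧ R b c ∧ R c d := by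
  have := (List.isChain_append.1 h.chain).2.1
  simp only [List.isChain_cons_cons] at this
  exact ⟨this.1, this.2.1, this.2.2.1⟩

lemma remove_sublist : s ++ a :: d :: r <+ s ++ a :: b :: c :: d :: r :=
  List.Sublist.append_left (((List.sublist_cons_self c _).trans
    (List.sublist_cons_self b _)).cons_cons a) s

/-- Cutting off two successive vertices leaves a polygon if the new side is added. -/
lemma remove_addEdge (h : ChordPolygon R par (s ++ a :: b :: c :: d :: r)) :
    ChordPolygon (addEdge R a d) par (s ++ a :: d :: r) := by
  have hsub : s ++ a :: d :: r <+ s ++ a :: b :: c :: d :: r := remove_sublist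
  have hn := h.nodup.sublist hsub
  obtain ⟨h1, h2, h3⟩ := h.sides
  have o1 := h.opp _ _ h1
  have o2 := h.opp _ _ h2
  have o3 := h.opp _ _ h3
  refine ⟨hn, by simp, ?_, ?_, ?_, ?_, ?_⟩
  · have := h.chain
    rw [List.isChain_append] at this ⊢
    simp only [List.isChain_cons_cons, List.head?_cons] at this ⊢
    exact ⟨this.1.imp fun _ _ => Or.inl, ⟨Or.inr (Or.inl ⟨rfl, rfl⟩),
      this.2.1.2.2.2.imp fun _ _ => Or.inl⟩, fun x hx y hy => Or.inl (this.2.2 x hx y hy)⟩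
  · left
    have := h.closing
    cases s <;> simpa using this
  · rintro x y (h1 | ⟨rfl, rfl⟩ | ⟨rfl, rfl⟩)
    · exact Or.inl (h.symm _ _ h1)
    · exact Or.inr (Or.inr ⟨rfl, rfl⟩)
    · exact Or.inr (Or.inl ⟨rfl, rfl⟩)
  · rintro x y (h1 | ⟨rfl, rfl⟩ | ⟨rfl, rfl⟩)
    · exact h.opp _ _ h1
    · omega
    · omega
  · intro x y z w hs hxz hyw
    rcases hxz with hxz | hxz
    · rcases hyw with hyw | hyw
      · exact h.cross _ _ _ _ (hs.trans hsub) hxz hyw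
      · exact not_between_of_nodup hn ((List.sublist_cons_self x _).trans hs) hyw
    · refine not_between_of_nodup hn (x := x) (y := y) (z := z) (List.Sublist.trans ?_ hs) hxz
      exact ((((List.nil_sublist [w]).cons_cons z).cons_cons y).cons_cons x)

lemma remove (h : ChordPolygon R par (s ++ a :: b :: c :: d :: r)) (had : R a d) :
    ChordPolygon R par (s ++ a :: d :: r) := by
  have := h.remove_addEdge
  rwa [addEdge_of_rel h.symm had] at this

lemma ldeg_of_notMem (_ : ChordPolygon R par (s ++ a :: b :: c :: d :: r)) {x : V}
    (hb : ¬ R x b) (hc : ¬ R x c) :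
    ldeg R (s ++ a :: b :: c :: d :: r) x = ldeg R (s ++ a :: d :: r) x := by
  simp [ldeg, List.countP_append, List.countP_cons, hb, hc]

section ear

variable (h : ChordPolygon R par (s ++ a :: b :: c :: d :: r)) (he : IsEar R s a b c d r)
include h he

/-- The only edges at `b` and `c` are `ab`, `bc` and `cd`. Removing the ear therefore costs `a` and
`d` one neighbour each and leaves all other degrees alone. -/
lemma ear_degrees :
    (∀ x ∈ s ++ r, ldeg R (s ++ a :: b :: c :: d :: r) x = ldeg R (s ++ a :: d :: r) x) ∧
    ldeg R (s ++ a :: b :: c :: d :: r) a = ldeg R (s ++ a :: d :: r) a + 1 ∧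
    ldeg R (s ++ a :: b :: c :: d :: r) d = ldeg R (s ++ a :: d :: r) d + 1 ∧
    ldeg R (s ++ a :: b :: c :: d :: r) b = 2 ∧ ldeg R (s ++ a :: b :: c :: d :: r) c = 2 := by
  classical
  obtain ⟨h1, h2, h3⟩ := h.sides
  have hn := h.nodup
  simp only [List.nodup_append, List.nodup_cons, List.mem_cons, not_or] at hn
  obtain ⟨-, ⟨⟨hab, hac, had, har⟩, ⟨hbc, hbd, hbr⟩, ⟨hcd, hcr⟩, hdr, -⟩, hs⟩ := hn
  have hRb : ∀ x ∈ s ++ a :: b :: c :: d :: r, R x b → x = a ∨ x = c := fun x hx hR =>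
    he.left x hx (h.symm _ _ hR)
  have hRc : ∀ x ∈ s ++ a :: b :: c :: d :: r, R x c → x = b ∨ x = d := fun x hx hR =>
    he.right x hx (h.symm _ _ hR)
  have nac : ¬ R a c := fun hR => by
    rcases hRc a (by simp) hR with h | h
    exacts [hab h, had h]
  have ndb : ¬ R d b := fun hR => by
    rcases hRb d (by simp) hR with h | h
    exacts [had h.symm, hcd h.symm]
  have nself : ∀ x, ¬ R x x := fun x hx => by have := h.opp _ _ hx; omega
  refine ⟨?_, ?_, ?_, ?_, ?_⟩
  · intro x hx
    have hx' : x ≠ a ∧ x ≠ b ∧ x ≠ c ∧ x ≠ d := by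
      rcases List.mem_append.1 hx with hx | hx
      · exact ⟨hs x hx a (by simp), hs x hx b (by simp), hs x hx c (by simp), hs x hx d (by simp)⟩
      · refine ⟨?_, ?_, ?_, ?_⟩ <;> rintro rfl <;> contradiction
    have hxm : x ∈ s ++ a :: b :: c :: d :: r := by
      rcases List.mem_append.1 hx with hx | hx <;> simp [hx]
    refine h.ldeg_of_notMem (fun hR => ?_) fun hR => ?_
    · rcases hRb x hxm hR with h | h
      exacts [hx'.1 h, hx'.2.2.1 h]
    · rcases hRc x hxm hR with h | h
      exacts [hx'.2.1 h, hx'.2.2.2 h]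
  · simp [ldeg, List.countP_append, List.countP_cons, h1, nac, nself]
    omega
  · simp [ldeg, List.countP_append, List.countP_cons, ndb, h.symm _ _ h3, nself]
    omega
  · have e1 : ∀ y ∈ s, ¬ R b y := fun y hy hR => by
      rcases he.left y (by simp [hy]) hR with rfl | rfl
      exacts [hs y hy y (by simp) rfl, hs y hy y (by simp) rfl]
    have e2 : ∀ y ∈ r, ¬ R b y := fun y hy hR => by
      rcases he.left y (by simp [hy]) hR with rfl | rfl <;> contradiction
    have nbd : ¬ R b d := fun hR => ndb (h.symm _ _ hR)
    have z1 : s.countP (fun y => decide (R b y)) = 0 := by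
      rw [List.countP_eq_zero]; simpa using e1
    have z2 : r.countP (fun y => decide (R b y)) = 0 := by
      rw [List.countP_eq_zero]; simpa using e2
    simp [ldeg, List.countP_append, nself, nbd, h2, h.symm _ _ h1, z1, z2]
  · have e1 : ∀ y ∈ s, ¬ R c y := fun y hy hR => by
      rcases he.right y (by simp [hy]) hR with rfl | rfl
      exacts [hs y hy y (by simp) rfl, hs y hy y (by simp) rfl]
    have e2 : ∀ y ∈ r, ¬ R c y := fun y hy hR => by
      rcases he.right y (by simp [hy]) hR with rfl | rfl <;> contradiction
    have nca : ¬ R c a := fun hR => nac (h.symm _ _ hR)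
    have z1 : s.countP (fun y => decide (R c y)) = 0 := by
      rw [List.countP_eq_zero]; simpa using e1
    have z2 : r.countP (fun y => decide (R c y)) = 0 := by
      rw [List.countP_eq_zero]; simpa using e2
    simp [ldeg, List.countP_append, nself, nca, h3, h.symm _ _ h2, z1, z2]

/-- Cutting off an ear removes three edges. -/
lemma degSum_ear :
    degSum R (s ++ a :: b :: c :: d :: r) = degSum R (s ++ a :: d :: r) + 6 := by
  obtain ⟨h1, ha, hd, hb, hc⟩ := h.ear_degrees he
  have e1 : s.map (ldeg R (s ++ a :: b :: c :: d :: r)) = s.map (ldeg R (s ++ a :: d :: r)) :=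
    List.map_congr_left fun x hx => h1 x (List.mem_append_left _ hx)
  have e2 : r.map (ldeg R (s ++ a :: b :: c :: d :: r)) = r.map (ldeg R (s ++ a :: d :: r)) :=
    List.map_congr_left fun x hx => h1 x (List.mem_append_right _ hx)
  simp only [degSum, List.map_append, List.map_cons, e1, e2, ha, hd, hb, hc, List.sum_append,
    List.sum_cons]
  omega

end ear

/-- Adding an edge between two vertices raises the sum of the degrees by two. -/
lemma degSum_addEdge (h : ChordPolygon R par (s ++ a :: b :: c :: d :: r)) (had : ¬ R a d) :
    degSum (addEdge R a d) (s ++ a :: d :: r) = degSum R (s ++ a :: d :: r) + 2 := by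
  have hn := h.nodup
  simp only [List.nodup_append, List.nodup_cons, List.mem_cons, not_or] at hn
  obtain ⟨-, ⟨⟨hab, hac, had', har⟩, -, -, hdr, -⟩, hs⟩ := hn
  have hda : ¬ R d a := fun hR => had (h.symm _ _ hR)
  have other : ∀ x, x ≠ a → x ≠ d →
      ldeg (addEdge R a d) (s ++ a :: d :: r) x = ldeg R (s ++ a :: d :: r) x := by
    intro x hxa hxd
    have : ∀ y, addEdge R a d x y ↔ R x y := fun y => by simp [addEdge, hxa, hxd]
    unfold ldeg
    exact List.countP_congr fun y _ => by simp [this]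
  have cnt : ∀ (l : List V) (x y : V), y ∉ l → (∀ z, addEdge R a d x z ↔ R x z ∨ z = y) →
      ∀ (i1 : DecidablePred (addEdge R a d x)) (i2 : DecidablePred (R x)),
      l.countP (fun z => @decide (addEdge R a d x z) (i1 z)) =
        l.countP (fun z => @decide (R x z) (i2 z)) := by
    intro l x y hy hiff i1 i2
    refine List.countP_congr fun z hz => ?_
    simp only [decide_eq_true_eq, hiff]
    exact ⟨fun hh => hh.resolve_right fun he => hy (he ▸ hz), Or.inl⟩
  have ia : ∀ z, addEdge R a d a z ↔ R a z ∨ z = d := fun z => by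
    simp only [addEdge, true_and]
    constructor
    · rintro (h | h | h)
      exacts [Or.inl h, Or.inr h, absurd h.1 had']
    · rintro (h | h)
      exacts [Or.inl h, Or.inr (Or.inl h)]
  have id' : ∀ z, addEdge R a d d z ↔ R d z ∨ z = a := fun z => by
    simp only [addEdge, true_and]
    constructor
    · rintro (h | h | h)
      exacts [Or.inl h, absurd h.1.symm had', Or.inr h]
    · rintro (h | h)
      exacts [Or.inl h, Or.inr (Or.inr h)]
  have nself : ∀ x, ¬ R x x := fun x hx => by have := h.opp _ _ hx; omega
  have q1 : ¬ addEdge R a d a a := by rw [ia]; simp [nself, had']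
  have q2 : addEdge R a d a d := by rw [ia]; simp
  have q3 : ¬ addEdge R a d d d := by rw [id']; simp [nself, Ne.symm had']
  have q4 : addEdge R a d d a := by rw [id']; simp
  have sa : a ∉ s := fun hm => hs a hm a (by simp) rfl
  have sd : d ∉ s := fun hm => hs d hm d (by simp) rfl
  have ea : ldeg (addEdge R a d) (s ++ a :: d :: r) a = ldeg R (s ++ a :: d :: r) a + 1 := by
    unfold ldeg
    rw [List.countP_append, List.countP_append, cnt s a d sd ia, List.countP_cons,
      List.countP_cons, List.countP_cons, List.countP_cons, cnt r a d hdr ia]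
    simp [q1, q2, had, nself]
    omega
  have ed : ldeg (addEdge R a d) (s ++ a :: d :: r) d = ldeg R (s ++ a :: d :: r) d + 1 := by
    unfold ldeg
    rw [List.countP_append, List.countP_append, cnt s d a sa id', List.countP_cons,
      List.countP_cons, List.countP_cons, List.countP_cons, cnt r d a har id']
    simp [q3, q4, hda, nself]
    omega
  have e1 : s.map (ldeg (addEdge R a d) (s ++ a :: d :: r)) = s.map (ldeg R (s ++ a :: d :: r)) :=
    List.map_congr_left fun x hx => other x (fun e => sa (e ▸ hx)) (fun e => sd (e ▸ hx))
  have e2 : r.map (ldeg (addEdge R a d) (s ++ a :: d :: r)) = r.map (ldeg R (s ++ a :: d :: r)) :=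
    List.map_congr_left fun x hx => other x (fun e => har (e ▸ hx)) (fun e => hdr (e ▸ hx))
  simp only [degSum, List.map_append, List.map_cons, e1, e2, ea, ed, List.sum_append,
    List.sum_cons]
  omega

lemma length_ge_two {p : List V} (h : ChordPolygon R par p) : 2 ≤ p.length := by
  have := h.even_length
  have := List.length_pos_of_ne_nil h.ne_nil
  omega

lemma degSum_of_length_two {p : List V} (h : ChordPolygon R par p) (hl : p.length = 2) :
    degSum R p = 2 := by
  obtain ⟨x, y, rfl⟩ := List.length_eq_two.1 hl
  have nself : ∀ x, ¬ R x x := fun x hx => by have := h.opp _ _ hx; omega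
  have hxy : R x y := by simpa using h.closing
  simp [degSum, ldeg, nself, hxy, h.symm _ _ hxy]

/-- A polygon with non-crossing bipartite chords has at most as many edges as a
quadrangulated one. -/
theorem degSum_le : ∀ (N : ℕ) {R : V → V → Prop} {p : List V}, ChordPolygon R par p → p.length ≤ N →
    degSum R p + 4 ≤ 3 * p.length
  | 0, R, p, h, hN => by have := h.length_ge_two; omega
  | N + 1, R, p, h, hN => by
    have h2 := h.length_ge_two
    have hev := h.even_length
    by_cases hl : p.length = 2
    · rw [h.degSum_of_length_two hl, hl]
    · obtain ⟨s, a, b, c, d, r, rfl, e1, e2⟩ := h.exists_ear (by omega)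
      have he : IsEar R s a b c d r := ⟨e1, e2⟩
      -- The shorter polygon has two vertices fewer, so its bound is lower by six, which is the
      -- degree sum lost with the ear. If `ad` had to be added, two units remain to spare.
      have ih := degSum_le N h.remove_addEdge (by simp at hN ⊢; omega)
      rw [h.degSum_ear he]
      simp only [List.length_append, List.length_cons] at ih ⊢
      by_cases had : R a d
      · rw [addEdge_of_rel h.symm had] at ih; omega
      · rw [h.degSum_addEdge had] at ih; omega

/-- In a polygon with the maximum number of edges, ears are cut off by edges. -/
lemma rel_of_ear (h : ChordPolygon R par (s ++ a :: b :: c :: d :: r)) (he : IsEar R s a b c d r)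
    (hfull : degSum R (s ++ a :: b :: c :: d :: r) + 4 =
      3 * (s ++ a :: b :: c :: d :: r).length) : R a d := by
  by_contra had
  have := degSum_le _ h.remove_addEdge le_rfl
  rw [h.degSum_addEdge had] at this
  rw [h.degSum_ear he] at hfull
  simp only [List.length_append, List.length_cons] at this hfull
  omega

end ChordPolygon

end Polygons

/-! ### Reconfigurable cycles are quadrangulated -/

section Completeness

variable {V : Type*} {G : SimpleGraph V}

lemma exists_mate_of_isPerfectMatching {M : G.Subgraph} (hM : M.IsPerfectMatching) :
    ∃ f : V → V, IsMate G f ∧ ∀ u w, M.Adj u w ↔ f u = w := by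
  have hex : ∀ v, ∃! w, M.Adj v w := fun v => hM.1 (hM.2 v)
  choose f hf hu using hex
  have hiff : ∀ u w, M.Adj u w ↔ f u = w := fun u w =>
    ⟨fun h => (hu u w h).symm, fun h => h ▸ hf u⟩
  refine ⟨f, ⟨fun v => ?_, fun v => (hf v).adj_sub⟩, hiff⟩
  exact (hiff _ _).1 (hf v).symm

lemma FlipAlong.rotate {a b c d : V} {M M' : G.Subgraph} (h : FlipAlong a b c d M M') :
    FlipAlong b c d a M M' := by
  obtain ⟨h1, h2, h3, h4⟩ := h
  refine ⟨h1, h2, ?_, ?_⟩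
  · simp only [List.nodup_cons, List.mem_cons, List.not_mem_nil, or_false, not_or] at h3 ⊢
    tauto
  · rw [h4]
    ext e
    simp only [Set.mem_insert_iff, Set.mem_singleton_iff]
    tauto

/-- A vertex whose partner changes in a flip lies opposite to a vertex joined to both partners. -/
lemma FlipAdj.exists_opposite {M M' : G.Subgraph} (h : FlipAdj M M') {b y y' : V}
    (hy : M.Adj b y) (hy' : M'.Adj b y') (hne : y ≠ y') :
    ∃ z, z ≠ b ∧ (M.Adj y z ∨ M'.Adj y z) ∧ (M.Adj y' z ∨ M'.Adj y' z) := by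
  obtain ⟨p0, p1, p2, p3, h⟩ := h
  have hmem : ∀ e : Sym2 V, e ∈ symmDiff M.edgeSet M'.edgeSet ↔
      e = s(p0, p1) ∨ e = s(p1, p2) ∨ e = s(p2, p3) ∨ e = s(p3, p0) := fun e => by
    rw [h.2.2.2]; simp
  have h1 : s(b, y) ∈ symmDiff M.edgeSet M'.edgeSet := by
    refine Or.inl ⟨hy, fun hm => hne ?_⟩
    have hm' : M'.Adj b y := hm
    exact (h.2.1.1 (h.2.1.2 b)).unique hm' hy'
  have h2 : s(b, y') ∈ symmDiff M.edgeSet M'.edgeSet := by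
    refine Or.inr ⟨hy', fun hm => hne ?_⟩
    have hm' : M.Adj b y' := hm
    exact (h.1.1 (h.1.2 b)).unique hy hm'
  -- The 4-cycle is rotated to start at `b`. Its two edges at `b` lead to `y` and `y'`, and `q2` is
  -- the opposite vertex.
  obtain ⟨q1, q2, q3, hq⟩ : ∃ q1 q2 q3, FlipAlong b q1 q2 q3 M M' := by
    have hb : b = p0 ∨ b = p1 ∨ b = p2 ∨ b = p3 := by
      rcases (hmem _).1 h1 with h | h | h | h <;> rcases Sym2.eq_iff.1 h with h | h <;>
        simp [h.1]
    rcases hb with rfl | rfl | rfl | rfl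
    exacts [⟨_, _, _, h⟩, ⟨_, _, _, h.rotate⟩, ⟨_, _, _, h.rotate.rotate⟩,
      ⟨_, _, _, h.rotate.rotate.rotate⟩]
  have hn := hq.2.2.1
  simp only [List.nodup_cons, List.mem_cons, List.not_mem_nil, or_false, not_or] at hn
  have hmem' : ∀ e : Sym2 V, e ∈ symmDiff M.edgeSet M'.edgeSet ↔
      e = s(b, q1) ∨ e = s(q1, q2) ∨ e = s(q2, q3) ∨ e = s(q3, b) := fun e => by
    rw [hq.2.2.2]; simp
  have hends : ∀ w, s(b, w) ∈ symmDiff M.edgeSet M'.edgeSet → w = q1 ∨ w = q3 := by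
    intro w hw
    rcases (hmem' _).1 hw with h | h | h | h <;> rcases Sym2.eq_iff.1 h with h | h
    · exact Or.inl h.2
    · exact absurd h.1 hn.1.1
    · exact absurd h.1 hn.1.1
    · exact absurd h.1 hn.1.2.1
    · exact absurd h.1 hn.1.2.1
    · exact absurd h.1 hn.1.2.2
    · exact absurd h.1 hn.1.2.2
    · exact Or.inr h.2
  have hor : ∀ u w, s(u, w) ∈ symmDiff M.edgeSet M'.edgeSet → M.Adj u w ∨ M'.Adj u w := by
    rintro u w (h | h)
    exacts [Or.inl h.1, Or.inr h.1]
  have e1 := hor q1 q2 ((hmem' _).2 (by simp))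
  have e3 := hor q3 q2 ((hmem' _).2 (by simp))
  refine ⟨q2, fun e => hn.1.2.1 e.symm, ?_, ?_⟩
  · rcases hends y h1 with rfl | rfl <;> assumption
  · rcases hends y' h2 with rfl | rfl <;> assumption

/-- The sides and chords used by the algorithm: edges of `G` between vertices of opposite
parity. -/
def oppAdj (G : SimpleGraph V) (par : V → ℕ) (x y : V) : Prop :=
  G.Adj x y ∧ ((par x = 0 ∧ par y = 1) ∨ (par x = 1 ∧ par y = 0))

lemma IsBlock.par_cases {f g : V → V} {par : V → ℕ} {v : V} {t : List V}
    (h : IsBlock f g par v t) : ∀ x ∈ v :: t, par x = 0 ∨ par x = 1 := by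
  have key : ∀ l : List V, List.IsChain (AltStep f g par) (l ++ [v]) →
      ∀ x ∈ l, par x = 0 ∨ par x = 1 := by
    intro l
    induction l with
    | nil => simp
    | cons y l ih =>
      intro hc x hx
      rcases List.mem_cons.1 hx with rfl | hx
      · cases l with
        | nil =>
          simp only [List.cons_append, List.nil_append, List.isChain_cons_cons] at hc
          rcases hc.1 with h | h <;> simp [h.1]
        | cons z l =>
          simp only [List.cons_append, List.isChain_cons_cons] at hc
          rcases hc.1 with h | h <;> simp [h.1]
      · exact ih (List.isChain_cons.1 hc).2 x hx
  exact key _ h.chain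

lemma IsBlock.chordPolygon {f g : V → V} (hf : IsMate G f) (hg : IsMate G g) {par : V → ℕ} {v : V}
    {t : List V} (h : IsBlock f g par v t) {θ : V → ℝ} (hθ : NonCrossing G θ)
    (hp : (v :: t).Pairwise fun a b => θ a < θ b) : ChordPolygon (oppAdj G par) par (v :: t) := by
  have hstep : ∀ x y, AltStep f g par x y → oppAdj G par x y := fun x y hs =>
    ⟨hs.adj hf hg, by rcases hs with h | h <;> simp [h.1, h.2.1]⟩
  have hsymm : ∀ x y, oppAdj G par x y → oppAdj G par y x := fun x y hs =>
    ⟨hs.1.symm, by have := hs.2; tauto⟩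
  have hch : List.IsChain (oppAdj G par) (v :: t ++ [v]) := h.chain.imp hstep
  have hch' := List.isChain_append.1 hch
  refine ⟨h.nodup, by simp, hch'.1, ?_, hsymm, fun x y hs => hs.2, ?_⟩
  · exact hsymm _ _ (hch'.2.2 _ (List.getLast_mem_getLast? _) v (by simp))
  · intro a b c d hs hac hbd
    have := hp.sublist hs
    simp only [List.pairwise_cons, List.mem_cons, List.not_mem_nil, or_false, forall_eq_or_imp,
      forall_eq] at this
    exact hθ a b c d this.1.1 this.2.1.1 this.2.2.1 hac.1 hbd.1

/-- The path from `c` around the closing side to `a`, avoiding `b`. It shows that an edge from `b`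
to a vertex off the polygon cannot separate `a` from `c`. -/
lemma ChordPolygon.cyclic_chain {R : V → V → Prop} {par : V → ℕ} {s r : List V} {a b c d : V}
    (h : ChordPolygon R par (s ++ a :: b :: c :: d :: r)) :
    List.IsChain R (c :: d :: r ++ (s ++ [a])) := by
  have hc := List.isChain_append.1 h.chain
  have h2 := hc.2.1
  simp only [List.isChain_cons_cons] at h2
  rw [List.isChain_append]
  refine ⟨List.isChain_cons_cons.2 h2.2.2, ?_, ?_⟩
  · rw [List.isChain_append]
    refine ⟨hc.1, by simp, ?_⟩
    intro x hx y hy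
    exact hc.2.2 x hx y (by simpa using hy)
  · intro x hx y hy
    have hcl := h.closing
    have e1 : (s ++ a :: b :: c :: d :: r).getLast h.ne_nil = x := by
      obtain ⟨h1, h2⟩ := List.mem_getLast?_eq_getLast hx
      rw [h2]; simp
    have e2 : (s ++ a :: b :: c :: d :: r).head h.ne_nil = y := by
      cases s <;> simpa using hy
    rw [e1, e2] at hcl
    exact h.symm _ _ hcl

/-- If the partner of the ear vertex `b` passes from one side to the other in a flip, then the ear
is cut off by an edge. -/
lemma ChordPolygon.adj_of_flip {θ : V → ℝ} (hnc : NonCrossing G θ) (hθ : Function.Injective θ)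
    {par : V → ℕ} {s r : List V} {a b c d : V}
    (h : ChordPolygon (oppAdj G par) par (s ++ a :: b :: c :: d :: r))
    (he : IsEar (oppAdj G par) s a b c d r)
    (hp : (s ++ a :: b :: c :: d :: r).Pairwise fun x y => θ x < θ y)
    {col : V → Prop}
    (hcol : ∀ x ∈ s ++ a :: b :: c :: d :: r, ∀ y ∈ s ++ a :: b :: c :: d :: r,
      ((col x ↔ ¬ col y) ↔ ((par x = 0 ∧ par y = 1) ∨ (par x = 1 ∧ par y = 0))))
    {y y' z : V} (hy : G.Adj b y) (hy' : G.Adj b y') (hyz : G.Adj y z) (hyz' : G.Adj y' z)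
    (hzb : z ≠ b) (hlt : θ y < θ b) (hlt' : θ b < θ y')
    (cy : col b ↔ ¬ col y) (cy' : col b ↔ ¬ col y') (cz : col y ↔ ¬ col z) : oppAdj G par a d := by
  obtain ⟨hab, hbc, hcd⟩ := h.sides
  have hcyc := h.cyclic_chain.imp fun _ _ hs => hs.1
  have hp' := (List.pairwise_append.1 hp).2.1
  simp only [List.pairwise_cons, List.mem_cons, forall_eq_or_imp] at hp'
  obtain ⟨⟨lab, lac, lad, -⟩, ⟨lbc, lbd, -⟩, ⟨lcd, -⟩, -⟩ := hp'
  have hn := h.nodup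
  simp only [List.nodup_append, List.nodup_cons, List.mem_cons, not_or] at hn
  obtain ⟨-, ⟨⟨nab, nac, nad, nar⟩, ⟨nbc, nbd, nbr⟩, ⟨ncd, ncr⟩, ndr, -⟩, ns⟩ := hn
  have nsb : b ∉ s := fun hm => ns b hm b (by simp) rfl
  have nsc : c ∉ s := fun hm => ns c hm c (by simp) rfl
  have hbcyc : b ∉ c :: d :: r ++ (s ++ [a]) := by
    simp only [List.mem_append, List.mem_cons, List.not_mem_nil, or_false, not_or]
    exact ⟨⟨nbc, nbd, nbr⟩, nsb, fun h => nab h.symm⟩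
  have hmemcyc : ∀ x, x ∈ c :: d :: r ++ (s ++ [a]) → x ∈ s ++ a :: b :: c :: d :: r := by
    intro x hx
    simp only [List.mem_append, List.mem_cons, List.not_mem_nil, or_false] at hx ⊢
    tauto
  have hamem : a ∈ c :: d :: r ++ (s ++ [a]) := by simp
  have cab : col a ↔ ¬ col b := (hcol a (by simp) b (by simp)).2 hab.2
  have cbc : col b ↔ ¬ col c := (hcol b (by simp) c (by simp)).2 hbc.2
  -- On the polygon, the ear property leaves only `a` and `c` as values of `y`. Off the polygon, an
  -- edge `yb` with `y` before `a` would separate `a` from `c`, which remain joined by the rest of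
  -- the polygon.
  have hya : θ a ≤ θ y := by
    by_contra! hlt2
    by_cases hyp : y ∈ s ++ a :: b :: c :: d :: r
    · have := (hcol b (by simp) y hyp).1 cy
      rcases he.left y hyp ⟨hy, this⟩ with rfl | rfl
      · exact lt_irrefl _ hlt2
      · linarith
    · have := hnc.inside_iff_of_chain hθ hy.symm _ _ hcyc (fun hm => hyp (hmemcyc _ hm)) hbcyc a
        hamem
      have := (this.1 ⟨hlt2, lab⟩).2
      linarith
  have hyc : θ y' ≤ θ c := by
    by_contra! hlt2
    by_cases hyp : y' ∈ s ++ a :: b :: c :: d :: r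
    · have := (hcol b (by simp) y' hyp).1 cy'
      rcases he.left y' hyp ⟨hy', this⟩ with rfl | rfl
      · linarith
      · exact lt_irrefl _ hlt2
    · have := hnc.inside_iff_of_chain hθ hy' _ _ hcyc hbcyc (fun hm => hyp (hmemcyc _ hm)) a
        hamem
      have := (this.2 ⟨lbc, hlt2⟩).1
      linarith
  have czb : col b ↔ col z := by rw [cy, cz, not_not]
  -- Otherwise `y` lies strictly under the side `ab`. As `z` has the colour of `b`, it is not `a`,
  -- so `ab` confines `z` and then `y'`, although `y'` lies beyond `b`.
  have hya' : y = a := by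
    by_contra hne
    have hin : Inside θ a b y := ⟨lt_of_le_of_ne hya fun e => hne (hθ e).symm, hlt⟩
    have hza : z ≠ a := by rintro rfl; rw [czb] at cab; exact iff_not_self cab
    have hzin := hnc.inside_of_adj hθ hab.1 hyz hin hza hzb
    have hy'in := hnc.inside_of_adj hθ hab.1 hyz'.symm hzin
      (fun e => by rw [e] at hlt'; linarith) (fun e => by rw [e] at hlt'; linarith)
    linarith [hy'in.2]
  have hyc' : y' = c := by
    by_contra hne
    have hin : Inside θ b c y' := ⟨hlt', lt_of_le_of_ne hyc fun e => hne (hθ e)⟩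
    have hzc : z ≠ c := by rintro rfl; rw [czb] at cbc; exact iff_not_self cbc
    have hzin := hnc.inside_of_adj hθ hbc.1 hyz' hin hzb hzc
    have hyin := hnc.inside_of_adj hθ hbc.1 hyz.symm hzin
      (fun e => by rw [e] at hlt; linarith) (fun e => by rw [e] at hlt; linarith)
    linarith [hyin.1]
  subst hya' hyc'
  -- On the polygon this is the ear property of `c`. Off it, wherever `z` lies in the order:
  -- strictly between two of the successive vertices `a`, `b`, `c`, `d`, one of the edges `az`, `cz`
  -- crosses a side; before `a` or after `d`, the edge `cz` separates `a` from `d`, which are joined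
  -- by the polygon without `b` and `c`.
  have hzd : z = d := by
    by_contra hne
    by_cases hzp : z ∈ s ++ y :: b :: y' :: d :: r
    · have hpar := (hcol y' (by simp) z hzp).1 (by rw [← czb, cbc, not_not])
      rcases he.right z hzp ⟨hyz', hpar⟩ with rfl | rfl
      exacts [hzb rfl, hne rfl]
    · have hzmem : z ∉ d :: r ++ (s ++ [y]) := fun hm => hzp (hmemcyc z (List.mem_cons_of_mem _ hm))
      have hch : List.IsChain G.Adj (d :: (r ++ (s ++ [y]))) := by
        have := (List.isChain_cons.1 hcyc).2
        simpa using this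
      have hcmem : y' ∉ d :: r ++ (s ++ [y]) := by
        simp only [List.mem_append, List.mem_cons, List.not_mem_nil, or_false, not_or]
        exact ⟨⟨ncd, ncr⟩, nsc, fun e => nac e.symm⟩
      have hzy : θ z ≠ θ y := fun e => hyz.ne (hθ e).symm
      have hzb' : θ z ≠ θ b := fun e => hzb (hθ e)
      have hzc : θ z ≠ θ y' := fun e => hyz'.ne (hθ e).symm
      have hzd' : θ z ≠ θ d := fun e => hne (hθ e)
      rcases lt_or_gt_of_ne hzy with l1 | l1
      · have hside := hnc.inside_iff_of_chain hθ hyz'.symm _ _ hch hzmem hcmem y (by simp)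
        have := (hside.1 ⟨l1, lac⟩).2
        linarith
      rcases lt_or_gt_of_ne hzb' with l2 | l2
      · exact hnc y z b y' l1 l2 lbc hab.1 hyz'.symm
      rcases lt_or_gt_of_ne hzc with l3 | l3
      · exact hnc y b z y' lab l2 l3 hyz hbc.1
      rcases lt_or_gt_of_ne hzd' with l4 | l4
      · exact hnc y y' z d lac l3 l4 hyz hcd.1
      · have hside := hnc.inside_iff_of_chain hθ hyz' _ _ hch hcmem hzmem y (by simp)
        have := (hside.2 ⟨lcd, l4⟩).1
        linarith
  subst hzd
  exact ⟨hyz, (hcol y (by simp) z (by simp)).1 cz⟩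

/-- Along an alternating cycle the two partners of a vertex are its two neighbours. -/
lemma IsBlock.partners {f g : V → V} (hf : IsMate G f) (hg : IsMate G g) {par : V → ℕ} {v : V}
    {t : List V} (h : IsBlock f g par v t) {θ : V → ℝ}
    (hp : (v :: t).Pairwise fun a b => θ a < θ b) {x b y : V} (hx : x ∈ v :: t) (hb : b ∈ v :: t)
    (hy : y ∈ v :: t) (hxb : θ x < θ b) (hby : θ b < θ y) :
    (θ (f b) < θ b ∧ θ b < θ (g b)) ∨ (θ (g b) < θ b ∧ θ b < θ (f b)) := by
  obtain ⟨l1, l2, hl⟩ := List.append_of_mem hb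
  have hch := h.chain
  rw [hl] at hch hp hx hy
  have hp' := List.pairwise_append.1 hp
  have hp2 := List.pairwise_cons.1 hp'.2.1
  have n1 : l1 ≠ [] := by
    rintro rfl
    rcases List.mem_cons.1 (by simpa using hx) with rfl | hx
    · exact lt_irrefl _ hxb
    · linarith [hp2.1 x hx]
  have n2 : l2 ≠ [] := by
    rintro rfl
    rcases List.mem_append.1 hy with hy | hy
    · linarith [hp'.2.2 y hy b (by simp)]
    · simp only [List.mem_singleton] at hy
      rw [hy] at hby
      exact lt_irrefl _ hby
  obtain ⟨k, x', rfl⟩ := (List.eq_nil_or_concat' l1).resolve_left n1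
  obtain ⟨y', m, rfl⟩ := List.exists_cons_of_ne_nil n2
  have lx : θ x' < θ b := hp'.2.2 x' (by simp) b (by simp)
  have ly : θ b < θ y' := hp2.1 y' (by simp)
  have hc : AltStep f g par x' b ∧ AltStep f g par b y' := by
    simp only [List.append_assoc, List.cons_append, List.nil_append] at hch
    have := (List.isChain_append.1 hch).2.1
    simp only [List.isChain_cons_cons] at this
    exact ⟨this.1, this.2.1⟩
  rcases hc with ⟨⟨-, p1, rfl⟩ | ⟨-, p1, rfl⟩, ⟨p2, -, rfl⟩ | ⟨p2, -, rfl⟩⟩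
  · omega
  · left; rw [hf.invol] at *; exact ⟨lx, ly⟩
  · right; rw [hg.invol] at *; exact ⟨lx, ly⟩
  · omega

/-- In a YES-instance every alternating cycle has the maximum number of chords. -/
theorem IsBlock.degSum_eq_of_reconfigurable [Fintype V] (hG : IsOuterplanar G)
    {M N : G.Subgraph} (hM : M.IsPerfectMatching) (hN : N.IsPerfectMatching)
    {f g : V → V} (hf : IsMate G f) (hg : IsMate G g) (hMf : ∀ v, M.Adj v (f v))
    (hNg : ∀ v, N.Adj v (g v)) (hrec : Reconfigurable M N) {par : V → ℕ} {v : V} {t : List V}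
    (h : IsBlock f g par v t) :
    degSum (oppAdj G par) (v :: t) + 4 = 3 * (v :: t).length := by
  obtain ⟨θ, hθ, hnc, hpw⟩ := h.exists_nonCrossing hG hf hg
  have hpoly := h.chordPolygon hf hg hnc hpw
  have hcolM : ∀ {M : G.Subgraph}, M.IsPerfectMatching → ∀ u w, M.Adj u w →
      (colour θ u ↔ ¬ colour θ w) := by
    intro M hM u w huw
    obtain ⟨m, hm, hiff⟩ := exists_mate_of_isPerfectMatching hM
    have := hnc.colour_mate hθ hm u
    rw [(hiff u w).1 huw] at this
    tauto
  -- Parity and colour both change at every step of the cycle, so on the cycle they agree up to one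
  -- global exchange. Unlike the parity, the colour controls all perfect matchings and all vertices.
  have hcolpar : ∀ x ∈ v :: t, (par x = 0 ∨ par x = 1) ∧
      ((colour θ x ↔ colour θ v) ↔ par x = 0) := by
    have key : ∀ (l : List V) (y : V), par y = 0 ∨ par y = 1 →
        ((colour θ y ↔ colour θ v) ↔ par y = 0) → List.IsChain (AltStep f g par) (y :: l) →
        ∀ x ∈ y :: l, (par x = 0 ∨ par x = 1) ∧ ((colour θ x ↔ colour θ v) ↔ par x = 0) := by
      intro l
      induction l with
      | nil =>
        intro y h1 h2 _ x hx
        simp only [List.mem_singleton] at hx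
        exact hx ▸ ⟨h1, h2⟩
      | cons z l ih =>
        intro y h1 h2 hc x hx
        rw [List.isChain_cons_cons] at hc
        rcases List.mem_cons.1 hx with rfl | hx
        · exact ⟨h1, h2⟩
        · refine ih z ?_ ?_ hc.2 x hx
          · rcases hc.1 with h | h <;> simp [h.2.1]
          · rcases hc.1 with ⟨q1, q2, rfl⟩ | ⟨q1, q2, rfl⟩
            · rw [hnc.colour_mate hθ hf]
              simp only [q1, q2] at h2 ⊢
              simp only [iff_true, one_ne_zero, iff_false] at h2 ⊢
              tauto
            · rw [hnc.colour_mate hθ hg]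
              simp only [q1, q2] at h2 ⊢
              simp only [iff_true, one_ne_zero, iff_false] at h2 ⊢
              tauto
    exact key t v (Or.inl h.par_eq) (by simp [h.par_eq]) (List.isChain_append.1 h.chain).1
  have hcol : ∀ x ∈ v :: t, ∀ y ∈ v :: t, ((colour θ x ↔ ¬ colour θ y) ↔
      ((par x = 0 ∧ par y = 1) ∨ (par x = 1 ∧ par y = 0))) := by
    intro x hx y hy
    obtain ⟨h1, h2⟩ := hcolpar x hx
    obtain ⟨h3, h4⟩ := hcolpar y hy
    rcases h1 with h1 | h1 <;> rcases h3 with h3 | h3 <;> simp only [h1, h3] at h2 h4 ⊢ <;>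
      simp only [iff_true, one_ne_zero, zero_ne_one, iff_false, and_self, and_true, and_false,
        or_true, or_false] at h2 h4 ⊢ <;> tauto
  obtain ⟨q, S, hS0, hSq, hflip⟩ := hrec
  have hSp : ∀ i ≤ q, (S i).IsPerfectMatching := by
    intro i hi
    rcases Nat.lt_or_ge i q with hlt | hge
    · obtain ⟨_, _, _, _, hh⟩ := hflip i hlt
      exact hh.1
    · rw [le_antisymm hi hge, hSq]; exact hN
  have main : ∀ (k : ℕ) (p : List V), p.length ≤ k → p <+ v :: t →
      ChordPolygon (oppAdj G par) par p → degSum (oppAdj G par) p + 4 = 3 * p.length := by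
    intro k
    induction k with
    | zero => intro p hk _ hp; have := hp.length_ge_two; omega
    | succ k ih =>
      intro p hk hsub hp
      have h2 := hp.length_ge_two
      have hev := hp.even_length
      by_cases hl : p.length = 2
      · rw [hp.degSum_of_length_two hl, hl]
      · obtain ⟨s, a, b, c, d, r, rfl, e1, e2⟩ := hp.exists_ear (by omega)
        have he : IsEar (oppAdj G par) s a b c d r := ⟨e1, e2⟩
        have had : oppAdj G par a d := by
          have hpw' := hpw.sublist hsub
          have hp' := (List.pairwise_append.1 hpw').2.1
          simp only [List.pairwise_cons, List.mem_cons, forall_eq_or_imp] at hp'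
          have hpart := h.partners hf hg hpw (x := a) (b := b) (y := c) (hsub.subset (by simp))
            (hsub.subset (by simp)) (hsub.subset (by simp)) hp'.1.1 hp'.2.1.1
          -- The partner of `b` is `f b` at the start and `g b` at the end. These lie on different
          -- sides of `b`, even when earlier cuts have made `a` and `c` the neighbours of `b` in
          -- place of them. Some flip must change the side.
          have hcross : ∃ i < q, ∃ y y', ((S i).Adj b y ∧ (S (i + 1)).Adj b y' ∨
              (S i).Adj b y' ∧ (S (i + 1)).Adj b y) ∧ θ y < θ b ∧ θ b < θ y' := by
            by_contra! hno
            have hside : ∀ i ≤ q, ∀ y, (S i).Adj b y → (θ y < θ b ↔ θ (f b) < θ b) := by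
              intro i
              induction i with
              | zero =>
                intro _ y hy
                rw [hS0] at hy
                rw [(hM.1 (hM.2 b)).unique hy (hMf b)]
              | succ i ihi =>
                intro hi y hy
                obtain ⟨y0, hy0, -⟩ := (hSp i (by omega)).1 ((hSp i (by omega)).2 b)
                rw [← ihi (by omega) y0 hy0]
                have ny : θ y ≠ θ b := fun e => hy.ne (hθ e).symm
                have ny0 : θ y0 ≠ θ b := fun e => hy0.ne (hθ e).symm
                constructor
                · intro hlt
                  by_contra hge
                  have := hno i hi y y0 (Or.inr ⟨hy0, hy⟩) hlt
                  exact hge (lt_of_le_of_ne this ny0)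
                · intro hlt
                  have := hno i hi y0 y (Or.inl ⟨hy0, hy⟩) hlt
                  exact lt_of_le_of_ne this ny
            have := hside q le_rfl (g b) (by rw [hSq]; exact hNg b)
            rcases hpart with ⟨h1, h2⟩ | ⟨h1, h2⟩
            · linarith [this.2 h1]
            · linarith [this.1 h1]
          obtain ⟨i, hi, y, y', hyy, hlt, hlt'⟩ := hcross
          have hne : y ≠ y' := by rintro rfl; linarith
          have p1 := hSp i hi.le
          have p2 := hSp (i + 1) hi
          obtain ⟨z, hzb, hyz, hyz'⟩ : ∃ z, z ≠ b ∧ ((S i).Adj y z ∨ (S (i + 1)).Adj y z) ∧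
              ((S i).Adj y' z ∨ (S (i + 1)).Adj y' z) := by
            rcases hyy with ⟨h1, h2⟩ | ⟨h1, h2⟩
            · exact (hflip i hi).exists_opposite h1 h2 hne
            · obtain ⟨z, hz, h3, h4⟩ := (hflip i hi).exists_opposite h1 h2 hne.symm
              exact ⟨z, hz, h4, h3⟩
          have hby : (S i).Adj b y ∨ (S (i + 1)).Adj b y := by tauto
          have hby' : (S i).Adj b y' ∨ (S (i + 1)).Adj b y' := by tauto
          have gadj : ∀ u w, ((S i).Adj u w ∨ (S (i + 1)).Adj u w) → G.Adj u w := by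
            rintro u w (h | h)
            exacts [h.adj_sub, h.adj_sub]
          have gcol : ∀ u w, ((S i).Adj u w ∨ (S (i + 1)).Adj u w) →
              (colour θ u ↔ ¬ colour θ w) := by
            rintro u w (h | h)
            exacts [hcolM p1 _ _ h, hcolM p2 _ _ h]
          exact hp.adj_of_flip hnc hθ he hpw' (col := colour θ)
            (fun x hx y hy => hcol x (hsub.subset hx) y (hsub.subset hy))
            (gadj _ _ hby) (gadj _ _ hby') (gadj _ _ hyz) (gadj _ _ hyz') hzb hlt hlt'
            (gcol _ _ hby) (gcol _ _ hby') (gcol _ _ hyz)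
        have := ih _ (by simp at hk ⊢; omega) (ChordPolygon.remove_sublist.trans hsub)
          (hp.remove had)
        rw [hp.degSum_ear he]
        simp only [List.length_append, List.length_cons] at this ⊢
        omega
  exact main _ _ le_rfl (List.Sublist.refl _) hpoly

end Completeness

/-! ### Sequences of flips -/

section Flips

variable {V : Type*} {G : SimpleGraph V}

/-- The perfect matching in which `f` gives the partner of each vertex. -/
def mateSub (G : SimpleGraph V) (f : V → V) : G.Subgraph where
  verts := Set.univ
  Adj u v := G.Adj u v ∧ f u = v ∧ f v = u
  adj_sub h := h.1
  edge_vert _ := Set.mem_univ _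
  symm := ⟨fun _ _ h => ⟨h.1.symm, h.2.2, h.2.1⟩⟩

lemma IsMate.mateSub_adj {f : V → V} (hf : IsMate G f) (u v : V) :
    (mateSub G f).Adj u v ↔ f u = v := by
  refine ⟨fun h => h.2.1, ?_⟩
  rintro rfl
  exact ⟨hf.adj u, rfl, hf.invol u⟩

lemma IsMate.isPerfectMatching {f : V → V} (hf : IsMate G f) :
    (mateSub G f).IsPerfectMatching := by
  refine ⟨fun v _ => ⟨f v, (hf.mateSub_adj _ _).2 rfl, fun w hw => ?_⟩, fun v => Set.mem_univ v⟩
  exact ((hf.mateSub_adj _ _).1 hw).symm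

lemma eq_mateSub {M : G.Subgraph} (hM : M.IsPerfectMatching) {f : V → V}
    (hf : ∀ v, M.Adj v (f v)) : IsMate G f ∧ M = mateSub G f := by
  obtain ⟨m, hm, hiff⟩ := exists_mate_of_isPerfectMatching hM
  have : m = f := funext fun v => (hiff v (f v)).1 (hf v)
  subst this
  refine ⟨hm, SimpleGraph.Subgraph.ext ?_ ?_⟩
  · exact SimpleGraph.Subgraph.isSpanning_iff.1 hM.2
  · funext u w
    rw [hm.mateSub_adj, hiff]

lemma FlipAlong.symm {a b c d : V} {M M' : G.Subgraph} (h : FlipAlong a b c d M M') :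
    FlipAlong a b c d M' M :=
  ⟨h.2.1, h.1, h.2.2.1, by rw [symmDiff_comm]; exact h.2.2.2⟩

/-- Rematch `a`, `b`, `c`, `d` as `a d` and `b c`. -/
def flipMate [DecidableEq V] (f : V → V) (a b c d : V) (x : V) : V :=
  if x = a then d else if x = d then a else if x = b then c else if x = c then b else f x

section flipMate

variable [DecidableEq V] {f : V → V} {a b c d : V}

lemma flipMate_of_ne {x : V} (ha : x ≠ a) (hb : x ≠ b) (hc : x ≠ c) (hd : x ≠ d) :
    flipMate f a b c d x = f x := by simp [flipMate, ha, hb, hc, hd]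

lemma flipMate_apply (h : [a, b, c, d].Nodup) : flipMate f a b c d a = d ∧
    flipMate f a b c d b = c ∧ flipMate f a b c d c = b ∧ flipMate f a b c d d = a := by
  simp only [List.nodup_cons, List.mem_cons, List.not_mem_nil, or_false, not_or] at h
  obtain ⟨⟨h1, h2, h3⟩, ⟨h4, h5⟩, h6, -⟩ := h
  simp only [flipMate]
  simp [Ne.symm h1, Ne.symm h2, Ne.symm h3, Ne.symm h4, h5, h6]

/-- The four vertices are matched among themselves before and after, so the involution is
undisturbed elsewhere and the two matchings differ exactly in the edges of the 4-cycle. -/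
lemma IsMate.flip (hf : IsMate G f) (h : [a, b, c, d].Nodup) (hab : f a = b) (hcd : f c = d)
    (hbc : G.Adj b c) (had : G.Adj a d) :
    IsMate G (flipMate f a b c d) ∧
      FlipAlong a b c d (mateSub G f) (mateSub G (flipMate f a b c d)) := by
  obtain ⟨e1, e2, e3, e4⟩ := flipMate_apply (f := f) h
  have hba : f b = a := by rw [← hab, hf.invol]
  have hdc : f d = c := by rw [← hcd, hf.invol]
  have hother : ∀ x, x ≠ a → x ≠ b → x ≠ c → x ≠ d → f x ≠ a ∧ f x ≠ b ∧ f x ≠ c ∧ f x ≠ d := by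
    intro x h1 h2 h3 h4
    refine ⟨?_, ?_, ?_, ?_⟩ <;> intro e <;> have := congrArg f e <;> rw [hf.invol] at this
    · exact h2 (this.trans hab)
    · exact h1 (this.trans hba)
    · exact h4 (this.trans hcd)
    · exact h3 (this.trans hdc)
  have hm : IsMate G (flipMate f a b c d) := by
    constructor <;> intro x
    all_goals
      by_cases ha : x = a
      · subst ha; first | rw [e1, e4] | (rw [e1]; exact had)
      by_cases hb : x = b
      · subst hb; first | rw [e2, e3] | (rw [e2]; exact hbc)
      by_cases hc : x = c
      · subst hc; first | rw [e3, e2] | (rw [e3]; exact hbc.symm)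
      by_cases hd : x = d
      · subst hd; first | rw [e4, e1] | (rw [e4]; exact had.symm)
      rw [flipMate_of_ne ha hb hc hd]
      try
        obtain ⟨q1, q2, q3, q4⟩ := hother x ha hb hc hd
        rw [flipMate_of_ne q1 q2 q3 q4, hf.invol]
    exact hf.adj x
  refine ⟨hm, hf.isPerfectMatching, hm.isPerfectMatching, h, ?_⟩
  simp only [List.nodup_cons, List.mem_cons, List.not_mem_nil, or_false, not_or] at h
  obtain ⟨⟨h1, h2, h3⟩, ⟨h4, h5⟩, h6, -⟩ := h
  ext e
  induction e with
  | h x y =>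
  simp only [Set.mem_symmDiff, SimpleGraph.Subgraph.mem_edgeSet, hf.mateSub_adj, hm.mateSub_adj,
    Set.mem_insert_iff, Set.mem_singleton_iff, Sym2.eq_iff]
  by_cases ha : x = a
  · subst ha; rw [e1, hab]; constructor
    · rintro (⟨rfl, -⟩ | ⟨rfl, -⟩) <;> simp
    · rintro (((⟨-, rfl⟩ | ⟨e, -⟩) | (⟨e, -⟩ | ⟨e, -⟩) | (⟨e, -⟩ | ⟨e, -⟩) | (⟨e, -⟩ | ⟨-, rfl⟩))) <;>
        first | contradiction | simp [h5, Ne.symm h5]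
  by_cases hb : x = b
  · subst hb; rw [e2, hba]; constructor
    · rintro (⟨rfl, -⟩ | ⟨rfl, -⟩) <;> simp
    · rintro (((⟨e, -⟩ | ⟨-, rfl⟩) | (⟨-, rfl⟩ | ⟨e, -⟩) | (⟨e, -⟩ | ⟨e, -⟩) | (⟨e, -⟩ | ⟨e, -⟩))) <;>
        first | contradiction | simp [h2, Ne.symm h2]
  by_cases hc : x = c
  · subst hc; rw [e3, hcd]; constructor
    · rintro (⟨rfl, -⟩ | ⟨rfl, -⟩) <;> simp
    · rintro (((⟨e, -⟩ | ⟨e, -⟩) | (⟨e, -⟩ | ⟨-, rfl⟩) | (⟨-, rfl⟩ | ⟨e, -⟩) | (⟨e, -⟩ | ⟨e, -⟩))) <;>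
        first | contradiction | simp [h5, Ne.symm h5]
  by_cases hd : x = d
  · subst hd; rw [e4, hdc]; constructor
    · rintro (⟨rfl, -⟩ | ⟨rfl, -⟩) <;> simp
    · rintro (((⟨e, -⟩ | ⟨e, -⟩) | (⟨e, -⟩ | ⟨e, -⟩) | (⟨e, -⟩ | ⟨-, rfl⟩) | (⟨-, rfl⟩ | ⟨e, -⟩))) <;>
        first | contradiction | simp [h2, Ne.symm h2]
  rw [flipMate_of_ne ha hb hc hd]
  simp [ha, hb, hc, hd]

end flipMate

/-- The flips along the 4-cycles listed in `qs` lead from the matching `f` to the matching `f'`. -/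
def FlipPath (G : SimpleGraph V) : (V → V) → List (V × V × V × V) → (V → V) → Prop
  | f, [], f' => f = f'
  | f, q :: qs, f' => ∃ h : V → V,
      FlipAlong q.1 q.2.1 q.2.2.1 q.2.2.2 (mateSub G f) (mateSub G h) ∧ FlipPath G h qs f'

lemma FlipPath.append {f₁ f₂ f₃ : V → V} {k l : List (V × V × V × V)} (h₁ : FlipPath G f₁ k f₂)
    (h₂ : FlipPath G f₂ l f₃) : FlipPath G f₁ (k ++ l) f₃ := by
  induction k generalizing f₁ with
  | nil => rw [show f₁ = f₂ from h₁]; exact h₂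
  | cons q k ih =>
    obtain ⟨h, h3, h4⟩ := h₁
    exact ⟨h, h3, ih h4⟩

lemma FlipPath.exists_seq {f f' : V → V} {l : List (V × V × V × V)} (h : FlipPath G f l f') :
    ∃ S : ℕ → G.Subgraph, S 0 = mateSub G f ∧ S l.length = mateSub G f' ∧
      ∀ i (hi : i < l.length),
        FlipAlong l[i].1 l[i].2.1 l[i].2.2.1 l[i].2.2.2 (S i) (S (i + 1)) := by
  induction l generalizing f with
  | nil =>
    rw [show f = f' from h]
    exact ⟨fun _ => mateSub G f', rfl, rfl, fun i hi => absurd hi (by simp)⟩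
  | cons q l ih =>
    obtain ⟨m, h1, h2⟩ := h
    obtain ⟨S, s0, s1, s2⟩ := ih h2
    refine ⟨fun i => if i = 0 then mateSub G f else S (i - 1), by simp, by simpa using s1, ?_⟩
    intro i hi
    cases i with
    | zero => simpa [s0] using h1
    | succ i => simpa using s2 i (by simpa using hi)

end Flips

/-! ### Scanning a quadrangulated cycle -/

section Scan

variable {V : Type*} {G : SimpleGraph V} {par : V → ℕ}

/-- The invariant of the scan of one cycle: `st` is the stack (bottom first) and `rest` lists the
vertices still to come; together they form a quadrangulated polygon with degrees `D`, whose sides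
starting at parity `0` and `1` are matched by `f` and `g`, respectively. -/
structure ScanInv (G : SimpleGraph V) (par : V → ℕ) (D : V → ℕ) (st rest : List V)
    (f g : V → V) : Prop where
  poly : ChordPolygon (oppAdj G par) par (st ++ rest)
  full : degSum (oppAdj G par) (st ++ rest) + 4 = 3 * (st ++ rest).length
  deg : ∀ x ∈ st ++ rest, D x = ldeg (oppAdj G par) (st ++ rest) x
  even : List.IsChain (fun x y => par x = 0 → f x = y) (st ++ rest)
  odd : List.IsChain (fun x y => par x = 1 → g x = y) (st ++ rest)
  last : g ((st ++ rest).getLast poly.ne_nil) = (st ++ rest).head poly.ne_nil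
  head : par ((st ++ rest).head poly.ne_nil) = 0
  irred : ∀ s a b c d r, st = s ++ a :: b :: c :: d :: r → r ≠ [] → ¬ (D b = 2 ∧ D c = 2)

/-- The topmost four vertices of the stack do not form a quadrangle to be cut off. -/
def TopIrred (D : V → ℕ) (st : List V) : Prop :=
  ∀ s a b c d, st = s ++ [a, b, c, d] → ¬ (D b = 2 ∧ D c = 2)

/-- A third neighbour would raise the degree to three. Thus ears are recognised from stored degrees
alone. -/
lemma eq_or_eq_of_ldeg_eq_two {R : V → V → Prop} {p : List V} {a b c : V} (ha : a ∈ p)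
    (hc : c ∈ p) (hac : a ≠ c) (hba : R b a) (hbc : R b c) (h2 : ldeg R p b = 2) :
    ∀ y ∈ p, R b y → y = a ∨ y = c := by
  classical
  intro y hy hby
  by_contra! hne
  have hsub : [a, c, y] ⊆ p.filter fun z => decide (R b z) := by
    intro z hz
    simp only [List.mem_cons, List.not_mem_nil, or_false] at hz
    rw [List.mem_filter]
    rcases hz with rfl | rfl | rfl <;> simp [*]
  have hnd : [a, c, y].Nodup := by simp [hac, hne.1.symm, hne.2.symm]
  have := (List.subperm_of_subset hnd hsub).length_le
  rw [← List.countP_eq_length_filter] at this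
  unfold ldeg at h2
  simp only [List.length_cons, List.length_nil] at this
  omega

namespace ScanInv

variable {D : V → ℕ} {st rest : List V} {f g : V → V}

/-- The field `irred` speaks of quadruples below the top. The only new one after a push is the
former top, for which `TopIrred` is assumed. -/
lemma push {x : V} (h : ScanInv G par D st (x :: rest) f g) (ht : TopIrred D st) :
    ScanInv G par D (st ++ [x]) rest f g := by
  have e : st ++ x :: rest = st ++ [x] ++ rest := by simp
  obtain ⟨h1, h2, h3, h4, h5, h6, h7, h8⟩ := h
  simp only [e] at h1 h2 h3 h4 h5 h6 h7
  refine ⟨h1, h2, h3, h4, h5, h6, h7, ?_⟩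
  intro s a b c d r hs hr
  obtain ⟨r', y, rfl⟩ := (List.eq_nil_or_concat' r).resolve_left hr
  have : st = s ++ a :: b :: c :: d :: r' := by
    have hs' : st ++ [x] = (s ++ a :: b :: c :: d :: r') ++ [y] := by simpa using hs
    exact (List.append_inj' hs' rfl).1
  by_cases hr' : r' = []
  · subst hr'; exact ht _ _ _ _ _ this
  · exact h8 _ _ _ _ _ _ this hr'

/-- At the end of the scan the cycle is reduced to a single edge, which both matchings use. -/
lemma finish (h : ScanInv G par D st [] f g) (ht : TopIrred D st) :
    ∃ x y, st = [x, y] ∧ f x = y ∧ g y = x := by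
  have hp := h.poly
  have hlen : st.length = 2 := by
    by_contra hl
    have h2 := hp.length_ge_two
    have hev := hp.even_length
    -- A polygon with four or more vertices would have an ear whose middle vertices have degree two.
    -- Being on the stack, it is either the top quadruple or a buried one, and both are excluded.
    obtain ⟨s, a, b, c, d, r, hs, e1, e2⟩ := hp.exists_ear (by simp at h2 hev ⊢; omega)
    have hdeg := h.deg
    rw [hs] at hp e1 e2 hdeg
    have hd := hp.ear_degrees ⟨e1, e2⟩
    have hst : st = s ++ a :: b :: c :: d :: r := by simpa using hs
    have hbc : D b = 2 ∧ D c = 2 :=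
      ⟨(hdeg b (by simp)).trans hd.2.2.2.1, (hdeg c (by simp)).trans hd.2.2.2.2⟩
    by_cases hr : r = []
    · subst hr; exact ht _ _ _ _ _ hst hbc
    · exact h.irred _ _ _ _ _ _ hst hr hbc
  obtain ⟨x, y, rfl⟩ := List.length_eq_two.1 hlen
  refine ⟨x, y, rfl, ?_, by simpa using h.last⟩
  have h1 := h.even
  have h2 := h.head
  simp at h1 h2
  exact h1 h2

/-- The vertex `a` needs a separate hypothesis because its successor changes from `b` to `d`. -/
lemma chain_remove {P P' : V → V → Prop} {s r : List V} {a b c d : V}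
    (h : List.IsChain P (s ++ a :: b :: c :: d :: r)) (hs : ∀ x ∈ s, ∀ y, P x y → P' x y)
    (hr : ∀ x ∈ r, ∀ y, P x y → P' x y) (had : P' a d) (hd : ∀ y, P d y → P' d y) :
    List.IsChain P' (s ++ a :: d :: r) := by
  have mono : ∀ l : List V, List.IsChain P l → (∀ x ∈ l, ∀ y, P x y → P' x y) →
      List.IsChain P' l := by
    intro l
    induction l with
    | nil => simp
    | cons x l ih =>
      intro hc hl
      rw [List.isChain_cons] at hc ⊢
      exact ⟨fun y hy => hl x (by simp) y (hc.1 y hy),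
        ih hc.2 fun z hz => hl z (List.mem_cons_of_mem _ hz)⟩
  rw [List.isChain_append] at h ⊢
  have h2 := h.2.1
  simp only [List.isChain_cons_cons] at h2
  refine ⟨mono _ h.1 hs, List.isChain_cons_cons.2 ⟨had, mono _ h2.2.2.2 ?_⟩, ?_⟩
  · intro x hx
    rcases List.mem_cons.1 hx with rfl | hx
    exacts [hd, hr x hx]
  · intro x hx y hy
    exact hs x (List.mem_of_mem_getLast? hx) y (h.2.2 x hx y (by simpa using hy))

/-- What the scan does when it cuts off the quadrangle `a b c d`. -/
structure Reduced [DecidableEq V] (G : SimpleGraph V) (par D D' : V → ℕ) (s : List V) (a b c d : V)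
    (rest : List V) (f g f' g' : V → V) : Prop where
  inv : ScanInv G par D' (s ++ [a, d]) rest f' g'
  mem_par : par a = 0 ∨ par a = 1
  matef : IsMate G f'
  mateg : IsMate G g'
  flipf : par a = 0 → FlipAlong a b c d (mateSub G f) (mateSub G f') ∧ g' = g
  flipg : par a = 1 → FlipAlong a b c d (mateSub G g') (mateSub G g) ∧ f' = f
  other : ∀ x, x ∉ [a, b, c, d] → f' x = f x ∧ g' x = g x
  agree : f' b = g' b ∧ f' c = g' c

/-- Degree two makes `b` and `c` an ear, and maximality then supplies the edge `ad`. The parity of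
`a` tells which matching contains `ab` and `cd`; that one is flipped, after which both match `b`
with `c` and the side `ad` takes the place of the three sides removed. -/
lemma reduce [DecidableEq V] {s : List V} {a b c d : V}
    (h : ScanInv G par D (s ++ [a, b, c, d]) rest f g) (hb : D b = 2) (hc : D c = 2)
    (hf : IsMate G f) (hg : IsMate G g) {D' : V → ℕ} (hDa : D' a = D a - 1) (hDd : D' d = D d - 1)
    (hD : ∀ x, x ≠ a → x ≠ d → D' x = D x) :
    ∃ f' g', Reduced G par D D' s a b c d rest f g f' g' := by
  have e : s ++ [a, b, c, d] ++ rest = s ++ a :: b :: c :: d :: rest := by simp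
  have e' : s ++ [a, d] ++ rest = s ++ a :: d :: rest := by simp
  obtain ⟨poly, full, deg, even, odd, last, head, irred⟩ := h
  simp only [e] at poly full deg even odd last head
  obtain ⟨sab, sbc, scd⟩ := poly.sides
  have hn := poly.nodup
  simp only [List.nodup_append, List.nodup_cons, List.mem_cons, not_or] at hn
  obtain ⟨-, ⟨⟨nab, nac, nad, nar⟩, ⟨nbc, nbd, nbr⟩, ⟨ncd, ncr⟩, ndr, -⟩, ns⟩ := hn
  have hnd : [a, b, c, d].Nodup := by simp [nab, nac, nad, nbc, nbd, ncd]
  have he : IsEar (oppAdj G par) s a b c d rest :=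
    ⟨eq_or_eq_of_ldeg_eq_two (by simp) (by simp) nac (poly.symm _ _ sab) sbc
      ((deg b (by simp)).symm.trans hb),
     eq_or_eq_of_ldeg_eq_two (by simp) (by simp) nbd (poly.symm _ _ sbc) scd
      ((deg c (by simp)).symm.trans hc)⟩
  have had := poly.rel_of_ear he full
  have hpar : (par a = 0 ∧ par b = 1 ∧ par c = 0 ∧ par d = 1) ∨
      (par a = 1 ∧ par b = 0 ∧ par c = 1 ∧ par d = 0) := by
    have h1 := sab.2; have h2 := sbc.2; have h3 := scd.2; omega
  have hds := poly.ear_degrees he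
  have poly' := poly.remove had
  have full' : degSum (oppAdj G par) (s ++ a :: d :: rest) + 4 = 3 * (s ++ a :: d :: rest).length := by
    rw [poly.degSum_ear he] at full
    simp only [List.length_append, List.length_cons] at full ⊢
    omega
  have deg' : ∀ x ∈ s ++ a :: d :: rest, D' x = ldeg (oppAdj G par) (s ++ a :: d :: rest) x := by
    intro x hx
    by_cases hxa : x = a
    · subst hxa; rw [hDa, deg x (by simp), hds.2.1]; rfl
    by_cases hxd : x = d
    · subst hxd; rw [hDd, deg x (by simp), hds.2.2.1]; rfl
    · have hx' : x ∈ s ++ rest := by simpa [hxa, hxd] using hx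
      rw [hD x hxa hxd, deg x (by simp at hx' ⊢; tauto), hds.1 x hx']
  -- The middle vertices of a buried quadruple lie below `a`. Only `a` and `d` change degree, and
  -- the quadruple was buried before, so nothing new can be cut there.
  have irred' : ∀ s' a' b' c' d' r', s ++ [a, d] = s' ++ a' :: b' :: c' :: d' :: r' → r' ≠ [] →
      ¬ (D' b' = 2 ∧ D' c' = 2) := by
    intro s' a' b' c' d' r' hs hr
    obtain ⟨r'', y, rfl⟩ := (List.eq_nil_or_concat' r').resolve_left hr
    have hs1 : (s ++ [a]) ++ [d] = (s' ++ a' :: b' :: c' :: d' :: r'') ++ [y] := by simpa using hs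
    have hs2 := (List.append_inj' hs1 rfl).1
    have hmem : ∀ z, z = b' ∨ z = c' → z ∈ s := by
      intro z hz
      rcases List.eq_nil_or_concat' r'' with rfl | ⟨r3, y3, rfl⟩
      · have : s ++ [a] = (s' ++ [a', b', c']) ++ [d'] := by simpa using hs2
        rw [(List.append_inj' this rfl).1]
        simp; tauto
      · have : s ++ [a] = (s' ++ a' :: b' :: c' :: d' :: r3) ++ [y3] := by simpa using hs2
        rw [(List.append_inj' this rfl).1]
        simp; tauto
    have hb' := hmem b' (Or.inl rfl)
    have hc' := hmem c' (Or.inr rfl)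
    rw [hD b' (ns b' hb' a (by simp)) (ns b' hb' d (by simp)),
      hD c' (ns c' hc' a (by simp)) (ns c' hc' d (by simp))]
    refine irred s' a' b' c' d' (r'' ++ [b, c, d]) ?_ (by simp)
    have : s ++ [a, b, c, d] = (s ++ [a]) ++ [b, c, d] := by simp
    rw [this, hs2]; simp
  have hhead : (s ++ a :: d :: rest).head poly'.ne_nil =
      (s ++ a :: b :: c :: d :: rest).head poly.ne_nil := by cases s <;> simp
  have hlast : (s ++ a :: d :: rest).getLast poly'.ne_nil =
      (s ++ a :: b :: c :: d :: rest).getLast poly.ne_nil := by simp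
  have plast : par ((s ++ a :: b :: c :: d :: rest).getLast poly.ne_nil) = 1 := by
    have := poly.opp _ _ poly.closing
    omega
  have hsne : ∀ x ∈ s, x ≠ a ∧ x ≠ b ∧ x ≠ c ∧ x ≠ d := fun x hx =>
    ⟨ns x hx a (by simp), ns x hx b (by simp), ns x hx c (by simp), ns x hx d (by simp)⟩
  have hrne : ∀ x ∈ rest, x ≠ a ∧ x ≠ b ∧ x ≠ c ∧ x ≠ d := fun x hx => by
    refine ⟨?_, ?_, ?_, ?_⟩ <;> rintro rfl <;> contradiction
  have hchain2 : ∀ {P : V → V → Prop}, List.IsChain P (s ++ a :: b :: c :: d :: rest) →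
      P a b ∧ P b c ∧ P c d := by
    intro P hP
    have := (List.isChain_append.1 hP).2.1
    simp only [List.isChain_cons_cons] at this
    exact ⟨this.1, this.2.1, this.2.2.1⟩
  obtain ⟨ev1, ev2, ev3⟩ := hchain2 even
  obtain ⟨od1, od2, od3⟩ := hchain2 odd
  have keep : ∀ (m : V → V) (i : ℕ) (x : V), (x ≠ a ∧ x ≠ b ∧ x ≠ c ∧ x ≠ d) → ∀ y,
      (par x = i → m x = y) → (par x = i → flipMate m a b c d x = y) := by
    intro m i x hx y hy
    rw [flipMate_of_ne hx.1 hx.2.1 hx.2.2.1 hx.2.2.2]; exact hy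
  rcases hpar with ⟨pa, pb, pc, pd⟩ | ⟨pa, pb, pc, pd⟩
  · have hfl := hf.flip hnd (ev1 pa) (ev3 pc) sbc.1 had.1
    obtain ⟨q1, q2, q3, q4⟩ := flipMate_apply (f := f) hnd
    refine ⟨flipMate f a b c d, g, ⟨?_, Or.inl pa, hfl.1, hg, fun _ => ⟨hfl.2, rfl⟩,
      fun h => by omega, ?_, ?_⟩⟩
    · refine ⟨by rwa [e'], by rwa [e'], by rwa [e'], ?_, ?_, ?_, ?_, irred'⟩
      · rw [e']
        exact chain_remove even (fun x hx => keep f 0 x (hsne x hx))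
          (fun x hx => keep f 0 x (hrne x hx)) (fun _ => q1) (fun y _ hh => by omega)
      · rw [e']
        exact chain_remove odd (fun _ _ _ => id) (fun _ _ _ => id) (fun hh => by omega)
          (fun _ => id)
      · simp only [e']; rw [hlast, hhead]; exact last
      · simp only [e']; rw [hhead]; exact head
    · intro x hx
      simp only [List.mem_cons, List.not_mem_nil, or_false, not_or] at hx
      exact ⟨flipMate_of_ne hx.1 hx.2.1 hx.2.2.1 hx.2.2.2, rfl⟩
    · rw [q2, q3, od2 pb]
      exact ⟨rfl, by rw [← od2 pb, hg.invol]⟩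
  · have hfl := hg.flip hnd (od1 pa) (od3 pc) sbc.1 had.1
    obtain ⟨q1, q2, q3, q4⟩ := flipMate_apply (f := g) hnd
    refine ⟨f, flipMate g a b c d, ⟨?_, Or.inr pa, hf, hfl.1, fun h => by omega,
      fun _ => ⟨hfl.2.symm, rfl⟩, ?_, ?_⟩⟩
    · refine ⟨by rwa [e'], by rwa [e'], by rwa [e'], ?_, ?_, ?_, ?_, irred'⟩
      · rw [e']
        exact chain_remove even (fun _ _ _ => id) (fun _ _ _ => id) (fun hh => by omega)
          (fun _ => id)
      · rw [e']
        exact chain_remove odd (fun x hx => keep g 1 x (hsne x hx))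
          (fun x hx => keep g 1 x (hrne x hx)) (fun _ => q1) (fun y _ hh => by omega)
      · simp only [e']; rw [hlast, hhead]
        -- The last vertex of the polygon has parity one, and `d` has parity zero here, so the
        -- closing edge of `g` is not touched by the flip.
        have hm : (s ++ a :: b :: c :: d :: rest).getLast poly.ne_nil ∈ s ++ rest := by
          rcases List.eq_nil_or_concat' rest with rfl | ⟨k, w, rfl⟩
          · simp at plast; omega
          · simp
        have hne := List.mem_append.1 hm |>.elim (hsne _) (hrne _)
        rw [flipMate_of_ne hne.1 hne.2.1 hne.2.2.1 hne.2.2.2]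
        exact last
      · simp only [e']; rw [hhead]; exact head
    · intro x hx
      simp only [List.mem_cons, List.not_mem_nil, or_false, not_or] at hx
      exact ⟨rfl, flipMate_of_ne hx.1 hx.2.1 hx.2.2.1 hx.2.2.2⟩
    · rw [q2, q3, ev2 pb]
      exact ⟨rfl, by rw [← ev2 pb, hf.invol]⟩

end ScanInv

end Scan

/-! ### Reasoning about random access machines -/

namespace RAM

@[simp] lemma State.reg_setReg (s : State) (x v y : ℕ) :
    (s.setReg x v).reg y = if y = x then v else s.reg y := by
  simp [State.setReg, Function.update_apply]

@[simp] lemma State.mem_setReg (s : State) (x v : ℕ) : (s.setReg x v).mem = s.mem := rfl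

@[simp] lemma State.reg_setMem (s : State) (a i v : ℕ) : (s.setMem a i v).reg = s.reg := rfl

@[simp] lemma State.mem_setMem (s : State) (a i v b : ℕ) :
    (s.setMem a i v).mem b = if b = a then Function.update (s.mem a) i v else s.mem b := by
  simp [State.setMem, Function.update_apply]

@[simp] lemma Test.holds_eq (s : State) (x y : ℕ) :
    (Test.eq x y).Holds s ↔ s.reg x = s.reg y := Iff.rfl

@[simp] lemma Test.holds_lt (s : State) (x y : ℕ) :
    (Test.lt x y).Holds s ↔ s.reg x < s.reg y := Iff.rfl

namespace Program

/-- The program contains no loop. -/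
@[simp] def LoopFree : Program → Prop
  | seq p q => p.LoopFree ∧ q.LoopFree
  | ite _ p q => p.LoopFree ∧ q.LoopFree
  | loop _ _ => False
  | _ => True

/-- The number of instructions of a program. -/
@[simp] def size : Program → ℕ
  | seq p q => p.size + q.size
  | ite _ p q => 1 + p.size + q.size
  | loop _ p => 1 + p.size
  | _ => 1

open Classical in
/-- The final state of a loop-free program. -/
@[simp] noncomputable def run : Program → State → State
  | const x c, s => s.setReg x c
  | copy x y, s => s.setReg x (s.reg y)
  | succ x y, s => s.setReg x (s.reg y + 1)
  | pred x y, s => s.setReg x (s.reg y - 1)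
  | load x a y, s => s.setReg x (s.mem a (s.reg y))
  | store a x y, s => s.setMem a (s.reg x) (s.reg y)
  | seq p q, s => q.run (p.run s)
  | ite b p q, s => if b.Holds s then p.run s else q.run s
  | loop _ _, s => s

lemma exec_run : ∀ (p : Program) (s : State), p.LoopFree → ∃ t ≤ p.size, Exec p s t (p.run s)
  | const x c, s, _ => ⟨1, le_rfl, .const s x c⟩
  | copy x y, s, _ => ⟨1, le_rfl, .copy s x y⟩
  | succ x y, s, _ => ⟨1, le_rfl, .succ s x y⟩
  | pred x y, s, _ => ⟨1, le_rfl, .pred s x y⟩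
  | load x a y, s, _ => ⟨1, le_rfl, .load s x a y⟩
  | store a x y, s, _ => ⟨1, le_rfl, .store s a x y⟩
  | seq p q, s, h => by
    obtain ⟨t, ht, h1⟩ := exec_run p s h.1
    obtain ⟨u, hu, h2⟩ := exec_run q (p.run s) h.2
    exact ⟨t + u, by simp only [size]; omega, .seq h1 h2⟩
  | ite b p q, s, h => by
    by_cases hb : b.Holds s
    · obtain ⟨t, ht, h1⟩ := exec_run p s h.1
      refine ⟨1 + t, by simp only [size]; omega, ?_⟩
      simp only [run, if_pos hb]
      exact .ite_true hb h1
    · obtain ⟨t, ht, h1⟩ := exec_run q s h.2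
      refine ⟨1 + t, by simp only [size]; omega, ?_⟩
      simp only [run, if_neg hb]
      exact .ite_false hb h1
  | loop _ _, _, h => h.elim

/-- The loop rule: the body keeps the invariant `I` and is paid for by the potential `Φ`. -/
lemma exec_loop {b : Test} {p : Program} (I : State → Prop) (Φ : State → ℕ)
    (hbody : ∀ s, I s → b.Holds s → ∃ t s', Exec p s t s' ∧ I s' ∧ t + 1 + Φ s' ≤ Φ s) :
    ∀ s, I s → ∃ t s', Exec (.loop b p) s t s' ∧ I s' ∧ ¬ b.Holds s' ∧ t + Φ s' ≤ Φ s + 1 := by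
  have key : ∀ (N : ℕ) (s : State), Φ s ≤ N → I s →
      ∃ t s', Exec (.loop b p) s t s' ∧ I s' ∧ ¬ b.Holds s' ∧ t + Φ s' ≤ Φ s + 1 := by
    intro N
    induction N with
    | zero =>
      intro s hN hI
      by_cases hb : b.Holds s
      · obtain ⟨t, s', -, -, h3⟩ := hbody s hI hb
        omega
      · exact ⟨1, s, .loop_false hb, hI, hb, by omega⟩
    | succ N ih =>
      intro s hN hI
      by_cases hb : b.Holds s
      · obtain ⟨t, s', h1, h2, h3⟩ := hbody s hI hb
        obtain ⟨u, s'', h4, h5, h6, h7⟩ := ih s' (by omega) h2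
        exact ⟨1 + t + u, s'', .loop_true hb h1 h4, h5, h6, by omega⟩
      · exact ⟨1, s, .loop_false hb, hI, hb, by omega⟩
  exact fun s hI => key _ s le_rfl hI

end Program

end RAM

/-! ### The program -/

section TheProgram

open RAM RAM.Program

infixr:60 " ;; " => RAM.Program.seq

/-- Appends `x` (register 3) and its partner to the list of vertices and moves on along the
alternating cycle; register 11 is set when the cycle is closed. -/
def cycleStep : Program :=
  load 4 2 3 ;;
  store 4 5 3 ;; succ 5 5 ;; store 4 5 4 ;; succ 5 5 ;;
  store 5 3 10 ;; store 5 4 10 ;; store 6 4 21 ;;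
  -- Two more vertices raise `3 * length` by six and `length / 2` by one.
  succ 6 6 ;; succ 6 6 ;; succ 6 6 ;; succ 6 6 ;; succ 6 6 ;; succ 6 6 ;; succ 7 7 ;;
  load 3 3 4 ;;
  ite (.eq 3 2) (const 11 1) (const 11 0)

/-- Traverses the alternating cycle of the vertex in register 2 unless it has been visited. -/
def visitVertex : Program :=
  load 8 5 2 ;;
  -- Register 20 is never written and holds 0. Labels are a vertex plus one, so the label 0 marks an
  -- unvisited vertex.
  ite (.eq 8 20)
    ((copy 3 2 ;; succ 10 2 ;; const 11 0) ;;
      loop (.eq 11 20) cycleStep ;;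
      -- Closing a cycle of length `k` completes its contributions `3k - 4` to the degree sum
      -- required and `k/2 - 1` to the number of flips.
      (pred 6 6 ;; pred 6 6 ;; pred 6 6 ;; pred 6 6 ;; pred 7 7))
    (const 8 0) ;;
  succ 2 2

/-- Counts the edge with index in register 2 if it joins vertices of opposite parity on the same
alternating cycle. -/
def countEdge : Program :=
  load 3 0 2 ;; load 4 1 2 ;; load 8 5 3 ;; load 12 5 4 ;;
  ite (.eq 8 12)
    (load 8 6 3 ;; load 12 6 4 ;;
      ite (.eq 8 12) (const 8 0)
        (load 8 7 3 ;; succ 8 8 ;; store 7 3 8 ;; load 8 7 4 ;; succ 8 8 ;; store 7 4 8 ;;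
          succ 9 9 ;; succ 9 9))
    (const 8 0) ;;
  succ 2 2

/-- Outputs the quadrangle in registers 16 to 19 and cuts it off. -/
def cutQuad : Program :=
  load 8 7 16 ;; pred 8 8 ;; store 7 16 8 ;;
  load 8 7 19 ;; pred 8 8 ;; store 7 19 8 ;;
  -- The height drops by two and `d` overwrites the cell of `b`, so that `a` and `d` are on top.
  pred 15 15 ;; pred 15 15 ;; pred 8 15 ;; store 8 8 19 ;;
  load 8 6 16 ;;
  -- Parity 0 at `a` means a flip of the first matching, written from the front. A flip of the
  -- second matching has to be undone in reverse order and is written from the back.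
  ite (.eq 8 20) (copy 12 13 ;; succ 13 13) (pred 14 14 ;; copy 12 14) ;;
  store 0 12 16 ;; store 1 12 17 ;; store 2 12 18 ;; store 3 12 19 ;;
  const 11 0

/-- Cuts off the quadrangle on top of the stack if there is one; otherwise sets register 11. -/
def tryCut : Program :=
  const 11 1 ;;
  ite (.lt 23 15)
    (pred 8 15 ;; load 19 8 8 ;; pred 8 8 ;; load 18 8 8 ;; pred 8 8 ;; load 17 8 8 ;;
      pred 8 8 ;; load 16 8 8 ;;
      load 8 7 17 ;;
      ite (.eq 8 22) (load 8 7 18 ;; ite (.eq 8 22) cutQuad (const 8 0)) (const 8 0))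
    (const 8 0)

/-- Pushes the next vertex, starting a new stack at the beginning of a cycle. -/
def pushVertex : Program :=
  load 3 4 2 ;; load 8 5 3 ;; succ 12 3 ;;
  -- The label of a cycle is its first vertex plus one, so this test succeeds exactly at the start
  -- of a cycle.
  ite (.eq 8 12) (const 15 0) (const 8 0) ;;
  store 8 15 3 ;; succ 15 15 ;; const 11 0

/-- Scans the vertices and outputs the flips. -/
def scanVertex : Program :=
  pushVertex ;; loop (.eq 11 20) tryCut ;; succ 2 2

/-- The program solving Perfect Matching Reconfiguration on outerplanar graphs. -/
def reconfProgram : Program :=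
  (const 21 1 ;; const 22 2 ;; const 23 3) ;;
  loop (.lt 2 0) visitVertex ;;
  const 2 0 ;;
  loop (.lt 2 1) countEdge ;;
  -- Register 6 holds the sum of the bounds over all cycles, register 9 the degree sum counted.
  ite (.eq 6 9)
    -- The total number of flips is known in advance, so the writing from the back can start at the
    -- final end of the output.
    ((const 2 0 ;; copy 14 7) ;; loop (.lt 2 0) scanVertex ;; (const 0 1 ;; copy 1 7))
    (const 0 0)

end TheProgram

/-! ### Listing the alternating cycles -/

section Visit

open RAM RAM.Program

variable {n : ℕ} {G : SimpleGraph (Fin n)} {f g : Fin n → Fin n}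

lemma AltStep.congr {V : Type*} {f g : V → V} {par par' : V → ℕ} {l : List V}
    (h : List.IsChain (AltStep f g par) l) (hpar : ∀ x ∈ l, par' x = par x) :
    List.IsChain (AltStep f g par') l := by
  rw [List.isChain_iff_getElem] at h ⊢
  intro i hi
  have := h i hi
  unfold AltStep at this ⊢
  rwa [hpar _ (List.getElem_mem _), hpar _ (List.getElem_mem _)]

lemma IsBlock.congr {V : Type*} {f g : V → V} {par par' : V → ℕ} {v : V} {t : List V}
    (h : IsBlock f g par v t) (hpar : ∀ x ∈ v :: t, par' x = par x) : IsBlock f g par' v t := by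
  refine ⟨h.nodup, AltStep.congr h.chain fun x hx => hpar x ?_, ?_⟩
  · rcases List.mem_append.1 hx with hx | hx
    · exact hx
    · simp only [List.mem_singleton] at hx; simp [hx]
  · rw [hpar v (by simp)]; exact h.par_eq

/-- The parity of a vertex, as stored in the memory. -/
def RAM.State.par (s : State) (x : Fin n) : ℕ := s.mem 6 x

/-- The label of the cycle of a vertex, as stored in the memory. -/
def RAM.State.cyc (s : State) (x : Fin n) : ℕ := s.mem 5 x

/-- The lists in `bs` are disjoint alternating cycles, with the parities and labels given by
`par` and `cyc`. -/
structure Layout (f g : Fin n → Fin n) (par cyc : Fin n → ℕ) (bs : List (List (Fin n))) : Prop where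
  block : ∀ b ∈ bs, ∃ v t, b = v :: t ∧ IsBlock f g par v t ∧ ∀ x ∈ b, cyc x = v + 1
  nodup : bs.flatten.Nodup
  closed_f : ∀ x ∈ bs.flatten, f x ∈ bs.flatten
  closed_g : ∀ x ∈ bs.flatten, g x ∈ bs.flatten

lemma Layout.congr {par cyc par' cyc' : Fin n → ℕ} {bs : List (List (Fin n))}
    (h : Layout f g par cyc bs) (hpar : ∀ x ∈ bs.flatten, par' x = par x)
    (hcyc : ∀ x ∈ bs.flatten, cyc' x = cyc x) : Layout f g par' cyc' bs := by
  refine ⟨fun b hb => ?_, h.nodup, h.closed_f, h.closed_g⟩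
  obtain ⟨v, t, rfl, h1, h2⟩ := h.block b hb
  refine ⟨v, t, rfl, h1.congr fun x hx => hpar x ?_, fun x hx => ?_⟩
  · exact List.mem_flatten.2 ⟨_, hb, hx⟩
  · rw [hcyc x (List.mem_flatten.2 ⟨_, hb, hx⟩), h2 x hx]

/-- Everything but the arrays and registers written while visiting agrees with `s₀`. -/
structure VisitFrame (s₀ s : State) : Prop where
  mem : ∀ a, a ∉ [4, 5, 6] → s.mem a = s₀.mem a
  reg : ∀ k, k ∉ [2, 3, 4, 5, 6, 7, 8, 10, 11] → s.reg k = s₀.reg k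

/-- The list of vertices `L` is stored in the memory. -/
structure Listed (s : State) (L : List (Fin n)) : Prop where
  len : s.reg 5 = L.length
  val : ∀ i (h : i < L.length), s.mem 4 i = L[i]

/-- The invariant of the traversal of all cycles. -/
structure Visited (f g : Fin n → Fin n) (s₀ s : State) (bs : List (List (Fin n))) : Prop where
  layout : Layout f g s.par s.cyc bs
  fresh : ∀ x, x ∉ bs.flatten → s.par x = 0 ∧ s.cyc x = 0
  listed : Listed s bs.flatten
  need : s.reg 6 = (bs.map fun b => 3 * b.length - 4).sum
  quads : s.reg 7 = (bs.map fun b => b.length / 2 - 1).sum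
  frame : VisitFrame s₀ s

/-- The invariant of the traversal of one cycle: `l` lists the vertices visited so far, starting
at `v`, and `x` comes next. -/
structure CycleWalk (f g : Fin n → Fin n) (s₀ : State) (bs : List (List (Fin n))) (v : Fin n)
    (s : State) (l : List (Fin n)) (x : Fin n) : Prop where
  layout : Layout f g s.par s.cyc bs
  fresh : ∀ z, z ∉ bs.flatten ++ l → s.par z = 0 ∧ s.cyc z = 0
  listed : Listed s (bs.flatten ++ l)
  nodup : (bs.flatten ++ l).Nodup
  closed_f : ∀ z ∈ l, f z ∈ l
  closed_g : ∀ z ∈ l, z = v ∨ g z = x ∨ g z ∈ l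
  next : (l = [] ∧ x = v) ∨ g x ∈ l
  cyc : ∀ z ∈ l, s.cyc z = v + 1
  chain : List.IsChain (AltStep f g s.par) (l ++ [x])
  head : (l ++ [x]).head? = some v
  par_next : s.par x = 0
  par_start : s.par v = 0
  even : l.length % 2 = 0
  need : s.reg 6 = (bs.map fun b => 3 * b.length - 4).sum + 3 * l.length
  quads : s.reg 7 = (bs.map fun b => b.length / 2 - 1).sum + l.length / 2
  flag : (s.reg 11 = 0 ∧ x ∉ bs.flatten ++ l) ∨ (s.reg 11 = 1 ∧ x = v ∧ l ≠ [])
  reg2 : s.reg 2 = v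
  reg3 : s.reg 3 = x
  reg10 : s.reg 10 = v + 1
  frame : VisitFrame s₀ s

lemma Listed.length_le {s : State} {L : List (Fin n)} (hn : L.Nodup) (h : Listed s L) :
    s.reg 5 ≤ n := by
  rw [h.len]
  simpa using hn.length_le_card

/-- Symbolic execution of one pass. The invariants rely on this summary only. -/
lemma cycleStep_run (s : State) :
    (cycleStep.run s).reg 3 = s.mem 3 (s.mem 2 (s.reg 3)) ∧
    (cycleStep.run s).reg 5 = s.reg 5 + 2 ∧ (cycleStep.run s).reg 6 = s.reg 6 + 6 ∧
    (cycleStep.run s).reg 7 = s.reg 7 + 1 ∧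
    (cycleStep.run s).reg 11 = (if s.mem 3 (s.mem 2 (s.reg 3)) = s.reg 2 then 1 else 0) ∧
    (cycleStep.run s).mem 4 = Function.update (Function.update (s.mem 4) (s.reg 5) (s.reg 3))
      (s.reg 5 + 1) (s.mem 2 (s.reg 3)) ∧
    (cycleStep.run s).mem 5 = Function.update (Function.update (s.mem 5) (s.reg 3) (s.reg 10))
      (s.mem 2 (s.reg 3)) (s.reg 10) ∧
    (cycleStep.run s).mem 6 = Function.update (s.mem 6) (s.mem 2 (s.reg 3)) (s.reg 21) ∧
    (∀ a, a ∉ [4, 5, 6] → (cycleStep.run s).mem a = s.mem a) ∧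
    ∀ k, k ∉ [3, 4, 5, 6, 7, 11] → (cycleStep.run s).reg k = s.reg k := by
  by_cases hc : s.mem 3 (s.mem 2 (s.reg 3)) = s.reg 2
  all_goals
    refine ⟨?_, ?_, ?_, ?_, ?_, ?_, ?_, ?_, ?_, ?_⟩
    iterate 8 simp [cycleStep, hc]
    all_goals
      intro a ha
      simp only [List.mem_cons, List.not_mem_nil, or_false, not_or] at ha
      simp [cycleStep, hc, ha]

/-- The vertices listed so far are closed under `f`, and under `g` except at the start `v` and at
the vertex whose `g`-partner is the current `x`. Hence `f x` is new together with `x`, and the next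
vertex `g (f x)` is either `v`, which closes the cycle, or new again. -/
lemma CycleWalk.step (hf : IsMate G f) (hg : IsMate G g) {s₀ : State}
    (h2 : ∀ x : Fin n, s₀.mem 2 x = f x) (h3 : ∀ x : Fin n, s₀.mem 3 x = g x)
    (h21 : s₀.reg 21 = 1) {bs : List (List (Fin n))} {v : Fin n} {s : State}
    {l : List (Fin n)} {x : Fin n} (h : CycleWalk f g s₀ bs v s l x) (h11 : s.reg 11 = 0) :
    ∃ l' x', CycleWalk f g s₀ bs v (cycleStep.run s) l' x' ∧ l'.length = l.length + 2 := by
  have hx : x ∉ bs.flatten ++ l := by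
    rcases h.flag with h | h
    · exact h.2
    · omega
  have hm2 : s.mem 2 x = f x := by rw [h.frame.mem 2 (by simp), h2]
  have hm3 : s.mem 3 (f x) = g (f x) := by rw [h.frame.mem 3 (by simp), h3]
  have hr21 : s.reg 21 = 1 := by rw [h.frame.reg 21 (by simp), h21]
  have r3 := h.reg3
  set y := f x with hy
  set x' := g y with hx'
  have hfy : f y = x := hf.invol x
  have hgx' : g x' = y := hg.invol y
  have hyx : y ≠ x := hf.ne x
  have hx'y : x' ≠ y := hg.ne y
  have hxL : x ∉ bs.flatten := fun hm => hx (List.mem_append_left _ hm)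
  have hxl : x ∉ l := fun hm => hx (List.mem_append_right _ hm)
  have hyL : y ∉ bs.flatten := fun hm => hxL (hfy ▸ h.layout.closed_f y hm)
  have hyl : y ∉ l := fun hm => hxl (hfy ▸ h.closed_f y hm)
  have hx'new : x' ≠ v → x' ∉ bs.flatten ++ (l ++ [x, y]) := by
    intro hne hm
    simp only [List.mem_append, List.mem_cons, List.not_mem_nil, or_false] at hm
    rcases hm with hm | hm | hm | hm
    · exact hyL (hgx' ▸ h.layout.closed_g x' hm)
    · rcases h.closed_g x' hm with h1 | h1 | h1
      · exact hne h1
      · exact hyx (hgx'.symm.trans h1)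
      · exact hyl (hgx' ▸ h1)
    · rcases h.next with h1 | h1
      · exact hne (hm.trans h1.2)
      · rw [← hm, hgx'] at h1; exact hyl h1
    · exact hx'y hm
  have hne' : (y : ℕ) ≠ x := fun e => hyx (Fin.ext e)
  obtain ⟨c3, c5, c6, c7, c11, m4, m5, m6, cm, cr⟩ := cycleStep_run s
  rw [r3, hm2, hm3] at c3 c11
  rw [r3, hm2] at m4 m5
  rw [r3, hm2, hr21] at m6
  have hpar : ∀ z : Fin n, (cycleStep.run s).par z = if z = y then 1 else s.par z := by
    intro z
    simp [State.par, m6, Function.update_apply, Fin.val_inj]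
  have hcyc : ∀ z : Fin n, (cycleStep.run s).cyc z =
      if z = y then (v : ℕ) + 1 else if z = x then (v : ℕ) + 1 else s.cyc z := by
    intro z
    simp [State.cyc, m5, h.reg10, Function.update_apply, Fin.val_inj]
  have hpar' : ∀ z, z ≠ y → (cycleStep.run s).par z = s.par z := fun z hz => by simp [hpar, hz]
  have hcyc' : ∀ z, z ≠ y → z ≠ x → (cycleStep.run s).cyc z = s.cyc z := fun z hz hz' => by
    simp [hcyc, hz, hz']
  have hvy : v ≠ y := by
    rintro e
    have hh := h.head
    cases l with
    | nil => exact hyx (by simpa [e] using hh.symm)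
    | cons w k => exact hyl (by simpa [e] using Or.inl hh.symm)
  have hparx' : (cycleStep.run s).par x' = 0 := by
    rw [hpar' x' hx'y]
    by_cases hv : x' = v
    · rw [hv]; exact h.par_start
    · exact (h.fresh x' (fun hm => hx'new hv (List.mem_append.2
        ((List.mem_append.1 hm).imp_right (List.mem_append_left _))))).1
  refine ⟨l ++ [x, y], x', ?_, by simp⟩
  have hmemL : ∀ z ∈ bs.flatten, z ≠ y ∧ z ≠ x := fun z hz =>
    ⟨fun e => hyL (e ▸ hz), fun e => hxL (e ▸ hz)⟩
  have hmeml : ∀ z ∈ l, z ≠ y ∧ z ≠ x := fun z hz =>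
    ⟨fun e => hyl (e ▸ hz), fun e => hxl (e ▸ hz)⟩
  constructor
  · exact h.layout.congr (fun z hz => hpar' z (hmemL z hz).1)
      fun z hz => hcyc' z (hmemL z hz).1 (hmemL z hz).2
  · intro z hz
    simp only [List.mem_append, List.mem_cons, List.not_mem_nil, or_false, not_or] at hz
    rw [hpar' z hz.2.2.2, hcyc' z hz.2.2.2 hz.2.2.1]
    exact h.fresh z (by simp [hz.1, hz.2.1])
  · have e : bs.flatten ++ (l ++ [x, y]) = (bs.flatten ++ l) ++ [x, y] := by simp
    have hlen := h.listed.len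
    have hval := h.listed.val
    rw [e]
    generalize bs.flatten ++ l = K at hlen hval
    constructor
    · rw [c5, hlen, List.length_append]; rfl
    · intro i hi
      simp only [m4, hlen, Function.update_apply]
      simp only [List.length_append, List.length_cons, List.length_nil] at hi
      split_ifs with h4 h5
      · subst h4; simp
      · subst h5; simp
      · rw [hval i (by omega), List.getElem_append_left]
  · have e : bs.flatten ++ (l ++ [x, y]) = (bs.flatten ++ l) ++ [x, y] := by simp
    rw [e, List.nodup_append]
    refine ⟨h.nodup, by simp [hyx.symm], ?_⟩
    intro a ha b hb hab
    subst hab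
    simp only [List.mem_cons, List.not_mem_nil, or_false] at hb
    rcases hb with rfl | hb
    · exact hx ha
    · rw [hb] at ha
      rcases List.mem_append.1 ha with ha | ha
      exacts [hyL ha, hyl ha]
  · intro z hz
    simp only [List.mem_append, List.mem_cons, List.not_mem_nil, or_false] at hz ⊢
    rcases hz with hz | rfl | rfl
    · exact Or.inl (h.closed_f z hz)
    · exact Or.inr (Or.inr rfl)
    · exact Or.inr (Or.inl hfy)
  · intro z hz
    simp only [List.mem_append, List.mem_cons, List.not_mem_nil, or_false] at hz ⊢
    rcases hz with hz | rfl | rfl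
    · rcases h.closed_g z hz with h1 | h1 | h1
      · exact Or.inl h1
      · exact Or.inr (Or.inr (Or.inr (Or.inl h1)))
      · exact Or.inr (Or.inr (Or.inl h1))
    · rcases h.next with h1 | h1
      · exact Or.inl h1.2
      · exact Or.inr (Or.inr (Or.inl h1))
    · exact Or.inr (Or.inl rfl)
  · right; rw [hgx']; simp
  · intro z hz
    simp only [List.mem_append, List.mem_cons, List.not_mem_nil, or_false] at hz
    rw [hcyc]
    rcases hz with hz | rfl | rfl
    · rw [if_neg (hmeml z hz).1, if_neg (hmeml z hz).2, h.cyc z hz]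
    · simp
    · simp
  · have e : l ++ [x, y] ++ [x'] = (l ++ [x]) ++ [y, x'] := by simp
    rw [e, List.isChain_append]
    refine ⟨AltStep.congr h.chain fun z hz => hpar' z ?_, ?_, ?_⟩
    · rcases List.mem_append.1 hz with hz | hz
      · exact (hmeml z hz).1
      · simp only [List.mem_singleton] at hz; rw [hz]; exact hyx.symm
    · simp only [List.isChain_cons_cons, List.isChain_singleton, and_true]
      exact Or.inr ⟨by simp [hpar], hparx', rfl⟩
    · intro a ha b hb
      simp only [List.getLast?_append, List.getLast?_singleton, Option.some_or, Option.mem_def,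
        Option.some.injEq, List.head?_cons] at ha hb
      subst ha hb
      exact Or.inl ⟨by rw [hpar' _ hyx.symm]; exact h.par_next, by simp [hpar], rfl⟩
  · have := h.head
    cases l <;> simpa using this
  · exact hparx'
  · rw [hpar' v hvy]; exact h.par_start
  · have := h.even; simp; omega
  · rw [c6, h.need]; simp; omega
  · rw [c7, h.quads]; have := h.even; simp; omega
  · rw [c11, h.reg2]
    by_cases hv : x' = v
    · right; simp [hv]
    · left
      exact ⟨by simp [Fin.val_inj, hv], hx'new hv⟩
  · rw [cr 2 (by simp), h.reg2]
  · rw [c3]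
  · rw [cr 10 (by simp), h.reg10]
  · constructor
    · intro a ha
      rw [← h.frame.mem a ha, cm a ha]
    · intro k hk
      rw [← h.frame.reg k hk, cr k (fun hm => hk (by simp at hm ⊢; omega))]

end Visit

/-! ### Linear running time of the traversal of the alternating cycles -/

section VisitLoop

open RAM RAM.Program

variable {n : ℕ} {G : SimpleGraph (Fin n)} {f g : Fin n → Fin n}

lemma CycleWalk.length_le {s₀ s : State} {bs : List (List (Fin n))} {v x : Fin n}
    {l : List (Fin n)} (h : CycleWalk f g s₀ bs v s l x) : s.reg 5 ≤ n :=
  h.listed.length_le h.nodup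

/-- A closed walk adds a cycle to the layout. -/
lemma CycleWalk.close {s₀ s s' : State} {bs : List (List (Fin n))} {v x : Fin n}
    {l : List (Fin n)} (h : CycleWalk f g s₀ bs v s l x) (h11 : s.reg 11 ≠ 0)
    (hmem : s'.mem = s.mem) (h5 : s'.reg 5 = s.reg 5) (h6 : s'.reg 6 = s.reg 6 - 4)
    (h7 : s'.reg 7 = s.reg 7 - 1) (hfr : VisitFrame s₀ s') :
    Visited f g s₀ s' (bs ++ [l]) ∧ v ∈ l := by
  obtain ⟨-, rfl, hl⟩ := h.flag.resolve_left fun hh => h11 hh.1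
  obtain ⟨w, t, rfl⟩ := List.exists_cons_of_ne_nil hl
  obtain rfl : w = x := by simpa using h.head
  have hpar : (s'.par : Fin n → ℕ) = s.par := by funext z; simp [State.par, hmem]
  have hcyc : (s'.cyc : Fin n → ℕ) = s.cyc := by funext z; simp [State.cyc, hmem]
  have hfl : (bs ++ [w :: t]).flatten = bs.flatten ++ (w :: t) := by simp
  have hlen2 : 2 ≤ (w :: t).length := by
    have := h.even
    simp only [List.length_cons] at this ⊢
    omega
  have hgw : g w ∈ w :: t := h.next.resolve_left fun hh => hl hh.1
  refine ⟨⟨⟨?_, ?_, ?_, ?_⟩, ?_, ?_, ?_, ?_, hfr⟩, by simp⟩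
  · intro b hb
    rw [hpar, hcyc]
    rcases List.mem_append.1 hb with hb | hb
    · exact h.layout.block b hb
    · simp only [List.mem_singleton] at hb
      subst hb
      exact ⟨w, t, rfl, ⟨(List.nodup_append.1 h.nodup).2.1, h.chain, h.par_start⟩, h.cyc⟩
  · rw [hfl]; exact h.nodup
  · rw [hfl]
    intro z hz
    rcases List.mem_append.1 hz with hz | hz
    · exact List.mem_append_left _ (h.layout.closed_f z hz)
    · exact List.mem_append_right _ (h.closed_f z hz)
  · rw [hfl]
    intro z hz
    rcases List.mem_append.1 hz with hz | hz
    · exact List.mem_append_left _ (h.layout.closed_g z hz)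
    · refine List.mem_append_right _ ?_
      rcases h.closed_g z hz with h1 | h1 | h1
      · rw [h1]; exact hgw
      · rw [h1]; simp
      · exact h1
  · rw [hfl, hpar, hcyc]; exact h.fresh
  · rw [hfl]
    exact ⟨by rw [h5, h.listed.len], fun i hi => by rw [hmem]; exact h.listed.val i hi⟩
  · rw [h6, h.need, List.map_append, List.sum_append]
    simp only [List.map_cons, List.map_nil, List.sum_cons, List.sum_nil]
    omega
  · rw [h7, h.quads, List.map_append, List.sum_append]
    simp only [List.map_cons, List.map_nil, List.sum_cons, List.sum_nil]
    omega

lemma Visited.start {s₀ s s' : State} {bs : List (List (Fin n))} {v : Fin n}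
    (h : Visited f g s₀ s bs) (hv : v ∉ bs.flatten) (hmem : s'.mem = s.mem)
    (h5 : s'.reg 5 = s.reg 5) (h6 : s'.reg 6 = s.reg 6) (h7 : s'.reg 7 = s.reg 7)
    (h11 : s'.reg 11 = 0) (h2 : s'.reg 2 = v) (h3 : s'.reg 3 = v) (h10 : s'.reg 10 = v + 1)
    (hfr : VisitFrame s₀ s') : CycleWalk f g s₀ bs v s' [] v := by
  have hpar : (s'.par : Fin n → ℕ) = s.par := by funext z; simp [State.par, hmem]
  have hcyc : (s'.cyc : Fin n → ℕ) = s.cyc := by funext z; simp [State.cyc, hmem]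
  have hfl : bs.flatten ++ [] = bs.flatten := by simp
  constructor
  · rw [hpar, hcyc]; exact h.layout
  · rw [hpar, hcyc, hfl]; exact h.fresh
  · rw [hfl]
    exact ⟨by rw [h5, h.listed.len], fun i hi => by rw [hmem]; exact h.listed.val i hi⟩
  · rw [hfl]; exact h.layout.nodup
  · simp
  · simp
  · exact Or.inl ⟨rfl, rfl⟩
  · simp
  · simp
  · simp
  · rw [hpar]; exact (h.fresh v hv).1
  · rw [hpar]; exact (h.fresh v hv).1
  · simp
  · rw [h6, h.need]; simp
  · rw [h7, h.quads]; simp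
  · exact Or.inl ⟨h11, by rw [hfl]; exact hv⟩
  · exact h2
  · exact h3
  · exact h10
  · exact hfr

lemma VisitFrame.congr {s₀ s s' : State} (h : VisitFrame s₀ s) (hmem : s'.mem = s.mem)
    (hreg : ∀ k, k ∉ [2, 3, 4, 5, 6, 7, 8, 10, 11] → s'.reg k = s.reg k) : VisitFrame s₀ s' :=
  ⟨fun a ha => by rw [hmem, h.mem a ha], fun k hk => by rw [hreg k hk, h.reg k hk]⟩

lemma Visited.congr {s₀ s s' : State} {bs : List (List (Fin n))} (h : Visited f g s₀ s bs)
    (hmem : s'.mem = s.mem) (hreg : ∀ k, k ∉ [2, 3, 8] → s'.reg k = s.reg k) :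
    Visited f g s₀ s' bs := by
  have hpar : (s'.par : Fin n → ℕ) = s.par := by funext z; simp [State.par, hmem]
  have hcyc : (s'.cyc : Fin n → ℕ) = s.cyc := by funext z; simp [State.cyc, hmem]
  refine ⟨?_, ?_, ⟨?_, ?_⟩, ?_, ?_, h.frame.congr hmem fun k hk => hreg k ?_⟩
  · rw [hpar, hcyc]; exact h.layout
  · rw [hpar, hcyc]; exact h.fresh
  · rw [hreg 5 (by simp), h.listed.len]
  · rw [hmem]; exact h.listed.val
  · rw [hreg 6 (by simp), h.need]
  · rw [hreg 7 (by simp), h.quads]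
  · simp only [List.mem_cons, List.not_mem_nil, or_false, not_or] at hk ⊢
    omega

variable (hf : IsMate G f) (hg : IsMate G g) {s₀ : State} (h2 : ∀ x : Fin n, s₀.mem 2 x = f x)
  (h3 : ∀ x : Fin n, s₀.mem 3 x = g x) (h20 : s₀.reg 20 = 0) (h21 : s₀.reg 21 = 1)
include hf hg h2 h3 h20 h21

/-- Listed vertices are distinct, so `n - s.reg 5` counts the free places. Each pass fills two of
them and has 19 instructions, for which the 40 units released are ample; the walk must therefore
close. -/
lemma exec_cycleLoop {s : State} {bs : List (List (Fin n))} {v x : Fin n} {l : List (Fin n)}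
    (h : CycleWalk f g s₀ bs v s l x) : ∃ t s', Exec (.loop (.eq 11 20) cycleStep) s t s' ∧
      (∃ l' x', CycleWalk f g s₀ bs v s' l' x') ∧ s'.reg 11 ≠ 0 ∧
      t + 20 * (n - s'.reg 5) ≤ 20 * (n - s.reg 5) + 1 := by
  have h20' : ∀ {s l x}, CycleWalk f g s₀ bs v s l x → s.reg 20 = 0 := fun h => by
    rw [h.frame.reg 20 (by simp), h20]
  obtain ⟨t, s', e, hI, hb, ht⟩ := exec_loop (b := .eq 11 20) (p := cycleStep)
    (fun s => ∃ l x, CycleWalk f g s₀ bs v s l x) (fun s => 20 * (n - s.reg 5)) (by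
      rintro s ⟨l, x, h⟩ hb
      rw [Test.holds_eq, h20' h] at hb
      obtain ⟨t, ht, e⟩ := exec_run cycleStep s (by simp [cycleStep])
      obtain ⟨l', x', h', hl⟩ := h.step hf hg h2 h3 h21 hb
      refine ⟨t, _, e, ⟨l', x', h'⟩, ?_⟩
      have h1 := h.listed.len
      have h1' := h'.listed.len
      have h5 := h'.length_le
      rw [List.length_append] at h1 h1'
      have hsz : cycleStep.size = 19 := by simp [cycleStep]
      omega) s ⟨l, x, h⟩
  refine ⟨t, s', e, hI, ?_, ht⟩
  obtain ⟨l, x, hI⟩ := hI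
  rw [Test.holds_eq, h20' hI] at hb
  exact hb

lemma exec_visitVertex {s : State} {bs : List (List (Fin n))} (h : Visited f g s₀ s bs) {v : Fin n}
    (hv : s.reg 2 = v) : ∃ t s' bs', Exec visitVertex s t s' ∧ Visited f g s₀ s' bs' ∧
      s'.reg 2 = v + 1 ∧ v ∈ bs'.flatten ∧ bs <+: bs' ∧
      t + 20 * (n - s'.reg 5) ≤ 20 * (n - s.reg 5) + 20 := by
  have hs20 : s.reg 20 = 0 := by rw [h.frame.reg 20 (by simp), h20]
  by_cases hc : s.mem 5 v = 0
  · by_cases hvL : v ∈ bs.flatten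
    · obtain ⟨b, hb, hvb⟩ := List.mem_flatten.1 hvL
      obtain ⟨w, t, rfl, -, hcyc⟩ := h.layout.block b hb
      have : s.mem 5 v = w + 1 := hcyc v hvb
      omega
    have hW := h.start (s' := ((((s.setReg 8 (s.mem 5 (s.reg 2))).setReg 3 (s.reg 2)).setReg 10
      (s.reg 2 + 1)).setReg 11 0)) hvL rfl (by simp) (by simp) (by simp) (by simp) (by simp [hv])
      (by simp [hv]) (by simp [hv]) (h.frame.congr rfl fun k hk => by
        simp only [List.mem_cons, List.not_mem_nil, or_false, not_or] at hk
        simp [hk])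
    obtain ⟨t, s', e, ⟨l', x', hW'⟩, h11, ht⟩ := exec_cycleLoop hf hg h2 h3 h20 h21 hW
    obtain ⟨tf, htf, ef⟩ := exec_run (pred 6 6 ;; pred 6 6 ;; pred 6 6 ;; pred 6 6 ;; pred 7 7) s'
      (by simp)
    have hcl := hW'.close (s' := (Program.run (pred 6 6 ;; pred 6 6 ;; pred 6 6 ;; pred 6 6 ;;
      pred 7 7) s').setReg 2 (s'.reg 2 + 1)) h11 (by simp) (by simp)
      (by simp; omega) (by simp) (hW'.frame.congr (by simp) fun k hk => by
        simp only [List.mem_cons, List.not_mem_nil, or_false, not_or] at hk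
        simp [hk])
    have einit : Exec (copy 3 2 ;; succ 10 2 ;; const 11 0) (s.setReg 8 (s.mem 5 (s.reg 2)))
        (1 + (1 + 1)) ((((s.setReg 8 (s.mem 5 (s.reg 2))).setReg 3 (s.reg 2)).setReg 10
          (s.reg 2 + 1)).setReg 11 0) := by
      have := Exec.seq (Exec.copy (s.setReg 8 (s.mem 5 (s.reg 2))) 3 2)
        (Exec.seq (Exec.succ _ 10 2) (Exec.const _ 11 0))
      simpa using this
    have elast : Exec (succ 2 2) (Program.run (pred 6 6 ;; pred 6 6 ;; pred 6 6 ;; pred 6 6 ;;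
        pred 7 7) s') 1 ((Program.run (pred 6 6 ;; pred 6 6 ;; pred 6 6 ;; pred 6 6 ;;
        pred 7 7) s').setReg 2 (s'.reg 2 + 1)) := by
      have := Exec.succ (Program.run (pred 6 6 ;; pred 6 6 ;; pred 6 6 ;; pred 6 6 ;;
        pred 7 7) s') 2 2
      simpa using this
    have eall := Exec.seq (Exec.load s 8 5 2) (Exec.seq (Exec.ite_true (b := .eq 8 20)
      (q := const 8 0) (by simp [hv, hc, hs20]) (Exec.seq einit (Exec.seq e ef))) elast)
    refine ⟨_, _, _, eall, hcl.1, ?_, ?_, List.prefix_append bs [l'], ?_⟩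
    · simp [hW'.reg2]
    · simp [hcl.2]
    · simp at ht htf ⊢
      omega
  · have hvL : v ∈ bs.flatten := by
      by_contra hvL
      exact hc (h.fresh v hvL).2
    refine ⟨_, _, bs, Exec.seq (Exec.load s 8 5 2) (Exec.seq (Exec.ite_false ?_ (Exec.const _ 8 0))
      (Exec.succ _ 2 2)), h.congr (by simp) ?_, ?_, hvL, List.prefix_rfl, ?_⟩
    · simp [hv, hc, hs20]
    · intro k hk
      simp only [List.mem_cons, List.not_mem_nil, or_false, not_or] at hk
      simp [hk]
    · simp [hv]
    · simp; omega

/-- The first part of the program lists all alternating cycles in linear time. -/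
lemma exec_visit (h0 : s₀.reg 0 = n) (hr2 : s₀.reg 2 = 0) (hr5 : s₀.reg 5 = 0)
    (hr6 : s₀.reg 6 = 0) (hr7 : s₀.reg 7 = 0)
    (h5 : ∀ x, s₀.mem 5 x = 0) (h6 : ∀ x, s₀.mem 6 x = 0) :
    ∃ t s bs, Exec (.loop (.lt 2 0) visitVertex) s₀ t s ∧ Visited f g s₀ s bs ∧
      (∀ x, x ∈ bs.flatten) ∧ t ≤ 50 * n + 1 := by
  have hinit : Visited f g s₀ s₀ ([] : List (List (Fin n))) := by
    refine ⟨⟨by simp, by simp, by simp, by simp⟩, fun x _ => ⟨h6 x, h5 x⟩,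
      ⟨by simp [hr5], by simp⟩, by simp [hr6], by simp [hr7], fun _ _ => rfl, fun _ _ => rfl⟩
  have h0' : ∀ {s bs}, Visited f g s₀ s bs → s.reg 0 = n := fun h => by
    rw [h.frame.reg 0 (by simp), h0]
  obtain ⟨t, s, e, ⟨bs, hI, hle, hall⟩, hb, ht⟩ := exec_loop (b := .lt 2 0) (p := visitVertex)
    (fun s => ∃ bs, Visited f g s₀ s bs ∧ s.reg 2 ≤ n ∧ ∀ x : Fin n, x < s.reg 2 → x ∈ bs.flatten)
    -- Two credits: 20 for each vertex not yet listed pays for the inner loops, 30 for each vertex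
    -- not yet visited pays for the remaining work.
    (fun s => 20 * (n - s.reg 5) + 30 * (n - s.reg 2)) (by
      rintro s ⟨bs, h, hle, hall⟩ hb
      rw [Test.holds_lt, h0' h] at hb
      obtain ⟨t, s', bs', e, h', hr, hmem, hpre, ht⟩ :=
        exec_visitVertex hf hg h2 h3 h20 h21 h (v := ⟨s.reg 2, hb⟩) rfl
      simp only at hr
      refine ⟨t, s', e, ⟨bs', h', by omega, ?_⟩, by omega⟩
      intro x hx
      rw [hr] at hx
      rcases Nat.lt_succ_iff_lt_or_eq.1 hx with hx | hx
      · exact hpre.flatten.subset (hall x hx)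
      · have : x = ⟨s.reg 2, hb⟩ := Fin.ext hx
        rw [this]; exact hmem) s₀ ⟨[], hinit, by omega, by simp [hr2]⟩
  rw [Test.holds_lt, h0' hI] at hb
  refine ⟨t, s, bs, e, hI, fun x => hall x (by omega), ?_⟩
  simp only [hr5, hr2] at ht
  omega

end VisitLoop

/-! ### Counting the chords -/

section Count

open RAM RAM.Program

variable {n : ℕ} {G : SimpleGraph (Fin n)} {f g : Fin n → Fin n}

/-- The vertices joined to `x` by an edge in `T` that the algorithm counts. -/
def counted (par cyc : Fin n → ℕ) (T : List (Fin n × Fin n)) (x : Fin n) : Finset (Fin n) :=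
  Finset.univ.filter fun y => cyc x = cyc y ∧ par x ≠ par y ∧ ((x, y) ∈ T ∨ (y, x) ∈ T)

/-- The invariant of the edge count, after `e` edges. -/
structure Counting (L : List (Fin n × Fin n)) (s₁ s : State) (e : ℕ) : Prop where
  deg : ∀ x : Fin n, s.mem 7 x = (counted s₁.par s₁.cyc (L.take e) x).card
  total : s.reg 9 = ∑ x : Fin n, s.mem 7 x
  index : s.reg 2 = e
  mem : ∀ a, a ≠ 7 → s.mem a = s₁.mem a
  reg : ∀ k, k ∉ [2, 3, 4, 8, 9, 12] → s.reg k = s₁.reg k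

lemma countEdge_run (s : State) (hne : s.mem 0 (s.reg 2) ≠ s.mem 1 (s.reg 2)) :
    ((s.mem 5 (s.mem 0 (s.reg 2)) = s.mem 5 (s.mem 1 (s.reg 2)) ∧
      s.mem 6 (s.mem 0 (s.reg 2)) ≠ s.mem 6 (s.mem 1 (s.reg 2))) →
      (countEdge.run s).mem 7 = Function.update (Function.update (s.mem 7) (s.mem 0 (s.reg 2))
        (s.mem 7 (s.mem 0 (s.reg 2)) + 1)) (s.mem 1 (s.reg 2))
        (s.mem 7 (s.mem 1 (s.reg 2)) + 1) ∧ (countEdge.run s).reg 9 = s.reg 9 + 2) ∧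
    (¬ (s.mem 5 (s.mem 0 (s.reg 2)) = s.mem 5 (s.mem 1 (s.reg 2)) ∧
      s.mem 6 (s.mem 0 (s.reg 2)) ≠ s.mem 6 (s.mem 1 (s.reg 2))) →
      (countEdge.run s).mem 7 = s.mem 7 ∧ (countEdge.run s).reg 9 = s.reg 9) ∧
    (countEdge.run s).reg 2 = s.reg 2 + 1 ∧
    (∀ a, a ≠ 7 → (countEdge.run s).mem a = s.mem a) ∧
    ∀ k, k ∉ [2, 3, 4, 8, 9, 12] → (countEdge.run s).reg k = s.reg k := by
  by_cases h1 : s.mem 5 (s.mem 0 (s.reg 2)) = s.mem 5 (s.mem 1 (s.reg 2))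
  · by_cases h2 : s.mem 6 (s.mem 0 (s.reg 2)) = s.mem 6 (s.mem 1 (s.reg 2))
    all_goals
      refine ⟨?_, ?_, ?_, ?_, ?_⟩
      · simp [countEdge, h1, h2, hne.symm]
      · simp [countEdge, h1, h2]
      · simp [countEdge, h1, h2]
      · intro a ha; simp [countEdge, h1, h2, ha]
      · intro k hk
        simp only [List.mem_cons, List.not_mem_nil, or_false, not_or] at hk
        simp [countEdge, h1, h2, hk]
  · refine ⟨?_, ?_, ?_, ?_, ?_⟩
    · simp [h1]
    · simp [countEdge, h1]
    · simp [countEdge, h1]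
    · intro a ha; simp [countEdge, h1]
    · intro k hk
      simp only [List.mem_cons, List.not_mem_nil, or_false, not_or] at hk
      simp [countEdge, h1, hk]

/-- Since the edge has not been listed in either direction, each of its ends gains a genuinely new
neighbour and the count rises by exactly one. -/
lemma counted_append {par cyc : Fin n → ℕ} {T : List (Fin n × Fin n)} {u w : Fin n} (hne : u ≠ w)
    (h1 : (u, w) ∉ T) (h2 : (w, u) ∉ T) (x : Fin n) :
    (counted par cyc (T ++ [(u, w)]) x).card = (counted par cyc T x).card +
      if cyc u = cyc w ∧ par u ≠ par w then
        (if x = u then 1 else 0) + (if x = w then 1 else 0) else 0 := by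
  have hmem : ∀ y, y ∈ counted par cyc (T ++ [(u, w)]) x ↔ y ∈ counted par cyc T x ∨
      (cyc x = cyc y ∧ par x ≠ par y ∧ ((x = u ∧ y = w) ∨ (y = u ∧ x = w))) := by
    intro y
    simp only [counted, Finset.mem_filter, Finset.mem_univ, true_and, List.mem_append,
      List.mem_singleton, Prod.mk.injEq]
    tauto
  split_ifs with hs hu hw hw
  · exact absurd (hu.symm.trans hw) hne
  · subst hu
    have : counted par cyc (T ++ [(x, w)]) x = insert w (counted par cyc T x) := by
      ext y
      rw [hmem, Finset.mem_insert]
      constructor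
      · rintro (h | ⟨-, -, h | h⟩)
        exacts [Or.inr h, Or.inl h.2, absurd h.2 hw]
      · rintro (rfl | h)
        exacts [Or.inr ⟨hs.1, hs.2, Or.inl ⟨rfl, rfl⟩⟩, Or.inl h]
    rw [this, Finset.card_insert_of_notMem]
    simp [counted, h1, h2]
  · subst hw
    have : counted par cyc (T ++ [(u, x)]) x = insert u (counted par cyc T x) := by
      ext y
      rw [hmem, Finset.mem_insert]
      constructor
      · rintro (h | ⟨-, -, h | h⟩)
        exacts [Or.inr h, absurd h.1 hu, Or.inl h.1]
      · rintro (rfl | h)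
        exacts [Or.inr ⟨hs.1.symm, hs.2.symm, Or.inr ⟨rfl, rfl⟩⟩, Or.inl h]
    rw [this, Finset.card_insert_of_notMem]
    simp [counted, h1, h2]
  · suffices h : counted par cyc (T ++ [(u, w)]) x = counted par cyc T x by simp [h]
    ext y
    rw [hmem]
    exact ⟨fun h => h.resolve_right fun h => by tauto, Or.inl⟩
  · suffices h : counted par cyc (T ++ [(u, w)]) x = counted par cyc T x by simp [h]
    ext y
    rw [hmem]
    refine ⟨fun h => h.resolve_right ?_, Or.inl⟩
    rintro ⟨h3, h4, ⟨rfl, rfl⟩ | ⟨rfl, rfl⟩⟩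
    exacts [hs ⟨h3, h4⟩, hs ⟨h3.symm, h4.symm⟩]

lemma Counting.step {L : List (Fin n × Fin n)} (hL : IsEdgeList G L) {s₁ s : State} {e : ℕ}
    (h0 : ∀ i (hi : i < L.length), s₁.mem 0 i = L[i].1)
    (h1 : ∀ i (hi : i < L.length), s₁.mem 1 i = L[i].2) (h : Counting L s₁ s e)
    (he : e < L.length) : Counting L s₁ (countEdge.run s) (e + 1) := by
  have hu : s.mem 0 (s.reg 2) = L[e].1 := by rw [h.index, h.mem 0 (by simp), h0 e he]
  have hw : s.mem 1 (s.reg 2) = L[e].2 := by rw [h.index, h.mem 1 (by simp), h1 e he]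
  set u := L[e].1 with hu'
  set w := L[e].2 with hw'
  have hLe : L[e] = (u, w) := rfl
  have hadj : G.Adj u w := (hL.2 u w).2 (Or.inl (hLe ▸ List.getElem_mem he))
  have hne : u ≠ w := hadj.ne
  have hnew : ∀ q ∈ L.take e, s(q.1, q.2) ≠ s(u, w) := by
    intro q hq heq
    have hnd := hL.1
    rw [← List.take_append_drop e L, List.map_append, List.nodup_append] at hnd
    refine hnd.2.2 _ (List.mem_map_of_mem hq) s(u, w) ?_ heq
    refine List.mem_map.2 ⟨(u, w), ?_, rfl⟩
    rw [List.drop_eq_getElem_cons he, hLe]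
    simp
  have hn1 : (u, w) ∉ L.take e := fun hm => hnew _ hm rfl
  have hn2 : (w, u) ∉ L.take e := fun hm => hnew _ hm Sym2.eq_swap
  have htake : L.take (e + 1) = L.take e ++ [(u, w)] := by
    rw [List.take_succ_eq_append_getElem he, hLe]
  obtain ⟨r1, r2, r3, r4, r5⟩ := countEdge_run s (by
    rw [hu, hw]; exact fun e => hne (Fin.ext e))
  rw [hu, hw, h.mem 5 (by simp), h.mem 6 (by simp)] at r1 r2
  have hD : ∀ x : Fin n, (countEdge.run s).mem 7 x = s.mem 7 x +
      if s₁.cyc u = s₁.cyc w ∧ s₁.par u ≠ s₁.par w then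
        (if x = u then 1 else 0) + (if x = w then 1 else 0) else 0 := by
    intro x
    by_cases hc : s₁.cyc u = s₁.cyc w ∧ s₁.par u ≠ s₁.par w
    · rw [(r1 hc).1, if_pos hc]
      simp only [Function.update_apply, Fin.val_inj]
      by_cases hxw : x = w
      · subst hxw; simp [hne.symm]
      · by_cases hxu : x = u
        · subst hxu; simp [hxw]
        · simp [hxu, hxw]
    · rw [(r2 hc).1, if_neg hc]; rfl
  refine ⟨?_, ?_, by rw [r3, h.index], fun a ha => by rw [r4 a ha, h.mem a ha],
    fun k hk => by rw [r5 k hk, h.reg k hk]⟩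
  · intro x
    rw [hD, htake, counted_append hne hn1 hn2, h.deg]
  · simp only [hD]
    rw [Finset.sum_add_distrib, ← h.total]
    by_cases hc : s₁.cyc u = s₁.cyc w ∧ s₁.par u ≠ s₁.par w
    · rw [(r1 hc).2]
      simp only [if_pos hc, Finset.sum_add_distrib, Finset.sum_ite_eq', Finset.mem_univ, if_true]
    · rw [(r2 hc).2]
      simp [if_neg hc]

lemma exec_count {L : List (Fin n × Fin n)} (hL : IsEdgeList G L) {s₁ : State}
    (h0 : ∀ i (hi : i < L.length), s₁.mem 0 i = L[i].1)
    (h1 : ∀ i (hi : i < L.length), s₁.mem 1 i = L[i].2) (h7 : ∀ x, s₁.mem 7 x = 0)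
    (hr1 : s₁.reg 1 = L.length) (hr2 : s₁.reg 2 = 0) (hr9 : s₁.reg 9 = 0) :
    ∃ t s, Exec (.loop (.lt 2 1) countEdge) s₁ t s ∧ Counting L s₁ s L.length ∧
      t ≤ 20 * L.length + 1 := by
  have hinit : Counting L s₁ s₁ 0 := by
    refine ⟨fun x => ?_, by simp [hr9, h7], hr2, fun _ _ => rfl, fun _ _ => rfl⟩
    simp [h7, counted]
  obtain ⟨t, s, e, ⟨i, hI, hi⟩, hb, ht⟩ := exec_loop (b := .lt 2 1) (p := countEdge)
    (fun s => ∃ e, Counting L s₁ s e ∧ e ≤ L.length) (fun s => 20 * (L.length - s.reg 2)) (by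
      rintro s ⟨i, h, hi⟩ hb
      rw [Test.holds_lt, h.index, h.reg 1 (by simp), hr1] at hb
      obtain ⟨t, ht, e⟩ := exec_run countEdge s (by simp [countEdge])
      have h' := h.step hL h0 h1 hb
      refine ⟨t, _, e, ⟨i + 1, h', hb⟩, ?_⟩
      rw [h'.index, h.index]
      have hsz : countEdge.size = 19 := by simp [countEdge]
      omega) s₁ ⟨0, hinit, by omega⟩
  rw [Test.holds_lt, hI.index, hI.reg 1 (by simp), hr1] at hb
  obtain rfl : i = L.length := by omega
  refine ⟨t, s, e, hI, ?_⟩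
  simp only [hr2] at ht
  omega

/-- In a layout, vertices with the same label lie on the same cycle. -/
lemma Layout.mem_iff {par cyc : Fin n → ℕ} {bs : List (List (Fin n))}
    (h : Layout f g par cyc bs) (hall : ∀ x, x ∈ bs.flatten) {b : List (Fin n)} (hb : b ∈ bs)
    {x y : Fin n} (hx : x ∈ b) : y ∈ b ↔ cyc x = cyc y := by
  obtain ⟨v, t, rfl, -, hcyc⟩ := h.block b hb
  refine ⟨fun hy => by rw [hcyc x hx, hcyc y hy], fun he => ?_⟩
  obtain ⟨b', hb', hy⟩ := List.mem_flatten.1 (hall y)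
  obtain ⟨v', t', rfl, -, hcyc'⟩ := h.block b' hb'
  have hvv : v' = v := by
    have h1 := hcyc x hx
    have h2 := hcyc' y hy
    exact Fin.ext (by omega)
  subst hvv
  by_cases he : v' :: t = v' :: t'
  · rw [he]; exact hy
  · have hpw := (List.nodup_flatten.1 h.nodup).2
    have : Std.Symm (List.Disjoint (α := Fin n)) := ⟨fun _ _ h => h.symm⟩
    have : List.Disjoint (v' :: t) (v' :: t') := hpw.forall hb hb' he
    exact absurd (by simp) (this (by simp : v' ∈ v' :: t))

lemma Layout.par_cases {par cyc : Fin n → ℕ} {bs : List (List (Fin n))}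
    (h : Layout f g par cyc bs) {b : List (Fin n)} (hb : b ∈ bs)
    {x : Fin n} (hx : x ∈ b) : par x = 0 ∨ par x = 1 := by
  obtain ⟨v, t, rfl, hbl, -⟩ := h.block b hb
  exact hbl.par_cases x hx

/-- After counting, the memory holds the degrees in the cycles. -/
lemma Layout.card_counted {par cyc : Fin n → ℕ} {bs : List (List (Fin n))}
    (h : Layout f g par cyc bs) (hall : ∀ x, x ∈ bs.flatten) {L : List (Fin n × Fin n)}
    (hL : IsEdgeList G L) {b : List (Fin n)} (hb : b ∈ bs) {x : Fin n} (hx : x ∈ b) :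
    (counted par cyc L x).card = ldeg (oppAdj G par) b x := by
  classical
  unfold ldeg
  have hnd : b.Nodup := (List.nodup_flatten.1 h.nodup).1 b hb
  rw [List.countP_eq_length_filter, ← List.toFinset_card_of_nodup (hnd.filter _)]
  congr 1
  ext y
  simp only [counted, Finset.mem_filter, Finset.mem_univ, true_and, List.mem_toFinset,
    List.mem_filter, ← hL.2]
  rw [decide_eq_true_iff]
  unfold oppAdj
  rw [h.mem_iff hall hb hx]
  constructor
  · rintro ⟨h1, h2, h3⟩
    have hy := (h.mem_iff hall hb hx).2 h1
    have p1 := h.par_cases hb hx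
    have p2 := h.par_cases hb hy
    exact ⟨h1, h3, by omega⟩
  · rintro ⟨h1, h2, h3⟩
    exact ⟨h1, by omega, h2⟩

/-- Every vertex lies on exactly one cycle, so the sum over vertices splits into one sum for each
cycle. -/
lemma Layout.sum_eq {par cyc : Fin n → ℕ} {bs : List (List (Fin n))}
    (h : Layout f g par cyc bs) (hall : ∀ x, x ∈ bs.flatten) {L : List (Fin n × Fin n)}
    (hL : IsEdgeList G L) : ∑ x : Fin n, (counted par cyc L x).card =
      (bs.map fun b => degSum (oppAdj G par) b).sum := by
  have huniv : (Finset.univ : Finset (Fin n)) = bs.flatten.toFinset := by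
    ext x; simp only [Finset.mem_univ, List.mem_toFinset, hall x]
  rw [huniv, List.sum_toFinset _ h.nodup, List.map_flatten, List.sum_flatten, List.map_map]
  congr 1
  refine List.map_congr_left fun b hb => ?_
  simp only [Function.comp_apply, degSum]
  congr 1
  exact List.map_congr_left fun x hx => h.card_counted hall hL hb hx

end Count

/-! ### Cutting off quadrangles -/

section ScanCongr

variable {V : Type*} {G : SimpleGraph V} {par : V → ℕ} {f g : V → V}

lemma List.IsChain.imp_of_mem {P Q : V → V → Prop} {l : List V} (h : List.IsChain P l)
    (hPQ : ∀ x ∈ l, ∀ y ∈ l, P x y → Q x y) : List.IsChain Q l := by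
  rw [List.isChain_iff_getElem] at h ⊢
  exact fun i hi => hPQ _ (List.getElem_mem _) _ (List.getElem_mem _) (h i hi)

/-- The invariant depends only on the values at the vertices of its polygon. Cuts in one cycle
therefore do not disturb the cycles still to come. -/
lemma ScanInv.congr {D D' : V → ℕ} {st rest : List V} {f' g' : V → V}
    (h : ScanInv G par D st rest f g)
    (hc : ∀ x ∈ st ++ rest, D' x = D x ∧ f' x = f x ∧ g' x = g x) :
    ScanInv G par D' st rest f' g' := by
  refine ⟨h.poly, h.full, fun x hx => by rw [(hc x hx).1, h.deg x hx], ?_, ?_, ?_, h.head, ?_⟩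
  · exact h.even.imp_of_mem fun x hx y _ hxy => by rwa [(hc x hx).2.1]
  · exact h.odd.imp_of_mem fun x hx y _ hxy => by rwa [(hc x hx).2.2]
  · rw [(hc _ (List.getLast_mem _)).2.2]; exact h.last
  · intro s a b c d r hs hr
    rw [(hc b (by simp [hs])).1, (hc c (by simp [hs])).1]
    exact h.irred s a b c d r hs hr

lemma IsBlock.scanInv {v : V} {t : List V} (h : IsBlock f g par v t)
    (hp : ChordPolygon (oppAdj G par) par (v :: t))
    (hfull : degSum (oppAdj G par) (v :: t) + 4 = 3 * (v :: t).length) {D : V → ℕ}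
    (hD : ∀ x ∈ v :: t, D x = ldeg (oppAdj G par) (v :: t) x) :
    ScanInv G par D [] (v :: t) f g := by
  have hch := List.isChain_append.1 h.chain
  refine ⟨hp, hfull, hD, ?_, ?_, ?_, h.par_eq, by simp⟩
  · exact hch.1.imp fun x y hxy hx => by rcases hxy with h | h <;> simp_all
  · exact hch.1.imp fun x y hxy hx => by rcases hxy with h | h <;> simp_all
  · have := hch.2.2 ((v :: t).getLast (by simp)) (List.getLast?_eq_some_getLast (by simp)) v
      (by simp)
    have hpar := hp.opp _ _ hp.closing
    have hv := h.par_eq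
    simp only [List.nil_append, List.head_cons] at hpar ⊢
    rcases this with h | h
    · omega
    · exact h.2.2

end ScanCongr

/-! ### Invariants of the scan and the layout of its output -/

section Scanning

open RAM RAM.Program

variable {n : ℕ} {G : SimpleGraph (Fin n)} {f g : Fin n → Fin n}

/-- The quadruple `e` is stored at index `i` of the output arrays. -/
def Stores (s : State) (i : ℕ) (e : Fin n × Fin n × Fin n × Fin n) : Prop :=
  s.mem 0 i = e.1 ∧ s.mem 1 i = e.2.1 ∧ s.mem 2 i = e.2.2.1 ∧ s.mem 3 i = e.2.2.2

/-- The output arrays, of length `q`, begin with `ev` and end with `od`. -/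
structure Emitted (s : State) (q : ℕ) (ev od : List (Fin n × Fin n × Fin n × Fin n)) : Prop where
  front : s.reg 13 = ev.length
  back : s.reg 14 + od.length = q
  fst : ∀ i (h : i < ev.length), Stores s i ev[i]
  snd : ∀ i (h : i < od.length), Stores s (s.reg 14 + i) od[i]

/-- The invariant of the scan, apart from the stack: `cur` lists the vertices left of the current
cycle, and `future` the cycles still to come. The flips along `ev` lead from `f` to `f'`, those
along `od` from `g'` to `g`. -/
structure Work (G : SimpleGraph (Fin n)) (f g : Fin n → Fin n) (s₂ : State) (q : ℕ) (s : State)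
    (cur : List (Fin n)) (future : List (List (Fin n))) (f' g' : Fin n → Fin n)
    (ev od : List (Fin n × Fin n × Fin n × Fin n)) : Prop where
  matef : IsMate G f'
  mateg : IsMate G g'
  pathf : FlipPath G f ev f'
  pathg : FlipPath G g' od g
  ready : ∀ b ∈ future, ∃ v t, b = v :: t ∧ s₂.cyc v = v + 1 ∧ (∀ x ∈ t, s₂.cyc x ≠ x + 1) ∧
    ScanInv G s₂.par (fun x => s.mem 7 x) [] b f' g'
  done : ∀ x, x ∉ cur → x ∉ future.flatten → f' x = g' x
  nodup : (cur ++ future.flatten).Nodup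
  emitted : Emitted s q ev od
  budget : ev.length + od.length + (cur.length / 2 - 1) +
    (future.map fun b => b.length / 2 - 1).sum = q
  mem : ∀ a ∈ [4, 5, 6], s.mem a = s₂.mem a
  reg : ∀ k, k ∉ [2, 3, 8, 11, 12, 13, 14, 15, 16, 17, 18, 19] → s.reg k = s₂.reg k

/-- The stack holds the list `st`, bottom first. -/
structure StackHolds (s : State) (st : List (Fin n)) : Prop where
  len : s.reg 15 = st.length
  val : ∀ i (h : i < st.length), s.mem 8 i = st[i]

/-- The invariant of the scan within a cycle. -/
structure Scanning (G : SimpleGraph (Fin n)) (f g : Fin n → Fin n) (s₂ : State) (q : ℕ)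
    (rest : List (Fin n)) (future : List (List (Fin n))) (s : State) (st : List (Fin n))
    (f' g' : Fin n → Fin n) (ev od : List (Fin n × Fin n × Fin n × Fin n)) : Prop where
  work : Work G f g s₂ q s (st ++ rest) future f' g' ev od
  inv : ScanInv G s₂.par (fun x => s.mem 7 x) st rest f' g'
  stack : StackHolds s st

variable {s₂ s s' : State} {q : ℕ} {cur st rest : List (Fin n)} {future : List (List (Fin n))}
  {f' g' : Fin n → Fin n} {ev od : List (Fin n × Fin n × Fin n × Fin n)}

lemma Emitted.congr (h : Emitted s q ev od) (hmem : ∀ a < 4, s'.mem a = s.mem a)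
    (h13 : s'.reg 13 = s.reg 13) (h14 : s'.reg 14 = s.reg 14) : Emitted s' q ev od := by
  have hst : ∀ i e, Stores (n := n) s i e → Stores s' i e := fun i e he => by
    unfold Stores
    rwa [hmem 0 (by simp), hmem 1 (by simp), hmem 2 (by simp), hmem 3 (by simp)]
  exact ⟨by rw [h13, h.front], by rw [h14, h.back], fun i hi => hst _ _ (h.fst i hi),
    fun i hi => by rw [h14]; exact hst _ _ (h.snd i hi)⟩

lemma Work.congr (h : Work G f g s₂ q s cur future f' g' ev od)
    (hmem : ∀ a, a < 8 → s'.mem a = s.mem a)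
    (hreg : ∀ k, k ∉ [2, 3, 8, 11, 12, 15, 16, 17, 18, 19] → s'.reg k = s.reg k) :
    Work G f g s₂ q s' cur future f' g' ev od := by
  refine ⟨h.matef, h.mateg, h.pathf, h.pathg, ?_, h.done, h.nodup, h.emitted.congr
    (fun a ha => hmem a (by omega)) (hreg 13 (by simp)) (hreg 14 (by simp)), h.budget, ?_, ?_⟩
  · rw [hmem 7 (by simp)]; exact h.ready
  · intro a ha
    rw [← h.mem a ha, hmem a (by simp at ha; omega)]
  · intro k hk
    rw [← h.reg k hk, hreg k (by simp at hk ⊢; omega)]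

lemma Scanning.congr (h : Scanning G f g s₂ q rest future s st f' g' ev od)
    (hmem : s'.mem = s.mem)
    (hreg : ∀ k, k ∉ [2, 3, 8, 11, 12, 16, 17, 18, 19] → s'.reg k = s.reg k) :
    Scanning G f g s₂ q rest future s' st f' g' ev od := by
  refine ⟨h.work.congr (fun a _ => by rw [hmem]) fun k hk => hreg k ?_, ?_, ?_, ?_⟩
  · simp at hk ⊢; omega
  · rw [hmem]; exact h.inv
  · rw [hreg 15 (by simp), h.stack.len]
  · rw [hmem]; exact h.stack.val

lemma cutQuad_run (s : State) (h20 : s.reg 20 = 0) (had : s.reg 16 ≠ s.reg 19) :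
    (cutQuad.run s).mem 7 = Function.update (Function.update (s.mem 7) (s.reg 16)
      (s.mem 7 (s.reg 16) - 1)) (s.reg 19) (s.mem 7 (s.reg 19) - 1) ∧
    (cutQuad.run s).mem 8 = Function.update (s.mem 8) (s.reg 15 - 3) (s.reg 19) ∧
    (cutQuad.run s).reg 15 = s.reg 15 - 2 ∧ (cutQuad.run s).reg 11 = 0 ∧
    (s.mem 6 (s.reg 16) = 0 → (cutQuad.run s).reg 13 = s.reg 13 + 1 ∧
      (cutQuad.run s).reg 14 = s.reg 14 ∧
      (cutQuad.run s).mem 0 = Function.update (s.mem 0) (s.reg 13) (s.reg 16) ∧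
      (cutQuad.run s).mem 1 = Function.update (s.mem 1) (s.reg 13) (s.reg 17) ∧
      (cutQuad.run s).mem 2 = Function.update (s.mem 2) (s.reg 13) (s.reg 18) ∧
      (cutQuad.run s).mem 3 = Function.update (s.mem 3) (s.reg 13) (s.reg 19)) ∧
    (s.mem 6 (s.reg 16) ≠ 0 → (cutQuad.run s).reg 13 = s.reg 13 ∧
      (cutQuad.run s).reg 14 = s.reg 14 - 1 ∧
      (cutQuad.run s).mem 0 = Function.update (s.mem 0) (s.reg 14 - 1) (s.reg 16) ∧
      (cutQuad.run s).mem 1 = Function.update (s.mem 1) (s.reg 14 - 1) (s.reg 17) ∧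
      (cutQuad.run s).mem 2 = Function.update (s.mem 2) (s.reg 14 - 1) (s.reg 18) ∧
      (cutQuad.run s).mem 3 = Function.update (s.mem 3) (s.reg 14 - 1) (s.reg 19)) ∧
    (∀ a ∈ [4, 5, 6], (cutQuad.run s).mem a = s.mem a) ∧
    ∀ k, k ∉ [8, 11, 12, 13, 14, 15] → (cutQuad.run s).reg k = s.reg k := by
  by_cases hc : s.mem 6 (s.reg 16) = 0
  all_goals
    refine ⟨?_, ?_, ?_, ?_, ?_, ?_, ?_, ?_⟩
    · simp [cutQuad, hc, h20, had.symm]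
    · simp [cutQuad, hc, h20, Nat.sub_sub]
    · simp [cutQuad, hc, h20, Nat.sub_sub]
    · simp [cutQuad]
    · simp [cutQuad, hc, h20]
    · simp [cutQuad, hc, h20]
    · simp [cutQuad, hc, h20]
    · intro k hk
      simp only [List.mem_cons, List.not_mem_nil, or_false, not_or] at hk
      simp [cutQuad, hc, h20, hk]

lemma tryCut_run (s : State) (h22 : s.reg 22 = 2) (h23 : s.reg 23 = 3) :
    (3 < s.reg 15 ∧ s.mem 7 (s.mem 8 (s.reg 15 - 3)) = 2 ∧ s.mem 7 (s.mem 8 (s.reg 15 - 2)) = 2 →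
      ∃ s', tryCut.run s = cutQuad.run s' ∧ s'.mem = s.mem ∧
        s'.reg 16 = s.mem 8 (s.reg 15 - 4) ∧ s'.reg 17 = s.mem 8 (s.reg 15 - 3) ∧
        s'.reg 18 = s.mem 8 (s.reg 15 - 2) ∧ s'.reg 19 = s.mem 8 (s.reg 15 - 1) ∧
        ∀ k, k ∉ [8, 11, 16, 17, 18, 19] → s'.reg k = s.reg k) ∧
    (¬ (3 < s.reg 15 ∧ s.mem 7 (s.mem 8 (s.reg 15 - 3)) = 2 ∧
        s.mem 7 (s.mem 8 (s.reg 15 - 2)) = 2) →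
      (tryCut.run s).mem = s.mem ∧ (tryCut.run s).reg 11 = 1 ∧
        ∀ k, k ∉ [8, 11, 16, 17, 18, 19] → (tryCut.run s).reg k = s.reg k) := by
  constructor
  · rintro ⟨h1, h2, h3⟩
    -- The straight-line part of `tryCut` along the successful branch, with the tests left out.
    refine ⟨(const 11 1 ;; pred 8 15 ;; load 19 8 8 ;; pred 8 8 ;; load 18 8 8 ;; pred 8 8 ;;
      load 17 8 8 ;; pred 8 8 ;; load 16 8 8 ;; load 8 7 17 ;; load 8 7 18).run s, ?_, ?_⟩
    · simp [tryCut, h1, h22, h23, h2, h3, Nat.sub_sub]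
    · refine ⟨by simp, by simp [Nat.sub_sub], by simp [Nat.sub_sub], by simp [Nat.sub_sub],
        by simp [Nat.sub_sub], ?_⟩
      intro k hk
      simp only [List.mem_cons, List.not_mem_nil, or_false, not_or] at hk
      simp [hk]
  · intro hn
    by_cases h1 : 3 < s.reg 15
    · by_cases h2 : s.mem 7 (s.mem 8 (s.reg 15 - 3)) = 2
      · have h3 : s.mem 7 (s.mem 8 (s.reg 15 - 2)) ≠ 2 := fun h3 => hn ⟨h1, h2, h3⟩
        refine ⟨by simp [tryCut, h1, h2, h3, h22, h23, Nat.sub_sub],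
          by simp [tryCut, h1, h2, h3, h22, h23, Nat.sub_sub], fun k hk => ?_⟩
        simp only [List.mem_cons, List.not_mem_nil, or_false, not_or] at hk
        simp [tryCut, h1, h2, h3, h22, h23, Nat.sub_sub, hk]
      · refine ⟨by simp [tryCut, h1, h2, h22, h23, Nat.sub_sub],
          by simp [tryCut, h1, h2, h22, h23, Nat.sub_sub], fun k hk => ?_⟩
        simp only [List.mem_cons, List.not_mem_nil, or_false, not_or] at hk
        simp [tryCut, h1, h2, h22, h23, Nat.sub_sub, hk]
    · refine ⟨by simp [tryCut, h1, h23], by simp [tryCut, h1, h23], fun k hk => ?_⟩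
      simp only [List.mem_cons, List.not_mem_nil, or_false, not_or] at hk
      simp [tryCut, h1, h23, hk]

lemma List.exists_append_four {α : Type*} {l : List α} (h : 3 < l.length) :
    ∃ s a b c d, l = s ++ [a, b, c, d] := by
  refine ⟨l.take (l.length - 4), ?_⟩
  have hl : (l.drop (l.length - 4)).length = 4 := by simp; omega
  obtain ⟨a, b, c, d, hd⟩ : ∃ a b c d, l.drop (l.length - 4) = [a, b, c, d] := by
    match l.drop (l.length - 4), hl with
    | [a, b, c, d], _ => exact ⟨a, b, c, d, rfl⟩
  exact ⟨a, b, c, d, by rw [← hd, List.take_append_drop]⟩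

/-- The two parts of the output grow towards each other. The free cell between them guarantees that
the new entry overwrites neither part. -/
lemma Emitted.push_front (h : Emitted s q ev od) (hlt : ev.length < s.reg 14)
    {e : Fin n × Fin n × Fin n × Fin n} (h13 : s'.reg 13 = s.reg 13 + 1)
    (h14 : s'.reg 14 = s.reg 14)
    (m0 : s'.mem 0 = Function.update (s.mem 0) (s.reg 13) e.1)
    (m1 : s'.mem 1 = Function.update (s.mem 1) (s.reg 13) e.2.1)
    (m2 : s'.mem 2 = Function.update (s.mem 2) (s.reg 13) e.2.2.1)
    (m3 : s'.mem 3 = Function.update (s.mem 3) (s.reg 13) e.2.2.2) :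
    Emitted s' q (ev ++ [e]) od := by
  have hst : ∀ i e', i ≠ s.reg 13 → Stores (n := n) s i e' → Stores s' i e' := by
    intro i e' hi he
    simpa [Stores, m0, m1, m2, m3, hi] using he
  refine ⟨by simp [h13, h.front], by rw [h14, h.back], ?_, ?_⟩
  · intro i hi
    rcases Nat.lt_or_ge i ev.length with hi' | hi'
    · rw [List.getElem_append_left hi']
      exact hst _ _ (by rw [h.front]; omega) (h.fst i hi')
    · have : i = ev.length := by simp at hi; omega
      subst this
      simp [Stores, m0, m1, m2, m3, h.front]
  · intro i hi
    rw [h14]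
    exact hst _ _ (by rw [h.front]; omega) (h.snd i hi)

lemma Emitted.push_back (h : Emitted s q ev od) (hlt : ev.length < s.reg 14)
    {e : Fin n × Fin n × Fin n × Fin n} (h13 : s'.reg 13 = s.reg 13)
    (h14 : s'.reg 14 = s.reg 14 - 1)
    (m0 : s'.mem 0 = Function.update (s.mem 0) (s.reg 14 - 1) e.1)
    (m1 : s'.mem 1 = Function.update (s.mem 1) (s.reg 14 - 1) e.2.1)
    (m2 : s'.mem 2 = Function.update (s.mem 2) (s.reg 14 - 1) e.2.2.1)
    (m3 : s'.mem 3 = Function.update (s.mem 3) (s.reg 14 - 1) e.2.2.2) :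
    Emitted s' q ev (e :: od) := by
  have hst : ∀ i e', i ≠ s.reg 14 - 1 → Stores (n := n) s i e' → Stores s' i e' := by
    intro i e' hi he
    simpa [Stores, m0, m1, m2, m3, hi] using he
  refine ⟨by rw [h13, h.front], ?_, fun i hi => hst _ _ (by omega) (h.fst i hi), ?_⟩
  · have := h.back; rw [h14]; simp; omega
  · intro i hi
    rw [h14]
    cases i with
    | zero => simp [Stores, m0, m1, m2, m3]
    | succ i =>
      have e : s.reg 14 - 1 + (i + 1) = s.reg 14 + i := by omega
      rw [e]
      exact hst _ _ (by omega) (h.snd i (by simpa using hi))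

end Scanning

/-! ### Amortised cost of cutting off quadrangles -/

section ScanLoop

open RAM RAM.Program

variable {n : ℕ} {G : SimpleGraph (Fin n)} {f g : Fin n → Fin n}
  {s₂ s s' : State} {q : ℕ} {cur st rest : List (Fin n)} {future : List (List (Fin n))}
  {f' g' : Fin n → Fin n} {ev od : List (Fin n × Fin n × Fin n × Fin n)}

lemma StackHolds.top {k : List (Fin n)} {a b c d : Fin n} (h : StackHolds s (k ++ [a, b, c, d])) :
    3 < s.reg 15 ∧ s.reg 15 - 3 = k.length + 1 ∧ s.mem 8 (s.reg 15 - 4) = a ∧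
      s.mem 8 (s.reg 15 - 3) = b ∧ s.mem 8 (s.reg 15 - 2) = c ∧ s.mem 8 (s.reg 15 - 1) = d := by
  have hl := h.len
  simp only [List.length_append, List.length_cons, List.length_nil] at hl
  have h0 := h.val k.length (by simp)
  have h1 := h.val (k.length + 1) (by simp)
  have h2 := h.val (k.length + 2) (by simp)
  have h3 := h.val (k.length + 3) (by simp)
  simp at h0 h1 h2 h3
  refine ⟨by omega, by omega, ?_, ?_, ?_, ?_⟩
  · rw [show s.reg 15 - 4 = k.length by omega, h0]
  · rw [show s.reg 15 - 3 = k.length + 1 by omega, h1]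
  · rw [show s.reg 15 - 2 = k.length + 2 by omega, h2]
  · rw [show s.reg 15 - 1 = k.length + 3 by omega, h3]

/-- `ScanInv.reduce` carried out in memory. A flip of `f'` prolongs the path `ev` at its end,
whereas a flip of `g'`, read backwards, prolongs the path `od` at its beginning. -/
lemma Scanning.cut {k : List (Fin n)} {a b c d : Fin n}
    (h : Scanning G f g s₂ q rest future s (k ++ [a, b, c, d]) f' g' ev od)
    (h20 : s₂.reg 20 = 0) (h22 : s₂.reg 22 = 2) (h23 : s₂.reg 23 = 3)
    (hb : s.mem 7 b = 2) (hc : s.mem 7 c = 2) :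
    ∃ f₁ g₁ ev₁ od₁, Scanning G f g s₂ q rest future (tryCut.run s) (k ++ [a, d]) f₁ g₁ ev₁ od₁ ∧
      (tryCut.run s).reg 11 = 0 ∧ (tryCut.run s).reg 2 = s.reg 2 := by
  obtain ⟨t3, tk, ta, tb, tc, td⟩ := h.stack.top
  obtain ⟨u, hu, um, u16, u17, u18, u19, ur⟩ := (tryCut_run s
    (by rw [h.work.reg 22 (by simp), h22]) (by rw [h.work.reg 23 (by simp), h23])).1
    ⟨t3, by rw [tb, hb], by rw [tc, hc]⟩
  have hnd : (k ++ [a, b, c, d] ++ rest ++ future.flatten).Nodup := h.work.nodup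
  have hnd' := hnd
  simp only [List.append_assoc, List.cons_append, List.nil_append, List.nodup_append,
    List.nodup_cons, List.mem_cons, List.mem_append, not_or] at hnd'
  have nad : a ≠ d := by tauto
  rw [ta] at u16
  rw [tb] at u17
  rw [tc] at u18
  rw [td] at u19
  obtain ⟨c7, c8, c15, c11, cf, cg, cm, cr⟩ := cutQuad_run u
    (by rw [ur 20 (by simp), h.work.reg 20 (by simp), h20])
    (by rw [u16, u19]; exact fun e => nad (Fin.ext e))
  rw [← hu] at c7 c8 c15 c11 cf cg cm cr
  rw [um] at c7 c8 cf cg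
  rw [u16, u19] at c7
  rw [u19, ur 15 (by simp), tk] at c8
  rw [ur 15 (by simp)] at c15
  rw [u16, u17, u18, u19, ur 13 (by simp), ur 14 (by simp), h.work.mem 6 (by simp)] at cf cg
  have hD : ∀ x : Fin n, (tryCut.run s).mem 7 x =
      if x = d then s.mem 7 d - 1 else if x = a then s.mem 7 a - 1 else s.mem 7 x := by
    intro x
    simp [c7, Function.update_apply, Fin.val_inj]
  obtain ⟨f₁, g₁, hR⟩ := h.inv.reduce hb hc h.work.matef h.work.mateg
    (D' := fun x => (tryCut.run s).mem 7 x) (by simp [hD, nad]) (by simp [hD])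
    (fun x h1 h2 => by simp [hD, h1, h2])
  have hbud := h.work.budget
  have hback := h.work.emitted.back
  -- At least four vertices of the current cycle are left, so the budget still contains a flip and
  -- the gap in the output is not empty.
  have hlt : ev.length < s.reg 14 := by
    simp at hbud
    omega
  have hfut : ∀ x ∈ future.flatten, x ∉ [a, b, c, d] := by
    intro x hx hm
    exact (List.nodup_append.1 hnd).2.2 x (by simp at hm ⊢; tauto) x hx rfl
  have hready : ∀ b ∈ future, ∃ v t, b = v :: t ∧ s₂.cyc v = v + 1 ∧
      (∀ x ∈ t, s₂.cyc x ≠ x + 1) ∧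
      ScanInv G s₂.par (fun x => (tryCut.run s).mem 7 x) [] b f₁ g₁ := by
    intro b hb
    obtain ⟨v, t, rfl, h1, h2, h3⟩ := h.work.ready b hb
    refine ⟨v, t, rfl, h1, h2, h3.congr fun x hx => ?_⟩
    have hx' := hfut x (List.mem_flatten.2 ⟨_, hb, hx⟩)
    refine ⟨?_, hR.other x hx'⟩
    simp only [List.mem_cons, List.not_mem_nil, or_false, not_or] at hx'
    simp [hD, hx']
  have hdone : ∀ x, x ∉ k ++ [a, d] ++ rest → x ∉ future.flatten → f₁ x = g₁ x := by
    intro x hx hx'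
    by_cases hxb : x = b
    · rw [hxb]; exact hR.agree.1
    by_cases hxc : x = c
    · rw [hxc]; exact hR.agree.2
    simp only [List.mem_append, List.mem_cons, List.not_mem_nil, or_false, not_or] at hx
    rw [(hR.other x (by simp; tauto)).1, (hR.other x (by simp; tauto)).2]
    exact h.work.done x (by simp; tauto) hx'
  have hnodup : (k ++ [a, d] ++ rest ++ future.flatten).Nodup := by
    refine hnd.sublist ?_
    refine (List.Sublist.append_right ?_ _).append_right _
    refine List.Sublist.append_left ?_ _
    exact .cons_cons _ (.cons _ (.cons _ (.refl _)))
  have hmem : ∀ a ∈ [4, 5, 6], (tryCut.run s).mem a = s₂.mem a := fun a ha => by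
    rw [cm a ha, um, h.work.mem a ha]
  have hreg : ∀ k, k ∉ [2, 3, 8, 11, 12, 13, 14, 15, 16, 17, 18, 19] →
      (tryCut.run s).reg k = s₂.reg k := fun k hk => by
    rw [cr k (by simp at hk ⊢; omega), ur k (by simp at hk ⊢; omega), h.work.reg k hk]
  have hstack : StackHolds (tryCut.run s) (k ++ [a, d]) := by
    have hl := h.stack.len
    refine ⟨by rw [c15, hl]; simp, ?_⟩
    intro i hi
    simp only [List.length_append, List.length_cons, List.length_nil] at hi
    rw [c8, Function.update_apply]
    split_ifs with hi'
    · subst hi'; simp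
    · rw [h.stack.val i (by simp; omega)]
      rcases Nat.lt_or_ge i k.length with hik | hik
      · rw [List.getElem_append_left hik, List.getElem_append_left hik]
      · obtain rfl : i = k.length := by omega
        simp
  rcases hR.mem_par with hpa | hpa
  · obtain ⟨d13, d14, m0, m1, m2, m3⟩ := cf hpa
    obtain ⟨hflip, hg₁⟩ := hR.flipf hpa
    refine ⟨f₁, g₁, ev ++ [(a, b, c, d)], od, ⟨⟨hR.matef, hR.mateg,
      h.work.pathf.append ⟨f₁, hflip, rfl⟩, by rw [hg₁]; exact h.work.pathg, hready, hdone, hnodup,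
      h.work.emitted.push_front hlt d13 d14 m0 m1 m2 m3, ?_, hmem, hreg⟩, hR.inv, hstack⟩, c11,
      by rw [cr 2 (by simp), ur 2 (by simp)]⟩
    simp only [List.length_append, List.length_cons, List.length_nil] at hbud ⊢
    omega
  · obtain ⟨d13, d14, m0, m1, m2, m3⟩ := cg (by
      have : s₂.mem 6 a = 1 := hpa
      omega)
    obtain ⟨hflip, hf₁⟩ := hR.flipg hpa
    refine ⟨f₁, g₁, ev, (a, b, c, d) :: od, ⟨⟨hR.matef, hR.mateg,
      by rw [hf₁]; exact h.work.pathf, ⟨g', hflip, h.work.pathg⟩, hready, hdone, hnodup,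
      h.work.emitted.push_back hlt d13 d14 m0 m1 m2 m3, ?_, hmem, hreg⟩, hR.inv, hstack⟩, c11,
      by rw [cr 2 (by simp), ur 2 (by simp)]⟩
    simp only [List.length_append, List.length_cons, List.length_nil] at hbud ⊢
    omega

lemma Scanning.noCut (h : Scanning G f g s₂ q rest future s st f' g' ev od)
    (h22 : s₂.reg 22 = 2) (h23 : s₂.reg 23 = 3)
    (hn : ∀ (k : List (Fin n)) (a b c d : Fin n), st = k ++ [a, b, c, d] → ¬ (s.mem 7 b = 2 ∧ s.mem 7 c = 2)) :
    Scanning G f g s₂ q rest future (tryCut.run s) st f' g' ev od ∧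
      (tryCut.run s).reg 11 = 1 ∧ (tryCut.run s).reg 2 = s.reg 2 ∧
      TopIrred (fun x : Fin n => (tryCut.run s).mem 7 x) st := by
  obtain ⟨um, u11, ur⟩ := (tryCut_run s
    (by rw [h.work.reg 22 (by simp), h22]) (by rw [h.work.reg 23 (by simp), h23])).2 (by
      rintro ⟨h1, h2, h3⟩
      rw [h.stack.len] at h1
      obtain ⟨k, a, b, c, d, rfl⟩ := List.exists_append_four h1
      obtain ⟨t3, tk, ta, tb, tc, td⟩ := h.stack.top
      rw [tb] at h2
      rw [tc] at h3
      exact hn k a b c d rfl ⟨h2, h3⟩)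
  refine ⟨h.congr um fun k hk => ur k (by simp at hk ⊢; omega), u11, ur 2 (by simp), ?_⟩
  simp only [um]
  exact hn

lemma tryCut_size : tryCut.size ≤ 40 := by simp [tryCut, cutQuad]

variable (h20 : s₂.reg 20 = 0) (h22 : s₂.reg 22 = 2) (h23 : s₂.reg 23 = 3)
include h20 h22 h23

lemma exec_cutLoop (h : Scanning G f g s₂ q rest future s st f' g' ev od) (h11 : s.reg 11 = 0) :
    ∃ t s', Exec (.loop (.eq 11 20) tryCut) s t s' ∧
      (∃ st f' g' ev od, Scanning G f g s₂ q rest future s' st f' g' ev od ∧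
        TopIrred (fun x : Fin n => s'.mem 7 x) st) ∧ s'.reg 2 = s.reg 2 ∧
      t + 50 * s'.reg 15 ≤ 50 * s.reg 15 + 51 := by
  have hs20 : ∀ {s st f' g' ev od}, Scanning G f g s₂ q rest future s st f' g' ev od →
      s.reg 20 = 0 := fun h => by rw [h.work.reg 20 (by simp), h20]
  obtain ⟨t, s', e, ⟨st', f₁, g₁, ev₁, od₁, ⟨hI, h2⟩, hflag⟩, hb, ht⟩ :=
    exec_loop (b := .eq 11 20) (p := tryCut)
    (fun s' => ∃ st f' g' ev od, (Scanning G f g s₂ q rest future s' st f' g' ev od ∧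
      s'.reg 2 = s.reg 2) ∧ (s'.reg 11 = 0 ∨ (s'.reg 11 = 1 ∧
        TopIrred (fun x : Fin n => s'.mem 7 x) st)))
    -- Every cut removes two vertices from the stack, and the single failing attempt sets the flag;
    -- both lower the potential by at least 50, more than the 41 that one pass can cost.
    (fun s' => 50 * (s'.reg 15 + (1 - s'.reg 11))) (by
      rintro s' ⟨st, f', g', ev, od, ⟨hI, h2⟩, -⟩ hb
      rw [Test.holds_eq, hs20 hI] at hb
      obtain ⟨t, ht, e⟩ := exec_run tryCut s' (by simp [tryCut, cutQuad])
      have hsz := tryCut_size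
      have hlen := hI.stack.len
      by_cases hn : ∃ (k : List (Fin n)) (a b c d : Fin n), st = k ++ [a, b, c, d] ∧ s'.mem 7 b = 2 ∧ s'.mem 7 c = 2
      · obtain ⟨k, a, b, c, d, rfl, hb', hc'⟩ := hn
        obtain ⟨f₁, g₁, ev₁, od₁, hI', h11', h2'⟩ := hI.cut h20 h22 h23 hb' hc'
        refine ⟨t, _, e, ⟨_, _, _, _, _, ⟨hI', by rw [h2', h2]⟩, Or.inl h11'⟩, ?_⟩
        have hlen' := hI'.stack.len
        simp only [List.length_append, List.length_cons, List.length_nil] at hlen hlen'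
        omega
      · obtain ⟨hI', h11', h2', hirr⟩ := hI.noCut h22 h23 fun k a b c d hk hbc =>
          hn ⟨k, a, b, c, d, hk, hbc⟩
        refine ⟨t, _, e, ⟨_, _, _, _, _, ⟨hI', by rw [h2', h2]⟩, Or.inr ⟨h11', hirr⟩⟩, ?_⟩
        have hlen' := hI'.stack.len
        omega) s ⟨st, f', g', ev, od, ⟨h, rfl⟩, Or.inl h11⟩
  rw [Test.holds_eq, hs20 hI] at hb
  obtain ⟨h11', hirr⟩ := hflag.resolve_left hb
  refine ⟨t, s', e, ⟨_, _, _, _, _, hI, hirr⟩, h2, ?_⟩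
  simp only [h11, h11'] at ht
  omega

end ScanLoop

/-! ### The scan over all cycles -/

section ScanAll

open RAM RAM.Program

variable {n : ℕ} {G : SimpleGraph (Fin n)} {f g : Fin n → Fin n}
  {s₂ s s' : State} {q : ℕ} {cur st rest L : List (Fin n)} {future : List (List (Fin n))}
  {f' g' : Fin n → Fin n} {ev od : List (Fin n × Fin n × Fin n × Fin n)}

/-- The invariant of the scan between two vertices: `L` lists the vertices still to come. -/
def Between (G : SimpleGraph (Fin n)) (f g : Fin n → Fin n) (s₂ : State) (q : ℕ) (s : State)
    (L : List (Fin n)) : Prop :=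
  ∃ future f' g' ev od, (Work G f g s₂ q s [] future f' g' ev od ∧ future.flatten = L) ∨
    ∃ st x rest, Scanning G f g s₂ q (x :: rest) future s st f' g' ev od ∧
      TopIrred (fun x : Fin n => s.mem 7 x) st ∧ x :: rest ++ future.flatten = L ∧
      ∀ y ∈ x :: rest, s₂.cyc y ≠ y + 1

lemma Between.congr (h : Between G f g s₂ q s L) (hmem : s'.mem = s.mem)
    (hreg : ∀ k, k ≠ 2 → s'.reg k = s.reg k) : Between G f g s₂ q s' L := by
  have hreg' : ∀ l : List ℕ, 2 ∈ l → ∀ k, k ∉ l → s'.reg k = s.reg k := fun l hl k hk =>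
    hreg k fun e => hk (e ▸ hl)
  obtain ⟨future, f', g', ev, od, ⟨h1, h2⟩ | ⟨st, x, rest, h1, h2, h3⟩⟩ := h
  · exact ⟨future, f', g', ev, od, Or.inl ⟨h1.congr (fun a _ => by rw [hmem])
      (hreg' _ (by simp)), h2⟩⟩
  · exact ⟨future, f', g', ev, od, Or.inr ⟨st, x, rest, h1.congr hmem (hreg' _ (by simp)),
      by rw [hmem]; exact h2, h3⟩⟩

lemma Work.begin {b : List (Fin n)} (h : Work G f g s₂ q s [] (b :: future) f' g' ev od) :
    Work G f g s₂ q s b future f' g' ev od := by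
  refine ⟨h.matef, h.mateg, h.pathf, h.pathg, fun b' hb' => h.ready b' (by simp [hb']), ?_, ?_,
    h.emitted, ?_, h.mem, h.reg⟩
  · exact fun x h1 h2 => h.done x (by simp) (by
      rw [List.flatten_cons, List.mem_append]; tauto)
  · simpa using h.nodup
  · have := h.budget
    simp at this ⊢
    omega

/-- The two remaining vertices are matched to each other by both matchings, so `f'` and `g'` now
agree on the whole cycle. -/
lemma Scanning.finish (h : Scanning G f g s₂ q [] future s st f' g' ev od)
    (ht : TopIrred (fun x : Fin n => s.mem 7 x) st) :
    Work G f g s₂ q s [] future f' g' ev od := by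
  obtain ⟨x, y, rfl, hf, hg⟩ := h.inv.finish ht
  have w := h.work
  refine ⟨w.matef, w.mateg, w.pathf, w.pathg, w.ready, ?_, ?_, w.emitted, ?_, w.mem, w.reg⟩
  · intro z _ hz
    by_cases hx : z = x
    · rw [hx, hf, ← hg, w.mateg.invol]
    by_cases hy : z = y
    · rw [hy, hg, ← hf, w.matef.invol]
    exact w.done z (by simp [hx, hy]) hz
  · exact (List.nodup_append.1 w.nodup).2.1
  · have := w.budget
    simpa using this

lemma pushVertex_run (s : State) :
    (pushVertex.run s).mem 8 = Function.update (s.mem 8)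
      (if s.mem 5 (s.mem 4 (s.reg 2)) = s.mem 4 (s.reg 2) + 1 then 0 else s.reg 15)
      (s.mem 4 (s.reg 2)) ∧
    (pushVertex.run s).reg 15 =
      (if s.mem 5 (s.mem 4 (s.reg 2)) = s.mem 4 (s.reg 2) + 1 then 0 else s.reg 15) + 1 ∧
    (pushVertex.run s).reg 11 = 0 ∧ (∀ a, a ≠ 8 → (pushVertex.run s).mem a = s.mem a) ∧
    ∀ k, k ∉ [3, 8, 11, 12, 15] → (pushVertex.run s).reg k = s.reg k := by
  by_cases hc : s.mem 5 (s.mem 4 (s.reg 2)) = s.mem 4 (s.reg 2) + 1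
  all_goals
    refine ⟨?_, ?_, ?_, ?_, ?_⟩
    · simp [pushVertex, hc]
    · simp [pushVertex, hc]
    · simp [pushVertex]
    · intro a ha; simp [pushVertex, hc, ha]
    · intro k hk
      simp only [List.mem_cons, List.not_mem_nil, or_false, not_or] at hk
      simp [pushVertex, hc, hk]

/-- The label test succeeds at first vertices of cycles only, so the stack is emptied when a new
cycle begins and never within one. -/
lemma Between.push {x : Fin n} (h : Between G f g s₂ q s (x :: L))
    (hx : s₂.mem 4 (s.reg 2) = x) :
    (pushVertex.run s).reg 11 = 0 ∧ (pushVertex.run s).reg 2 = s.reg 2 ∧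
    (pushVertex.run s).reg 15 ≤ s.reg 15 + 1 ∧
    ∃ st rest future f' g' ev od,
      Scanning G f g s₂ q rest future (pushVertex.run s) st f' g' ev od ∧
      rest ++ future.flatten = L ∧ ∀ y ∈ rest, s₂.cyc y ≠ y + 1 := by
  obtain ⟨p8, p15, p11, pm, pr⟩ := pushVertex_run s
  refine ⟨p11, pr 2 (by simp), by rw [p15]; split_ifs <;> omega, ?_⟩
  have hpush : ∀ {cur future f' g' ev od}, Work G f g s₂ q s cur future f' g' ev od →
      s.mem 4 (s.reg 2) = x ∧ s.mem 5 x = s₂.cyc x ∧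
      Work G f g s₂ q (pushVertex.run s) cur future f' g' ev od := fun w =>
    ⟨by rw [w.mem 4 (by simp), hx], by rw [w.mem 5 (by simp)]; rfl,
      w.congr (fun a ha => pm a (by omega)) fun k hk => pr k (by simp at hk ⊢; omega)⟩
  obtain ⟨future, f', g', ev, od, ⟨h1, h2⟩ | ⟨st, y, rest, h1, h2, h3, h4⟩⟩ := h
  · cases future with
    | nil => simp at h2
    | cons b future =>
      obtain ⟨v, t, rfl, hv, ht, hinv⟩ := h1.ready b (by simp)
      have h3 : v = x ∧ t ++ future.flatten = L := by simpa using h2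
      obtain ⟨rfl, h3⟩ := h3
      obtain ⟨e4, e5, hw⟩ := hpush h1.begin
      rw [e4, e5, if_pos hv] at p8 p15
      refine ⟨[v], t, future, f', g', ev, od, ⟨hw, ?_, ?_⟩, h3, ht⟩
      · rw [pm 7 (by simp)]
        exact hinv.push (by simp [TopIrred])
      · refine ⟨by simp [p15], fun i hi => ?_⟩
        obtain rfl : i = 0 := by simpa using hi
        simp [p8]
  · have h3' : y = x ∧ rest ++ future.flatten = L := by simpa using h3
    obtain ⟨rfl, h3'⟩ := h3'
    obtain ⟨e4, e5, hw⟩ := hpush h1.work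
    rw [e4, e5, if_neg (h4 y (by simp))] at p8 p15
    refine ⟨st ++ [y], rest, future, f', g', ev, od, ⟨by simpa using hw, ?_, ?_⟩, h3',
      fun z hz => h4 z (by simp [hz])⟩
    · rw [pm 7 (by simp)]
      exact h1.inv.push h2
    · refine ⟨by simp [p15, h1.stack.len], fun i hi => ?_⟩
      rw [p8, h1.stack.len, Function.update_apply]
      split_ifs with hi'
      · subst hi'; simp
      · have hi2 : i < st.length := by simp at hi; omega
        rw [h1.stack.val i hi2, List.getElem_append_left hi2]

lemma Between.end (h : Between G f g s₂ q s []) :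
    ∃ qs : List (Fin n × Fin n × Fin n × Fin n), qs.length = q ∧ FlipPath G f qs g ∧
      (∀ i (hi : i < qs.length), Stores s i qs[i]) ∧
      ∀ k, k ∉ [2, 3, 8, 11, 12, 13, 14, 15, 16, 17, 18, 19] → s.reg k = s₂.reg k := by
  obtain ⟨future, f', g', ev, od, ⟨h1, h2⟩ | ⟨st, y, rest, h1, h2, h3, h4⟩⟩ := h
  · obtain rfl : future = [] := by
      cases future with
      | nil => rfl
      | cons b k =>
        obtain ⟨v, t, rfl, -⟩ := h1.ready b (by simp)
        simp at h2
    have hbud := h1.budget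
    have hback := h1.emitted.back
    simp at hbud
    -- With no cycle left the modified matchings coincide, so the two flip paths can be joined. The
    -- budget is used up, hence the two parts of the output abut.
    obtain rfl : f' = g' := funext fun x => h1.done x (by simp) (by simp)
    refine ⟨ev ++ od, by simp; omega, h1.pathf.append h1.pathg, fun i hi => ?_, h1.reg⟩
    rcases Nat.lt_or_ge i ev.length with hi' | hi'
    · rw [List.getElem_append_left hi']
      exact h1.emitted.fst i hi'
    · rw [List.getElem_append_right hi']
      have := h1.emitted.snd (i - ev.length) (by simp at hi; omega)
      rwa [show s.reg 14 + (i - ev.length) = i by omega] at this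
  · simp at h3

variable (h20 : s₂.reg 20 = 0) (h22 : s₂.reg 22 = 2) (h23 : s₂.reg 23 = 3)
include h20 h22 h23

lemma exec_scanVertex {x : Fin n} (h : Between G f g s₂ q s (x :: L))
    (hx : s₂.mem 4 (s.reg 2) = x) :
    ∃ t s', Exec scanVertex s t s' ∧ Between G f g s₂ q s' L ∧ s'.reg 2 = s.reg 2 + 1 ∧
      t + 50 * s'.reg 15 ≤ 50 * s.reg 15 + 120 := by
  obtain ⟨p11, p2, p15, st, rest, future, f', g', ev, od, hS, hL, hcyc⟩ := h.push hx
  obtain ⟨tp, htp, ep⟩ := exec_run pushVertex s (by simp [pushVertex])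
  obtain ⟨t, s', e, ⟨st', f₁, g₁, ev₁, od₁, hS', hirr⟩, h2, ht⟩ := exec_cutLoop h20 h22 h23 hS p11
  refine ⟨_, _, Exec.seq ep (Exec.seq e (Exec.succ s' 2 2)), ?_, by simp [h2, p2], ?_⟩
  · have hB : Between G f g s₂ q s' L := by
      cases rest with
      | nil => exact ⟨future, f₁, g₁, ev₁, od₁, Or.inl ⟨hS'.finish hirr, by simpa using hL⟩⟩
      | cons y rest => exact ⟨future, f₁, g₁, ev₁, od₁, Or.inr ⟨st', y, rest, hS', hirr, hL, hcyc⟩⟩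
    exact hB.congr rfl fun k hk => by simp [hk]
  · have hsz : pushVertex.size = 9 := by simp [pushVertex]
    simp
    omega

lemma exec_scan (hB : Between G f g s₂ q s₂ L) (hlen : L.length = s₂.reg 0)
    (h4 : ∀ i (hi : i < L.length), s₂.mem 4 i = L[i]) (hr2 : s₂.reg 2 = 0)
    (hr15 : s₂.reg 15 = 0) :
    ∃ t s, Exec (.loop (.lt 2 0) scanVertex) s₂ t s ∧ Between G f g s₂ q s [] ∧
      t ≤ 150 * L.length + 1 := by
  have hr0 : ∀ {s L}, Between G f g s₂ q s L → s.reg 0 = s₂.reg 0 := by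
    rintro s L ⟨future, f', g', ev, od, ⟨h1, -⟩ | ⟨st, y, rest, h1, -⟩⟩
    · exact h1.reg 0 (by simp)
    · exact h1.work.reg 0 (by simp)
  obtain ⟨t, s, e, ⟨hI, hle⟩, hb, ht⟩ := exec_loop (b := .lt 2 0) (p := scanVertex)
    (fun s => Between G f g s₂ q s (L.drop (s.reg 2)) ∧ s.reg 2 ≤ L.length)
    -- Each vertex is pushed once. Its 150 units cover its own scan step and deposit the 50 units on
    -- the stack from which later cuts are paid.
    (fun s => 50 * s.reg 15 + 150 * (L.length - s.reg 2)) (by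
      rintro s ⟨hI, hle⟩ hb
      rw [Test.holds_lt, hr0 hI, ← hlen] at hb
      rw [List.drop_eq_getElem_cons hb] at hI
      obtain ⟨t, s', e, hI', h2, ht⟩ := exec_scanVertex h20 h22 h23 hI (h4 _ hb)
      exact ⟨t, s', e, ⟨by rw [h2]; exact hI', by omega⟩, by omega⟩) s₂
    ⟨by simpa [hr2] using hB, by omega⟩
  rw [Test.holds_lt, hr0 hI, ← hlen] at hb
  rw [List.drop_eq_nil_of_le (by omega)] at hI
  exact ⟨t, s, e, hI, by simp only [hr2, hr15] at ht; omega⟩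

end ScanAll

/-! ### Correctness of the whole program -/

section Main

open RAM RAM.Program

variable {n : ℕ} {G : SimpleGraph (Fin n)} {f g : Fin n → Fin n}

/-- This allows a single comparison of totals to test all cycles at once. -/
lemma List.sum_map_eq_iff_of_le {α : Type*} {l : List α} {p r : α → ℕ} (h : ∀ b ∈ l, p b ≤ r b) :
    (l.map p).sum = (l.map r).sum ↔ ∀ b ∈ l, p b = r b := by
  induction l with
  | nil => simp
  | cons b l ih =>
    have ih := ih fun c hc => h c (by simp [hc])
    have hb := h b (by simp)
    have hle : (l.map p).sum ≤ (l.map r).sum :=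
      List.sum_le_sum fun c hc => h c (by simp [hc])
    simp only [List.map_cons, List.sum_cons, List.mem_cons, forall_eq_or_imp]
    rw [← ih]
    omega

/-- A cycle of the layout is a polygon with at most as many chords as a quadrangulation. -/
lemma Layout.polygon (hG : IsOuterplanar G) (hf : IsMate G f) (hg : IsMate G g)
    {par cyc : Fin n → ℕ} {bs : List (List (Fin n))} (h : Layout f g par cyc bs)
    {b : List (Fin n)} (hb : b ∈ bs) : ∃ v t, b = v :: t ∧ IsBlock f g par v t ∧
      (∀ x ∈ b, cyc x = v + 1) ∧ ChordPolygon (oppAdj G par) par b ∧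
      degSum (oppAdj G par) b + 4 ≤ 3 * b.length := by
  obtain ⟨v, t, rfl, hbl, hcyc⟩ := h.block b hb
  obtain ⟨θ, -, hnc, hpw⟩ := hbl.exists_nonCrossing hG hf hg
  have hp := hbl.chordPolygon hf hg hnc hpw
  exact ⟨v, t, rfl, hbl, hcyc, hp, ChordPolygon.degSum_le _ hp le_rfl⟩

/-- The number of counted chord ends is as large as possible if and only if every cycle is
quadrangulated. -/
lemma Layout.full_iff (hG : IsOuterplanar G) (hf : IsMate G f) (hg : IsMate G g)
    {par cyc : Fin n → ℕ} {bs : List (List (Fin n))} (h : Layout f g par cyc bs) :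
    (bs.map fun b => 3 * b.length - 4).sum = (bs.map fun b => degSum (oppAdj G par) b).sum ↔
      ∀ b ∈ bs, degSum (oppAdj G par) b + 4 = 3 * b.length := by
  rw [eq_comm, List.sum_map_eq_iff_of_le]
  · refine forall₂_congr fun b hb => ?_
    obtain ⟨-, -, -, -, -, -, hle⟩ := h.polygon hG hf hg hb
    omega
  · intro b hb
    obtain ⟨-, -, -, -, -, -, hle⟩ := h.polygon hG hf hg hb
    omega

/-- At the beginning of the scan, all cycles are still to come. -/
lemma Layout.work (hG : IsOuterplanar G) (hf : IsMate G f) (hg : IsMate G g) {s : State}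
    {bs : List (List (Fin n))} (h : Layout f g s.par s.cyc bs) (hall : ∀ x, x ∈ bs.flatten)
    (hfull : ∀ b ∈ bs, degSum (oppAdj G s.par) b + 4 = 3 * b.length)
    (hdeg : ∀ b ∈ bs, ∀ x ∈ b, s.mem 7 x = ldeg (oppAdj G s.par) b x)
    (h13 : s.reg 13 = 0) (h14 : s.reg 14 = (bs.map fun b => b.length / 2 - 1).sum) :
    Work G f g s (bs.map fun b => b.length / 2 - 1).sum s [] bs f g [] [] := by
  refine ⟨hf, hg, rfl, rfl, ?_, fun x _ hx => absurd (hall x) hx, by simpa using h.nodup,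
    ⟨by simp [h13], by simp [h14], by simp, by simp⟩, by simp, fun _ _ => rfl, fun _ _ => rfl⟩
  intro b hb
  obtain ⟨v, t, rfl, hbl, hcyc, hp, -⟩ := h.polygon hG hf hg hb
  refine ⟨v, t, rfl, hcyc v (by simp), fun x hx => ?_, hbl.scanInv hp (hfull _ hb) (hdeg _ hb)⟩
  rw [hcyc x (by simp [hx])]
  intro e
  have : v = x := Fin.ext (by omega)
  exact (List.nodup_cons.1 hbl.nodup).1 (this ▸ hx)

/-- What the program achieves. -/
structure Solves {G : SimpleGraph (Fin n)} (M N : G.Subgraph) (s : State) : Prop where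
  decides : (s.reg 0 = 1 ∧ Reconfigurable M N) ∨ (s.reg 0 = 0 ∧ ¬ Reconfigurable M N)
  outputs : s.reg 0 = 1 → s.reg 1 ≤ n ∧ OutputsReconfSeq M N s

lemma Solves.of_flipPath {s : State} {qs : List (Fin n × Fin n × Fin n × Fin n)}
    (hpath : FlipPath G f qs g) (h0 : s.reg 0 = 1) (h1 : s.reg 1 = qs.length)
    (hn : qs.length ≤ n) (hst : ∀ i (hi : i < qs.length), Stores s i qs[i]) :
    Solves (mateSub G f) (mateSub G g) s := by
  obtain ⟨S, hS0, hS1, hS⟩ := hpath.exists_seq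
  have hseq : IsReconfSeq (mateSub G f) (mateSub G g) qs.length S :=
    ⟨hS0, hS1, fun i hi => ⟨_, _, _, _, hS i hi⟩⟩
  refine ⟨Or.inl ⟨h0, _, S, hseq⟩, fun _ => ⟨by omega, S, by rwa [h1], ?_⟩⟩
  intro i hi
  rw [h1] at hi
  obtain ⟨e0, e1, e2, e3⟩ := hst i hi
  exact ⟨_, _, _, _, e0, e1, e2, e3, hS i hi⟩

lemma sum_half_le (bs : List (List (Fin n))) :
    (bs.map fun b => b.length / 2 - 1).sum ≤ bs.flatten.length := by
  rw [List.length_flatten]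
  exact List.sum_le_sum fun b _ => by omega

/-- The comparison of totals decides whether all cycles are quadrangulated. If so, the scan produces
a flip path; if not, `IsBlock.degSum_eq_of_reconfigurable` rules out a reconfiguration. Visiting,
counting and scanning take at most `50n + 1`, `20|E| + 1` and `150n + 1` steps, apart from a
constant. -/
theorem exec_reconfProgram (hG : IsOuterplanar G) {L : List (Fin n × Fin n)}
    (hL : IsEdgeList G L) (hf : IsMate G f) (hg : IsMate G g) :
    ∃ t s, Exec reconfProgram (inputState L f g) t s ∧ t ≤ 300 * (n + L.length + 1) ∧
      Solves (mateSub G f) (mateSub G g) s := by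
  set sA := (((inputState L f g).setReg 21 1).setReg 22 2).setReg 23 3 with hsA
  have eA : Exec (const 21 1 ;; const 22 2 ;; const 23 3) (inputState L f g) (1 + (1 + 1)) sA :=
    Exec.seq (.const _ _ _) (Exec.seq (.const _ _ _) (.const _ _ _))
  have hregA : ∀ k, k ∉ [0, 1, 21, 22, 23] → sA.reg k = 0 := by
    intro k hk
    simp only [List.mem_cons, List.not_mem_nil, or_false, not_or] at hk
    simp only [hsA, State.reg_setReg, hk, if_false]
    unfold inputState
    match k with
    | 0 => omega
    | 1 => omega
    | k + 2 => rfl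
  have hmemA : ∀ a i, 4 ≤ a → sA.mem a i = 0 := by
    intro a i ha
    match a with
    | a + 4 => rfl
  obtain ⟨tB, sB, bs, eB, hV, hall, htB⟩ := exec_visit hf hg (s₀ := sA)
    (fun x => by simp [hsA, inputState]) (fun x => by simp [hsA, inputState])
    (hregA 20 (by simp)) (by simp [hsA]) (by simp [hsA, inputState]) (hregA 2 (by simp))
    (hregA 5 (by simp)) (hregA 6 (by simp)) (hregA 7 (by simp)) (fun x => hmemA _ _ (by simp))
    (fun x => hmemA _ _ (by simp))
  set sC := sB.setReg 2 0 with hsC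
  have hmemC : ∀ a, a ∉ [4, 5, 6] → sC.mem a = sA.mem a := fun a ha => hV.frame.mem a ha
  have hregC : ∀ k, k ∉ [2, 3, 4, 5, 6, 7, 8, 10, 11] → sC.reg k = sA.reg k := fun k hk => by
    rw [← hV.frame.reg k hk, hsC, State.reg_setReg, if_neg (by simp at hk; omega)]
  obtain ⟨tD, sD, eD, hCt, htD⟩ := exec_count hL (s₁ := sC)
    (fun i hi => by rw [hmemC 0 (by simp)]; simp [hsA, inputState, hi])
    (fun i hi => by rw [hmemC 1 (by simp)]; simp [hsA, inputState, hi])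
    (fun x => by rw [hmemC 7 (by simp)]; exact hmemA _ _ (by simp))
    (by rw [hregC 1 (by simp)]; simp [hsA, inputState])
    (by simp [hsC]) (by rw [hregC 9 (by simp)]; exact hregA 9 (by simp))
  have hlay : Layout f g sC.par sC.cyc bs := hV.layout
  have h6 : sD.reg 6 = (bs.map fun b => 3 * b.length - 4).sum := by
    rw [hCt.reg 6 (by simp)]; exact hV.need
  have h7 : sD.reg 7 = (bs.map fun b => b.length / 2 - 1).sum := by
    rw [hCt.reg 7 (by simp)]; exact hV.quads
  have hcount : ∀ x : Fin n, sD.mem 7 x = (counted sC.par sC.cyc L x).card := by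
    intro x
    rw [hCt.deg, List.take_length]
  have h9 : sD.reg 9 = (bs.map fun b => degSum (oppAdj G sC.par) b).sum := by
    rw [hCt.total, ← hlay.sum_eq hall hL]
    exact Finset.sum_congr rfl fun x _ => hcount x
  have hpre : ∀ {t s}, Exec (.ite (.eq 6 9)
      ((const 2 0 ;; copy 14 7) ;; loop (.lt 2 0) scanVertex ;; (const 0 1 ;; copy 1 7))
      (const 0 0)) sD t s → Exec reconfProgram (inputState L f g)
        (1 + (1 + 1) + (tB + (1 + (tD + t)))) s := fun e =>
    Exec.seq eA (Exec.seq eB (Exec.seq (Exec.const _ _ _) (Exec.seq eD e)))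
  -- By `Layout.full_iff` this is the condition that the program tests, since each cycle separately
  -- satisfies the inequality.
  by_cases hfull : ∀ b ∈ bs, degSum (oppAdj G sC.par) b + 4 = 3 * b.length
  · have hn : bs.flatten.length = n := by
      have h1 := List.toFinset_card_of_nodup hlay.nodup
      have h2 : bs.flatten.toFinset = Finset.univ := by
        ext x; simp only [Finset.mem_univ, List.mem_toFinset, hall x]
      rw [h2] at h1
      simpa using h1.symm
    set s₂ := (sD.setReg 2 0).setReg 14 (sD.reg 7) with hs₂
    have hreg₂ : ∀ k, k ∉ [2, 3, 4, 5, 6, 7, 8, 9, 10, 11, 12, 14] → s₂.reg k = sA.reg k := by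
      intro k hk
      simp only [List.mem_cons, List.not_mem_nil, or_false, not_or] at hk
      rw [← hregC k (by simp [hk]), ← hCt.reg k (by simp [hk])]
      simp [hs₂, hk]
    have hmem₂ : ∀ a, a ≠ 7 → s₂.mem a = sC.mem a := fun a ha => hCt.mem a ha
    have hpar : (s₂.par : Fin n → ℕ) = sC.par := by
      funext x; simp only [State.par, hmem₂ 6 (by simp)]
    have hcyc : (s₂.cyc : Fin n → ℕ) = sC.cyc := by
      funext x; simp only [State.cyc, hmem₂ 5 (by simp)]
    have hlay₂ : Layout f g s₂.par s₂.cyc bs := by rw [hpar, hcyc]; exact hlay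
    have hW := hlay₂.work hG hf hg hall (by rw [hpar]; exact hfull) (by
      intro b hb x hx
      rw [hpar, ← hlay.card_counted hall hL hb hx]
      exact hcount x) (by rw [hreg₂ 13 (by simp)]; exact hregA 13 (by simp))
      (by simp [hs₂, h7])
    obtain ⟨tE, sE, eE, hB, htE⟩ := exec_scan (L := bs.flatten)
      (by rw [hreg₂ 20 (by simp)]; exact hregA 20 (by simp))
      (by rw [hreg₂ 22 (by simp)]; simp [hsA]) (by rw [hreg₂ 23 (by simp)]; simp [hsA])
      ⟨bs, f, g, [], [], Or.inl ⟨hW, rfl⟩⟩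
      (by rw [hn, hreg₂ 0 (by simp)]; simp [hsA, inputState])
      (fun i hi => by rw [hmem₂ 4 (by simp)]; exact hV.listed.val i hi) (by simp [hs₂])
      (by rw [hreg₂ 15 (by simp)]; exact hregA 15 (by simp))
    obtain ⟨qs, hlen, hpath, hst, hregE⟩ := hB.end
    have hbr : (Test.eq 6 9).Holds sD := by
      rw [Test.holds_eq, h6, h9, hlay.full_iff hG hf hg]; exact hfull
    have eC : Exec (const 2 0 ;; copy 14 7) sD (1 + 1) s₂ := by
      have := Exec.seq (Exec.const sD 2 0) (Exec.copy _ 14 7)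
      simpa using this
    refine ⟨_, _, hpre (Exec.ite_true hbr (Exec.seq eC (Exec.seq eE (Exec.seq
      (Exec.const _ _ _) (Exec.copy _ _ _))))), by omega, Solves.of_flipPath hpath ?_ ?_ ?_ hst⟩
    · simp
    · rw [hlen, ← h7]
      simp [hregE 7 (by simp), hs₂]
    · rw [hlen]
      exact (sum_half_le bs).trans_eq hn
  · have hbr : ¬ (Test.eq 6 9).Holds sD := by
      rw [Test.holds_eq, h6, h9, hlay.full_iff hG hf hg]; exact hfull
    refine ⟨_, _, hpre (Exec.ite_false hbr (Exec.const _ _ _)), by omega,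
      Or.inr ⟨by simp, fun hrec => hfull fun b hb => ?_⟩, by simp⟩
    obtain ⟨v, t, rfl, hbl, -⟩ := hlay.block b hb
    exact hbl.degSum_eq_of_reconfigurable hG hf.isPerfectMatching hg.isPerfectMatching hf hg
      (fun v => (hf.mateSub_adj _ _).2 rfl) (fun v => (hg.mateSub_adj _ _).2 rfl) hrec

end Main

/-- There is one program that decides Perfect Matching Reconfiguration on outerplanar graphs in time
linear in the number of vertices and edges (answer in register 0), and for YES-instances outputs,
within that time, a reconfiguration sequence of length linear in the number of vertices. -/
theorem mainTheorem4 :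
    ∃ (P : RAM.Program) (C : ℕ), ∀ (n : ℕ) (G : SimpleGraph (Fin n)) (L : List (Fin n × Fin n))
      (Mini Mtar : G.Subgraph) (mateIni mateTar : Fin n → Fin n),
      IsOuterplanar G → IsEdgeList G L →
      Mini.IsPerfectMatching → Mtar.IsPerfectMatching →
      IsMateFun Mini mateIni → IsMateFun Mtar mateTar →
      ∃ (t : ℕ) (s : RAM.State),
        RAM.Exec P (inputState L mateIni mateTar) t s ∧
        t ≤ C * (n + L.length + 1) ∧
        (Reconfigurable Mini Mtar → s.reg 0 = 1) ∧
        (¬ Reconfigurable Mini Mtar → s.reg 0 = 0) ∧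
        (Reconfigurable Mini Mtar →
          s.reg 1 ≤ C * n ∧ OutputsReconfSeq Mini Mtar s) := by
  refine ⟨reconfProgram, 300, ?_⟩
  intro n G L Mini Mtar mateIni mateTar hG hL hMini hMtar hini htar
  -- A perfect matching is determined by its partner function, so the subgraphs can be replaced by
  -- the input arrays.
  obtain ⟨hf, rfl⟩ := eq_mateSub hMini hini
  obtain ⟨hg, rfl⟩ := eq_mateSub hMtar htar
  obtain ⟨t, s, e, ht, hdec, hout⟩ := exec_reconfProgram hG hL hf hg
  have h1 : Reconfigurable (mateSub G mateIni) (mateSub G mateTar) → s.reg 0 = 1 := fun h =>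
    hdec.elim (fun h => h.1) fun h' => absurd h h'.2
  refine ⟨t, s, e, ht, h1, fun h => ?_, fun h => ?_⟩
  · exact hdec.elim (fun h' => absurd h'.2 h) fun h => h.1
  · obtain ⟨h2, h3⟩ := hout (h1 h)
    exact ⟨by omega, h3⟩
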